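/- **Setting.** A *splice diagram* $\Gamma$ is a finite tree with at least one vertex of valency greater than one (such vertices are called *nodes*; vertices of valency one are *leaves*) and no vertex of valency two, together with a positive integer weight $d_{v,e}$ for every node $v$ and every edge $e$ in the star of $v$ (the set of edges at $v$). Write $d_v=\prod_{e\ni v} d_{v,e}$, and let $\delta_v$ be the valency of $v$. For vertices $u,v$, the *linking number* $\ell_{u,v}$ is the product of all weights $d_{x,e}$ where $x$ is a node on the geodesic $[u,v]$ and $e$ is an edge at $x$ not contained in $[u,v]$ (so $\ell_{v,v}=d_v$ for a node $v$). Let $n$ be the number of leaves and let $(w_\lambda)_\lambda$ be the standard basis of $\mathbb{Z}^n$, indexed by the leaves; for each node $v$ put $w_v=\sum_{\lambda}\ell_{v,\lambda}\,w_\lambda\in\mathbb{Z}^n$. The diagram is *coprime* if for each node the weights of distinct edges at it are coprime. It satisfies the *edge determinant condition* if $d_{u,[u,v]}\,d_{v,[u,v]}>\ell_{u,v}$ for all adjacent nodes $u,v$, and the *semigroup condition* if for every node $v$ and edge $e$ at $v$ the number $d_v$ lies in the subsemigroup of $(\mathbb{N},+)$ generated by the $\ell_{v,\lambda}$, where $\lambda$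 runs over the leaves with $e\subseteq[v,\lambda]$. If $\Gamma$ satisfies both of these conditions, a *splice type system* $\mathcal{S}(\Gamma)$ is a family of convergent power series $$F_{v,i}=\sum_{e\ni v} c_{v,e,i}\,z^{m_{v,e}}+g_{v,i}\in\mathcal{O}=\mathbb{C}\{z_\lambda:\lambda\text{ a leaf}\},\qquad v\text{ a node},\ 1\le i\le \delta_v-2,$$ such that: $m_{v,e}\in\mathbb{N}^n$ involves only leaves $\lambda$ with $e\subseteq[v,\lambda]$, and $w_v\cdot m_{v,e}=d_v$; for each node $v$ all maximal minors of the matrix $(c_{v,e,i})_{e,i}$ are non-zero; and every exponent $m$ in the support of $g_{v,i}\in\mathcal{O}$ satisfies $w_v\cdot m>d_v$ and $w_u\cdot m>\ell_{u,v}$ for each node $u\ne v$. Let $I\subseteq\mathcal{O}$ be the ideal generated by the system and $(X,0)\subset(\mathbb{C}^n,0)$ the germ it defines. For $w\in(\mathbb{R}_{\ge0})^n$ the $w$-initial form of $f\in\mathcal O$ is the sum of its terms of minimal $w$-weight, and $\mathrm{in}_w I$ is the ideal generated by the $w$-initial forms of all elements of $I$. The *local tropicalization* of $I$ is the set of $w\in(\mathbb{R}_{\ge0})^n$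 such that $\mathrm{in}_wI$ contains no monomial; the *positive local tropicalization* is its intersection with $(\mathbb{R}_{>0})^n$. A *tropicalizing fan* is a finite rational polyhedral fan whose support is the local tropicalization, whose maximal cones have dimension $\dim X$ and meet $(\mathbb{R}_{>0})^n$, and such that $\mathrm{in}_wI$ is constant for $w$ in the relative interior of each cone. The *tropical multiplicity* at a top-dimensional cone $\tau$ is the number of irreducible components, counted with multiplicity, of the subscheme of $(\mathbb{C}^*)^n$ defined by $\mathrm{in}_wI$, for $w$ in the relative interior of $\tau$ (then $w$ has positive entries, and $\mathrm{in}_wI$ is generated by polynomials). The *splice fan* of $\Gamma$ is the fan whose top-dimensional cones are $\mathbb{R}_{\ge0}w_u+\mathbb{R}_{\ge0}w_v$ for the edges $[u,v]$ of $\Gamma$. **Theorem.** Let $\Gamma$ be a coprime splice diagram. Then: 1. For each node $v$ of $\Gamma$ the vector $w_v\in\mathbb{Z}^n$ is primitive. 2. Suppose that $\Gamma$ satisfies the edge determinant and semigroup conditions, and let $\mathcal{S}(\Gamma)$ be any splice type system for $\Gamma$. Then all tropical multiplicities of the positive local tropicalization of $\mathcal{S}(\Gamma)$ equal one. That is, for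 every tropicalizing fan of the germ defined by $\mathcal{S}(\Gamma)$ the tropical multiplicity at each of its top-dimensional cones is one; and for every edge $[u,v]$ of $\Gamma$, each $w$ in the relative interior of the cone $\mathbb{R}_{\ge0}w_u+\mathbb{R}_{\ge0}w_v$ of the splice fan belongs to the positive local tropicalization, and the subscheme of $(\mathbb{C}^*)^n$ defined by $\mathrm{in}_wI$ has exactly one irreducible component, counted with multiplicity. -/

import Mathlib

noncomputable section

/-! ### Convergent power series, initial ideals, local tropicalization -/

section LocalTropicalization

variable {σ : Type*}

/-- A complex power series in the variables `σ` is convergent (near the origin) if it converges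
absolutely on some polydisc of positive radius `r`. -/
def IsConvergentSeries (f : MvPowerSeries σ ℂ) : Prop :=
  ∃ r : ℝ, 0 < r ∧ Summable fun m : σ →₀ ℕ => ‖MvPowerSeries.coeff m f‖ * r ^ m.degree

lemma IsConvergentSeries.exists_le {f : MvPowerSeries σ ℂ} {r s : ℝ}
    (hf : Summable fun m : σ →₀ ℕ => ‖MvPowerSeries.coeff m f‖ * r ^ m.degree)
    (hs : 0 < s) (hsr : s ≤ r) :
    Summable fun m : σ →₀ ℕ => ‖MvPowerSeries.coeff m f‖ * s ^ m.degree :=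
  Summable.of_nonneg_of_le (fun m => by positivity) (fun m => by gcongr) hf

lemma IsConvergentSeries.of_norm_coeff_le {f g : MvPowerSeries σ ℂ} (hf : IsConvergentSeries f)
    (h : ∀ m, ‖MvPowerSeries.coeff m g‖ ≤ ‖MvPowerSeries.coeff m f‖) : IsConvergentSeries g := by
  obtain ⟨r, hr, hf⟩ := hf
  exact ⟨r, hr, Summable.of_nonneg_of_le (fun m => by positivity)
    (fun m => mul_le_mul_of_nonneg_right (h m) (by positivity)) hf⟩

lemma IsConvergentSeries.monomial (m : σ →₀ ℕ) (c : ℂ) :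
    IsConvergentSeries (MvPowerSeries.monomial m c) := by
  classical
  refine ⟨1, one_pos, summable_of_ne_finset_zero (s := {m}) fun k hk => ?_⟩
  have : k ≠ m := by simpa using hk
  simp [MvPowerSeries.coeff_monomial, this]

lemma IsConvergentSeries.add {f g : MvPowerSeries σ ℂ} (hf : IsConvergentSeries f)
    (hg : IsConvergentSeries g) : IsConvergentSeries (f + g) := by
  obtain ⟨r, hr, hf⟩ := hf
  obtain ⟨s, hs, hg⟩ := hg
  have ht : 0 < min r s := lt_min hr hs
  refine ⟨min r s, ht, Summable.of_nonneg_of_le (fun m => by positivity) (fun m => ?_)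
    ((exists_le hf ht (min_le_left _ _)).add (exists_le hg ht (min_le_right _ _)))⟩
  rw [map_add, ← add_mul]
  exact mul_le_mul_of_nonneg_right (norm_add_le _ _) (by positivity)

lemma IsConvergentSeries.mul {f g : MvPowerSeries σ ℂ} (hf : IsConvergentSeries f)
    (hg : IsConvergentSeries g) : IsConvergentSeries (f * g) := by
  classical
  obtain ⟨r, hr, hf⟩ := hf
  obtain ⟨s, hs, hg⟩ := hg
  have ht : 0 < min r s := lt_min hr hs
  have hf' := exists_le hf ht (min_le_left _ _)
  have hg' := exists_le hg ht (min_le_right _ _)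
  have h := summable_sum_mul_antidiagonal_of_summable_mul (A := σ →₀ ℕ)
    (Summable.mul_of_nonneg hf' hg' (fun m => mul_nonneg (norm_nonneg _) (pow_nonneg ht.le _))
      (fun m => mul_nonneg (norm_nonneg _) (pow_nonneg ht.le _)))
  refine ⟨min r s, ht, Summable.of_nonneg_of_le
    (fun m => mul_nonneg (norm_nonneg _) (pow_nonneg ht.le _)) (fun m => ?_) h⟩
  rw [MvPowerSeries.coeff_mul]
  refine (mul_le_mul_of_nonneg_right (norm_sum_le _ _) (pow_nonneg ht.le _)).trans ?_
  rw [Finset.sum_mul]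
  refine Finset.sum_le_sum fun kl hkl => le_of_eq ?_
  have hm : m.degree = kl.1.degree + kl.2.degree := by
    rw [← Finset.HasAntidiagonal.mem_antidiagonal.1 hkl, map_add]
  rw [hm, pow_add, norm_mul, mul_mul_mul_comm]

variable (σ) in
/-- The ring `𝒪 = ℂ{z_i : i ∈ σ}` of convergent power series near the origin. -/
def ConvergentSeries : Subalgebra ℂ (MvPowerSeries σ ℂ) where
  carrier := {f | IsConvergentSeries f}
  mul_mem' := IsConvergentSeries.mul
  add_mem' := IsConvergentSeries.add
  algebraMap_mem' c := IsConvergentSeries.monomial 0 c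

/-- The monomial `z^m`, as an element of `𝒪`. -/
def ConvergentSeries.zpow (m : σ →₀ ℕ) : ConvergentSeries σ :=
  ⟨MvPowerSeries.monomial m 1, IsConvergentSeries.monomial m 1⟩

variable [Fintype σ]

/-- The `w`-weight `w · m` of the exponent `m`. -/
def weightPairing (w : σ → ℝ) (m : σ →₀ ℕ) : ℝ := ∑ i, w i * m i

open Classical in
/-- The sum of the terms of minimal `w`-weight of a power series. -/
def initialSeries (w : σ → ℝ) (f : MvPowerSeries σ ℂ) : MvPowerSeries σ ℂ := fun m =>
  if ∀ k, MvPowerSeries.coeff k f ≠ 0 → weightPairing w m ≤ weightPairing w k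
  then MvPowerSeries.coeff m f else 0

lemma IsConvergentSeries.initialSeries (w : σ → ℝ) {f : MvPowerSeries σ ℂ}
    (hf : IsConvergentSeries f) : IsConvergentSeries (initialSeries w f) := by
  classical
  refine hf.of_norm_coeff_le fun m => ?_
  have : MvPowerSeries.coeff m (_root_.initialSeries w f) =
      if ∀ k, MvPowerSeries.coeff k f ≠ 0 → weightPairing w m ≤ weightPairing w k
      then MvPowerSeries.coeff m f else 0 := rfl
  rw [this]
  split_ifs <;> simp

/-- The `w`-initial form of a convergent power series. -/
def initialForm (w : σ → ℝ) (f : ConvergentSeries σ) : ConvergentSeries σ :=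
  ⟨initialSeries w f, IsConvergentSeries.initialSeries w f.2⟩

/-- The `w`-initial ideal of `I` in `𝒪`: the ideal generated by the `w`-initial forms of all the
elements of `I`. -/
def initialIdeal (w : σ → ℝ) (I : Ideal (ConvergentSeries σ)) : Ideal (ConvergentSeries σ) :=
  Ideal.span (initialForm w '' (I : Set (ConvergentSeries σ)))

/-- The local tropicalization of (the germ at the origin defined by) `I`: the nonnegative weight
vectors `w` for which the `w`-initial ideal contains no monomial. -/
def localTrop (I : Ideal (ConvergentSeries σ)) : Set (σ → ℝ) :=
  {w | (∀ i, 0 ≤ w i) ∧ ∀ m : σ →₀ ℕ, ConvergentSeries.zpow m ∉ initialIdeal w I}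

/-- The positive local tropicalization of `I`. -/
def positiveLocalTrop (I : Ideal (ConvergentSeries σ)) : Set (σ → ℝ) :=
  localTrop I ∩ {w | ∀ i, 0 < w i}

/-- A finite rational polyhedral fan in `ℝ^σ`. (Strict convexity of the cones is not required
here; it is automatic for cones contained in the nonnegative orthant.) -/
structure IsRationalFan (F : Set (PointedCone ℝ (σ → ℝ))) : Prop where
  finite : F.Finite
  rational : ∀ τ ∈ F, ∃ S : Finset (σ → ℤ),
    τ = PointedCone.hull ℝ ((fun (x : σ → ℤ) (i : σ) => (x i : ℝ)) '' (S : Set (σ → ℤ)))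
  face_mem : ∀ τ ∈ F, ∀ τ' : PointedCone ℝ (σ → ℝ), τ'.IsFaceOf τ → τ' ∈ F
  inter_face : ∀ τ ∈ F, ∀ τ' ∈ F, (τ ⊓ τ').IsFaceOf τ ∧ (τ ⊓ τ').IsFaceOf τ'

/-- The relative interior of a cone. -/
def relInterior (τ : PointedCone ℝ (σ → ℝ)) : Set (σ → ℝ) :=
  intrinsicInterior ℝ (τ : Set (σ → ℝ))

/-- `F` is a tropicalizing fan for the germ defined by `I`. The dimension of the germ is the Krull
dimension of its local ring `𝒪 / I`. -/
structure IsTropicalizingFan (I : Ideal (ConvergentSeries σ))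
    (F : Set (PointedCone ℝ (σ → ℝ))) : Prop where
  isFan : IsRationalFan F
  support_eq : (⋃ τ ∈ F, (τ : Set (σ → ℝ))) = localTrop I
  dim_eq : ∀ τ, Maximal (· ∈ F) τ →
    ((Module.finrank ℝ (Submodule.span ℝ (τ : Set (σ → ℝ))) : ℕ) : WithBot ℕ∞) =
      ringKrullDim (ConvergentSeries σ ⧸ I)
  meets_positive : ∀ τ, Maximal (· ∈ F) τ → ∃ w ∈ τ, ∀ i, 0 < w i
  initialIdeal_eq : ∀ τ ∈ F, ∀ w ∈ relInterior τ, ∀ w' ∈ relInterior τ,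
    initialIdeal w I = initialIdeal w' I

/-- The coordinate ring `ℂ[z_i^{±1} : i ∈ σ]` of the torus `(ℂ^*)^σ`. -/
abbrev TorusRing (σ : Type*) : Type _ := AddMonoidAlgebra ℂ (σ →₀ ℤ)

/-- The inclusion of polynomials into Laurent polynomials. -/
def toTorusRing : MvPolynomial σ ℂ →ₐ[ℂ] TorusRing σ :=
  MvPolynomial.aeval fun i => AddMonoidAlgebra.single (Finsupp.single i (1 : ℤ)) (1 : ℂ)

/-- For a weight vector `w` with positive entries all `w`-initial forms are polynomials; this is the
ideal of the intersection of the `w`-initial degeneration of the germ with the torus. -/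
def torusInitialIdeal (w : σ → ℝ) (I : Ideal (ConvergentSeries σ)) : Ideal (TorusRing σ) :=
  Ideal.span {q | ∃ p : MvPolynomial σ ℂ, ∃ f ∈ I,
    (p : MvPowerSeries σ ℂ) = (initialForm w f : MvPowerSeries σ ℂ) ∧ q = toTorusRing p}

end LocalTropicalization

/-- The multiplicity along the component `P` of the subscheme of `Spec R` defined by `J`: the length
of the local ring of that subscheme at the generic point of the component. -/
def componentMultiplicity {R : Type*} [CommRing R] (J P : Ideal R) [P.IsPrime] : ℕ∞ :=
  Module.length (Localization.AtPrime P)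
    (Localization.AtPrime P ⧸ J.map (algebraMap R (Localization.AtPrime P)))

/-- The number of irreducible components, counted with multiplicity, of the subscheme of `Spec R`
defined by `J` (for `R` Noetherian, so that there are finitely many components). -/
def componentCount {R : Type*} [CommRing R] (J : Ideal R) : ℕ∞ :=
  ∑ᶠ P : {P : Ideal R // J.IsMinimalPrime P},
    haveI : P.1.IsPrime := P.2.isPrime
    componentMultiplicity J P.1

/-- The number of irreducible components, counted with multiplicity, of `in_w Y ∩ (ℂ^*)^σ`, where
`Y` is the germ defined by `I`. For `w` in the relative interior of a top-dimensional cone `τ` of a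
tropicalizing fan this is the tropical multiplicity at `τ`. -/
def tropicalMultiplicity {σ : Type*} [Fintype σ] (I : Ideal (ConvergentSeries σ)) (w : σ → ℝ) :
    ℕ∞ :=
  componentCount (torusInitialIdeal w I)

/-- A vector of a lattice `ℤ^ι` is primitive if it is not a multiple `k • x` with `k ≠ ±1`. -/
def IsPrimitiveVector {ι : Type*} (w : ι → ℤ) : Prop :=
  ∀ (k : ℤ) (x : ι → ℤ), w = k • x → IsUnit k

/-! ### Splice diagrams -/

/-- A splice diagram: a finite tree with at least one node and no vertex of valency two, with a
positive integer weight on each edge of the star of each node. An edge of the star of `v` is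
encoded by its other endpoint; the values of `weight` at leaves are irrelevant. -/
structure SpliceDiagram (V : Type*) [Fintype V] where
  graph : SimpleGraph V
  isTree : graph.IsTree
  valency_ne_two : ∀ v, Nat.card (graph.neighborSet v) ≠ 2
  exists_node : ∃ v, 1 < Nat.card (graph.neighborSet v)
  weight : (v : V) → graph.neighborSet v → ℕ
  weight_pos : ∀ v, 1 < Nat.card (graph.neighborSet v) → ∀ e, 0 < weight v e

namespace SpliceDiagram

variable {V : Type*} [Fintype V] (Γ : SpliceDiagram V)

/-- The number of edges at `v`. -/
def valency (v : V) : ℕ := Nat.card (Γ.graph.neighborSet v)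

/-- The nodes. -/
abbrev Node : Type _ := {v : V // 1 < Γ.valency v}

/-- The leaves. -/
abbrev Leaf : Type _ := {v : V // Γ.valency v = 1}

/-- The star of `v`; its edges are encoded by their endpoints other than `v`. -/
abbrev Star (v : V) : Type _ := Γ.graph.neighborSet v

instance (v : V) : Fintype (Γ.Star v) := Fintype.ofFinite _

/-- The geodesic `[u, v]`, the unique path from `u` to `v`. -/
def geodesic (u v : V) : Γ.graph.Walk u v := (Γ.isTree.existsUnique_path u v).choose

/-- The edge joining `x` to `e` lies on the geodesic `[u, v]`. -/
def EdgeOn (u v : V) (x e : V) : Prop := s(x, e) ∈ (Γ.geodesic u v).edges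

/-- The total weight `d_v` of a node. -/
def totalWeight (v : V) : ℕ := ∏ e : Γ.Star v, Γ.weight v e

open Classical in
/-- The linking number of `u` and `v`: the product of the weights adjacent to, but not on, the
geodesic `[u, v]`. For a node `u = v` it is the total weight. -/
def linking (u v : V) : ℕ :=
  ∏ x ∈ (Finset.univ : Finset Γ.Node).filter (fun x => x.1 ∈ (Γ.geodesic u v).support),
    ∏ e ∈ (Finset.univ : Finset (Γ.Star x.1)).filter (fun e => ¬ Γ.EdgeOn u v x.1 e.1),
      Γ.weight x.1 e

/-- The weight vector `w_v = ∑_λ ℓ_{v,λ} w_λ` of a node `v`, in the lattice with basis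
`(w_λ)_λ` indexed by the leaves. -/
def nodeWeight (v : Γ.Node) : Γ.Leaf → ℤ := fun l => Γ.linking v l

open Classical in
/-- The weight vector of any vertex, as a real vector: `w_v` for a node, and the basis vector `w_λ`
for a leaf `λ`. -/
def vertexWeight (v : V) : Γ.Leaf → ℝ := fun l =>
  if Γ.valency v = 1 then (if l.1 = v then 1 else 0) else (Γ.linking v l : ℝ)

/-- The diagram is coprime: the weights around each node are pairwise coprime. -/
def IsCoprime : Prop :=
  ∀ v : Γ.Node, ∀ e e' : Γ.Star v.1, e ≠ e' → Nat.Coprime (Γ.weight v e) (Γ.weight v e')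

/-- The edge determinant condition. -/
def EdgeDeterminantCondition : Prop :=
  ∀ (u v : Γ.Node) (h : Γ.graph.Adj u v),
    (0 : ℤ) < Γ.weight u ⟨v, h⟩ * Γ.weight v ⟨u, h.symm⟩ - Γ.linking u v

/-- The semigroup condition. -/
def SemigroupCondition : Prop :=
  ∀ (v : Γ.Node) (e : Γ.Star v.1),
    Γ.totalWeight v ∈ AddSubmonoid.closure
      {k : ℕ | ∃ l : Γ.Leaf, Γ.EdgeOn v l v e ∧ k = Γ.linking v l}

/-- `m` is an admissible co-weight for the pair `(v, e)`: it only involves leaves `λ` with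
`e ⊆ [v, λ]`, and `w_v · m = d_v`. -/
def IsAdmissible (v : Γ.Node) (e : Γ.Star v.1) (m : Γ.Leaf →₀ ℕ) : Prop :=
  (∀ l, m l ≠ 0 → Γ.EdgeOn v l v e) ∧ ∑ l : Γ.Leaf, m l * Γ.linking v l = Γ.totalWeight v

/-- The cone `ℝ_{≥0} ρ([u, v])` over the embedded edge `[u, v]`: it is generated by the weight
vectors of the two endpoints. The cones over the edges are the top-dimensional cones of the
splice fan. -/
def spliceCone (u v : V) : PointedCone ℝ (Γ.Leaf → ℝ) :=
  PointedCone.hull ℝ {Γ.vertexWeight u, Γ.vertexWeight v}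

/-- A splice type system associated to `Γ`: for each node `v` and each `i < valency v - 2` the
series `∑_e c_{v,e,i} z^{m_{v,e}} + g_{v,i}`. -/
structure SpliceTypeSystem where
  /-- the admissible co-weights `m_{v,e}` -/
  coweight : (v : Γ.Node) → Γ.Star v.1 → (Γ.Leaf →₀ ℕ)
  admissible : ∀ v e, Γ.IsAdmissible v e (coweight v e)
  /-- the coefficients `c_{v,e,i}` -/
  coeff : (v : Γ.Node) → Γ.Star v.1 → Fin (Γ.valency v - 2) → ℂ
  /-- the Hamm determinant conditions: all maximal minors are non-zero -/
  hamm : ∀ (v : Γ.Node) (rows : Fin (Γ.valency v - 2) ↪ Γ.Star v.1),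
    (Matrix.of fun i j => coeff v (rows i) j).det ≠ 0
  /-- the higher order terms `g_{v,i}` -/
  higher : (v : Γ.Node) → Fin (Γ.valency v - 2) → ConvergentSeries Γ.Leaf
  higher_self : ∀ v i (m : Γ.Leaf →₀ ℕ),
    MvPowerSeries.coeff m (higher v i : MvPowerSeries Γ.Leaf ℂ) ≠ 0 →
      Γ.totalWeight v < ∑ l : Γ.Leaf, Γ.linking v l * m l
  higher_other : ∀ v i (m : Γ.Leaf →₀ ℕ),
    MvPowerSeries.coeff m (higher v i : MvPowerSeries Γ.Leaf ℂ) ≠ 0 →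
      ∀ u : Γ.Node, u ≠ v → Γ.linking u v < ∑ l : Γ.Leaf, Γ.linking u l * m l

namespace SpliceTypeSystem

variable {Γ} (S : Γ.SpliceTypeSystem)

/-- The series `F_{v,i} = f_{v,i} + g_{v,i}` of the system. -/
def series (v : Γ.Node) (i : Fin (Γ.valency v - 2)) : ConvergentSeries Γ.Leaf :=
  (∑ e : Γ.Star v.1, S.coeff v e i • ConvergentSeries.zpow (S.coweight v e)) + S.higher v i

/-- The ideal of `𝒪` generated by the system; it defines the splice type singularity. -/
def ideal : Ideal (ConvergentSeries Γ.Leaf) :=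
  Ideal.span {f | ∃ v i, f = S.series v i}

end SpliceTypeSystem

end SpliceDiagram

end

/-! Primitivity. Fix a prime p and a node v. By coprimality p divides at most one weight at each
node. Leave v along the edge whose weight p divides, if there is one, and repeat this at every node
until a leaf λ is reached. The weights that make up ℓ_{v,λ} sit off this path, so p divides none of
them. As p is arbitrary, w_v is primitive.

Initial degeneration along an edge. Let w = a w_u + b w_v with a, b > 0. Linking numbers are
multiplicative along geodesics (`linking_mul_linking`). Hence all monomials of the equations at a
node x have the same w-weight, except for the one in the direction of the edge. That monomial is
strictly heavier by the edge determinant inequality, or, when the edge ends in a leaf, by its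
coordinate at this leaf; the higher order terms are heavier too. The Hamm conditions permit solving
the system at x so that each new generator involves one private monomial, a fixed base monomial and
the heavy monomial. Its initial form is then a binomial with two non-zero coefficients
(`initialSeries_series`).

The exponent differences of these binomials are linearly independent, by triangularity with respect
to the distance from u. Coprimality shows that they generate the whole common kernel of two integral
functionals (`mem_span_exponent_iff`), so their lattice is saturated. Therefore the binomials
generate a prime ideal of the Laurent ring, and each subfamily also defines a domain, so the
binomials form a regular sequence in any order and have only Koszul syzygies.

It remains to see that these binomials generate the whole initial ideal on the torus. For integral w
the substitution z_i ↦ x_i t^{w_i} turns the generators into powers of t times series whose constant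
terms are the binomials. Koszul relations lift from t = 0, so the ideal of these series is
t-saturated, and initial forms of arbitrary elements lie in the binomial ideal
(`weightComponent_mem_span`). Real coefficients a, b are replaced, separately for each element, by
integers giving the same initial form (`exists_nat_weights`). Thus the torus initial ideal is prime:
w is tropical and the count is one.

Arbitrary tropicalizing fans. Conversely, every positive tropical weight lies on the splice fan
(`exists_mem_spliceCone`): otherwise some combination of the equations at a node has a monomial as
initial form. Maximal cones all have the same dimension, and it is at least two because finitely
many of them cover a two-dimensional splice cone. So the relative interior of a maximal cone
contains a point off all the lines spanned by the vertex vectors, hence with both coefficients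
positive in some splice cone. The multiplicity there is one, and it is constant on the relative
interior. -/

noncomputable section

namespace SpliceDiagram

variable {V : Type*} [Fintype V] (Γ : SpliceDiagram V)

/-! ### Geodesics and branches -/

lemma geodesic_isPath (u v : V) : (Γ.geodesic u v).IsPath :=
  (Γ.isTree.existsUnique_path u v).choose_spec.1

lemma eq_geodesic {u v : V} {p : Γ.graph.Walk u v} (hp : p.IsPath) : p = Γ.geodesic u v :=
  (Γ.isTree.existsUnique_path u v).choose_spec.2 p hp

lemma geodesic_self (u : V) : Γ.geodesic u u = SimpleGraph.Walk.nil :=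
  (Γ.eq_geodesic SimpleGraph.Walk.IsPath.nil).symm

lemma geodesic_eq_append {x y p : V} (hp : p ∈ (Γ.geodesic x y).support) :
    Γ.geodesic x y = (Γ.geodesic x p).append (Γ.geodesic p y) := by
  classical
  have h := (Γ.geodesic x y).take_spec hp
  rw [Γ.eq_geodesic ((Γ.geodesic_isPath x y).takeUntil hp),
    Γ.eq_geodesic ((Γ.geodesic_isPath x y).dropUntil hp)] at h
  exact h.symm

/-- `x` lies on the far side of the edge from `a` to `b`. -/
def Beyond (a b x : V) : Prop := Γ.EdgeOn a x a b

variable {Γ}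

lemma geodesic_adj {a b : V} (h : Γ.graph.Adj a b) :
    Γ.geodesic a b = SimpleGraph.Walk.cons h SimpleGraph.Walk.nil := by
  refine (Γ.eq_geodesic ?_).symm
  simp [SimpleGraph.Walk.cons_isPath_iff, h.ne]

lemma geodesic_eq_cons_of_not_mem {a b x : V} (h : Γ.graph.Adj a b)
    (ha : a ∉ (Γ.geodesic b x).support) :
    Γ.geodesic a x = SimpleGraph.Walk.cons h (Γ.geodesic b x) :=
  (Γ.eq_geodesic ((Γ.geodesic_isPath b x).cons ha)).symm

lemma geodesic_eq_cons_of_mem {a b x : V} (h : Γ.graph.Adj a b)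
    (ha : a ∈ (Γ.geodesic b x).support) :
    Γ.geodesic b x = SimpleGraph.Walk.cons h.symm (Γ.geodesic a x) := by
  rw [Γ.geodesic_eq_append ha, geodesic_adj h.symm]
  simp

lemma not_mem_of_mem_support {a b x : V} (h : Γ.graph.Adj a b)
    (ha : a ∈ (Γ.geodesic b x).support) : b ∉ (Γ.geodesic a x).support := by
  have := Γ.geodesic_isPath b x
  rw [geodesic_eq_cons_of_mem h ha, SimpleGraph.Walk.cons_isPath_iff] at this
  exact this.2

lemma beyond_iff_not_mem {a b x : V} (h : Γ.graph.Adj a b) :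
    Γ.Beyond a b x ↔ a ∉ (Γ.geodesic b x).support := by
  constructor
  · intro hx ha
    exact not_mem_of_mem_support h ha (SimpleGraph.Walk.snd_mem_support_of_mem_edges _ hx)
  · intro ha
    unfold Beyond EdgeOn
    rw [geodesic_eq_cons_of_not_mem h ha]
    simp

lemma Beyond.geodesic_eq {a b x : V} (h : Γ.graph.Adj a b) (hx : Γ.Beyond a b x) :
    Γ.geodesic a x = SimpleGraph.Walk.cons h (Γ.geodesic b x) :=
  geodesic_eq_cons_of_not_mem h ((beyond_iff_not_mem h).1 hx)

lemma Beyond.adj {a b x : V} (hx : Γ.Beyond a b x) : Γ.graph.Adj a b :=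
  SimpleGraph.Walk.adj_of_mem_edges _ hx

/-- Removing an edge cuts the tree into two pieces, and `Beyond a b`, `Beyond b a` are these pieces.
-/
lemma beyond_iff_not_beyond {a b x : V} (h : Γ.graph.Adj a b) :
    Γ.Beyond a b x ↔ ¬ Γ.Beyond b a x := by
  rw [beyond_iff_not_mem h, beyond_iff_not_mem h.symm, not_not]
  constructor
  · intro ha
    rw [geodesic_eq_cons_of_not_mem h ha]
    simp
  · intro hb
    exact not_mem_of_mem_support h.symm hb

lemma Beyond.unique {a b c x : V} (hb : Γ.Beyond a b x) (hc : Γ.Beyond a c x) : b = c := by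
  have h := (hb.geodesic_eq hb.adj).symm.trans (hc.geodesic_eq hc.adj)
  simpa using congrArg SimpleGraph.Walk.snd h

lemma not_beyond_self (a b : V) : ¬ Γ.Beyond a b a := by
  intro h
  unfold Beyond EdgeOn at h
  rw [geodesic_self] at h
  simp at h

lemma beyond_adj {a b : V} (h : Γ.graph.Adj a b) : Γ.Beyond a b b := by
  rw [beyond_iff_not_mem h, geodesic_self]
  simpa using h.ne

lemma exists_beyond {a x : V} (hx : x ≠ a) : ∃ b, Γ.graph.Adj a b ∧ Γ.Beyond a b x := by
  rcases hg : Γ.geodesic a x with _ | ⟨h, p⟩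
  · exact absurd rfl hx
  · refine ⟨_, h, ?_⟩
    unfold Beyond EdgeOn
    rw [hg]
    simp

lemma Beyond.trans_adj {a b c x : V} (hab : Γ.graph.Adj a b) (hca : c ≠ a)
    (hx : Γ.Beyond b c x) : Γ.Beyond a b x := by
  rw [beyond_iff_not_beyond hab]
  exact fun h => hca (hx.unique h)

lemma Beyond.eq_or_exists {a b x : V} (hx : Γ.Beyond a b x) :
    x = b ∨ ∃ c, Γ.graph.Adj b c ∧ c ≠ a ∧ Γ.Beyond b c x := by
  by_cases hxb : x = b
  · exact Or.inl hxb
  · obtain ⟨c, hbc, hc⟩ := exists_beyond hxb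
    refine Or.inr ⟨c, hbc, ?_, hc⟩
    rintro rfl
    exact (beyond_iff_not_beyond hx.adj).1 hx hc

/-- If `z` lies on `[v, x]`, then it lies in the same direction from `v` as `x`. -/
lemma beyond_iff_of_mem_support {v x z e : V} (hz : z ∈ (Γ.geodesic v x).support) (hzv : z ≠ v) :
    Γ.Beyond v e z ↔ Γ.Beyond v e x := by
  have key : ∀ f, Γ.Beyond v f z → Γ.Beyond v f x := by
    intro f hf
    unfold Beyond EdgeOn at hf ⊢
    rw [Γ.geodesic_eq_append hz, SimpleGraph.Walk.edges_append]
    exact List.mem_append_left _ hf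
  refine ⟨key e, fun h => ?_⟩
  obtain ⟨f, -, hf⟩ := exists_beyond hzv
  rwa [(key f hf).unique h] at hf

lemma geodesic_reverse (u v : V) : (Γ.geodesic u v).reverse = Γ.geodesic v u :=
  Γ.eq_geodesic (Γ.geodesic_isPath u v).reverse

/-- Vertices in different directions from `v` are separated by `v`. -/
lemma mem_support_of_beyond {v e x y : V} (hy : Γ.Beyond v e y) (hx : ¬ Γ.Beyond v e x) :
    v ∈ (Γ.geodesic x y).support := by
  -- A walk that avoids v never changes its direction as seen from v; this is checked one edge at a
  -- time.
  have aux : ∀ {s t : V} (p : Γ.graph.Walk s t), v ∉ p.support →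
      (Γ.Beyond v e s ↔ Γ.Beyond v e t) := by
    intro s t p
    induction p with
    | nil => intro _; rfl
    | @cons s s' t h p ih =>
      intro hv
      rw [SimpleGraph.Walk.support_cons, List.mem_cons, not_or] at hv
      rw [← ih hv.2]
      have hs' : s' ≠ v := by
        rintro rfl
        exact hv.2 p.start_mem_support
      by_cases hb : Γ.Beyond s s' v
      · refine (beyond_iff_of_mem_support ?_ hs').symm
        rw [← geodesic_reverse, hb.geodesic_eq h]
        simp
      · rw [beyond_iff_not_beyond h, not_not] at hb
        refine beyond_iff_of_mem_support ?_ (Ne.symm hv.1)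
        rw [← geodesic_reverse, hb.geodesic_eq h.symm]
        simp
  by_contra h
  exact hx ((aux _ h).2 hy)

variable (Γ) in
open Classical in
/-- The number of vertices beyond a directed edge. -/
def branchCard (a b : V) : ℕ := ((Finset.univ : Finset V).filter (Γ.Beyond a b)).card

lemma branchCard_lt {a b c : V} (hab : Γ.graph.Adj a b) (hca : c ≠ a) :
    Γ.branchCard b c < Γ.branchCard a b := by
  classical
  refine Finset.card_lt_card ⟨fun x hx => ?_, fun h => ?_⟩
  · simp only [Finset.mem_filter, Finset.mem_univ, true_and] at hx ⊢
    exact hx.trans_adj hab hca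
  · have : b ∈ (Finset.univ : Finset V).filter (Γ.Beyond a b) := by
      simpa using beyond_adj hab
    have := h this
    simp only [Finset.mem_filter, Finset.mem_univ, true_and] at this
    exact not_beyond_self _ _ this

/-- Induction on branches: a property of directed edges holds if it holds for `a → b` as soon as
it holds for all the other edges that start at `b`. -/
lemma branch_induction {P : V → V → Prop}
    (h : ∀ a b, Γ.graph.Adj a b → (∀ c, Γ.graph.Adj b c → c ≠ a → P b c) → P a b)
    {a b : V} (hab : Γ.graph.Adj a b) : P a b := by
  induction hn : Γ.branchCard a b using Nat.strong_induction_on generalizing a b with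
  | _ n ih =>
    refine h a b hab fun c hbc hca => ih _ ?_ hbc rfl
    rw [← hn]
    exact branchCard_lt hab hca

lemma valency_pos (v : V) : 0 < Γ.valency v := by
  obtain ⟨x, hx⟩ := Γ.exists_node
  by_cases hxv : x = v
  · subst hxv; exact lt_trans one_pos hx
  · obtain ⟨b, hb, -⟩ := exists_beyond (Γ := Γ) (a := v) hxv
    have : Nonempty (Γ.graph.neighborSet v) := ⟨⟨b, hb⟩⟩
    exact Nat.card_pos

lemma node_or_leaf (v : V) : 1 < Γ.valency v ∨ Γ.valency v = 1 := by
  have := valency_pos (Γ := Γ) v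
  omega

lemma Node.two_lt_valency (v : Γ.Node) : 2 < Γ.valency v :=
  lt_of_le_of_ne v.2 (Ne.symm (Γ.valency_ne_two v))

lemma card_star (v : V) : Fintype.card (Γ.Star v) = Γ.valency v :=
  Nat.card_eq_fintype_card.symm

lemma eq_of_adj_leaf {l a b : V} (hl : Γ.valency l = 1) (ha : Γ.graph.Adj l a)
    (hb : Γ.graph.Adj l b) : a = b := by
  have := (Nat.card_eq_one_iff_unique.1 hl).1
  exact congrArg Subtype.val (Subsingleton.elim (⟨a, ha⟩ : Γ.Star l) ⟨b, hb⟩)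

lemma Beyond.eq_of_leaf {a b x : V} (hb : Γ.valency b = 1) (hx : Γ.Beyond a b x) : x = b := by
  rcases hx.eq_or_exists with h | ⟨c, hbc, hca, -⟩
  · exact h
  · exact absurd (eq_of_adj_leaf hb hbc hx.adj.symm) hca

/-- A node has an edge different from two given ones. -/
lemma Node.exists_star_ne (v : Γ.Node) (e f : V) : ∃ g : Γ.Star v.1, g.1 ≠ e ∧ g.1 ≠ f := by
  classical
  by_contra! h
  have h1 : (Finset.univ : Finset (Γ.Star v.1)).image Subtype.val ⊆ {e, f} := by
    intro x hx
    obtain ⟨g, -, rfl⟩ := Finset.mem_image.1 hx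
    by_cases hg : g.1 = e
    · simp [hg]
    · simp [h g hg]
  have h2 := (Finset.card_le_card h1).trans (Finset.card_le_two)
  rw [Finset.card_image_of_injective _ Subtype.val_injective, Finset.card_univ, card_star] at h2
  exact absurd v.two_lt_valency (not_lt.2 h2)

lemma exists_leaf_beyond {a b : V} (hab : Γ.graph.Adj a b) : ∃ l : Γ.Leaf, Γ.Beyond a b l := by
  refine branch_induction (P := fun a b => ∃ l : Γ.Leaf, Γ.Beyond a b l) ?_ hab
  intro a b hab ih
  rcases node_or_leaf (Γ := Γ) b with hb | hb
  · obtain ⟨g, hg, -⟩ := Node.exists_star_ne ⟨b, hb⟩ a a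
    obtain ⟨l, hl⟩ := ih g.1 g.2 hg
    exact ⟨l, hl.trans_adj hab hg⟩
  · exact ⟨⟨b, hb⟩, beyond_adj hab⟩

end SpliceDiagram

namespace SpliceDiagram

variable {V : Type*} [Fintype V] {Γ : SpliceDiagram V}

/-! ### Linking numbers -/

variable (Γ) in
open Classical in
/-- The contribution of the node `z` to the linking number of `u` and `x`. -/
def offFactor (u x : V) (z : Γ.Node) : ℕ :=
  if z.1 ∈ (Γ.geodesic u x).support then
    ∏ e : Γ.Star z.1, if Γ.EdgeOn u x z.1 e.1 then 1 else Γ.weight z.1 e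
  else 1

lemma linking_eq_prod (u x : V) : Γ.linking u x = ∏ z : Γ.Node, Γ.offFactor u x z := by
  classical
  unfold linking offFactor
  rw [Finset.prod_filter]
  refine Finset.prod_congr rfl fun z _ => ?_
  split_ifs
  · rw [Finset.prod_filter]
    refine Finset.prod_congr rfl fun e _ => ?_
    split_ifs <;> simp_all
  · rfl

variable (Γ) in
open Classical in
/-- The product of the weights around `v`, except for the one in direction `e`. -/
def complWeight (v e : V) : ℕ := ∏ f : Γ.Star v, if f.1 = e then 1 else Γ.weight v f

variable (Γ) in
open Classical in
/-- The product of the weights around `v`, except for those in directions `a` and `c`. -/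
def complWeight₂ (v a c : V) : ℕ :=
  ∏ f : Γ.Star v, if f.1 = a ∨ f.1 = c then 1 else Γ.weight v f

lemma weight_mul_complWeight (v : V) (e : Γ.Star v) :
    Γ.weight v e * Γ.complWeight v e = Γ.totalWeight v := by
  classical
  unfold complWeight totalWeight
  rw [← Finset.mul_prod_erase _ _ (Finset.mem_univ e),
    ← Finset.mul_prod_erase _ (Γ.weight v) (Finset.mem_univ e)]
  simp only [if_true, one_mul]
  congr 1
  refine Finset.prod_congr rfl fun f hf => ?_
  rw [if_neg]
  exact fun h => (Finset.mem_erase.1 hf).1 (Subtype.ext h)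

lemma weight_mul_complWeight₂ {v a : V} (c : Γ.Star v) (hc : c.1 ≠ a) :
    Γ.weight v c * Γ.complWeight₂ v a c = Γ.complWeight v a := by
  classical
  unfold complWeight complWeight₂
  rw [← Finset.mul_prod_erase _ _ (Finset.mem_univ c),
    ← Finset.mul_prod_erase Finset.univ (fun f : Γ.Star v => if f.1 = a then 1 else Γ.weight v f)
      (Finset.mem_univ c)]
  simp only [or_true, if_true, one_mul, if_neg hc]
  congr 1
  refine Finset.prod_congr rfl fun f hf => ?_
  have : f.1 ≠ c.1 := fun h => (Finset.mem_erase.1 hf).1 (Subtype.ext h)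
  simp [this]

lemma Node.weight_pos (v : Γ.Node) (e : Γ.Star v.1) : 0 < Γ.weight v.1 e := Γ.weight_pos v.1 v.2 e

lemma Node.complWeight_pos (v : Γ.Node) (e : V) : 0 < Γ.complWeight v.1 e := by
  classical
  refine Finset.prod_pos fun f _ => ?_
  split_ifs
  exacts [one_pos, v.weight_pos f]

lemma Node.totalWeight_pos (v : Γ.Node) : 0 < Γ.totalWeight v.1 :=
  Finset.prod_pos fun f _ => v.weight_pos f

lemma linking_pos (u x : V) : 0 < Γ.linking u x := by
  classical
  rw [linking_eq_prod]
  refine Finset.prod_pos fun z _ => ?_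
  unfold offFactor
  split_ifs
  · refine Finset.prod_pos fun f _ => ?_
    split_ifs
    exacts [one_pos, z.weight_pos f]
  · exact one_pos

variable (Γ) in
open Classical in
/-- The product of the weights adjacent to, but not on, the geodesic `[a, x]`, except for those
around `a`. -/
def rho (a x : V) : ℕ := ∏ z : Γ.Node, if z.1 = a then 1 else Γ.offFactor a x z

lemma rho_pos (a x : V) : 0 < Γ.rho a x := by
  classical
  refine Finset.prod_pos fun z _ => ?_
  unfold offFactor
  split_ifs
  · exact one_pos
  · refine Finset.prod_pos fun f _ => ?_
    split_ifs
    exacts [one_pos, z.weight_pos f]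
  · exact one_pos

lemma offFactor_self (u : Γ.Node) {x e : V} (hx : Γ.Beyond u.1 e x) :
    Γ.offFactor u.1 x u = Γ.complWeight u.1 e := by
  classical
  unfold offFactor complWeight
  rw [if_pos (SimpleGraph.Walk.start_mem_support _)]
  refine Finset.prod_congr rfl fun f _ => ?_
  have : Γ.EdgeOn u.1 x u.1 f.1 ↔ f.1 = e :=
    ⟨fun h => Beyond.unique h hx, fun h => h ▸ hx⟩
  simp [this]

/-- Isolates the contribution of u itself, which depends only on the direction e. Within one branch
at u the vector w_u is therefore proportional to `rho u`. -/
lemma linking_eq_mul_rho (u : Γ.Node) {x e : V} (hx : Γ.Beyond u.1 e x) :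
    Γ.linking u.1 x = Γ.complWeight u.1 e * Γ.rho u.1 x := by
  classical
  rw [linking_eq_prod, rho, ← Finset.mul_prod_erase _ _ (Finset.mem_univ u),
    ← Finset.mul_prod_erase Finset.univ (fun z : Γ.Node => if z.1 = u.1 then 1 else _)
      (Finset.mem_univ u), offFactor_self u hx]
  simp only [if_true, one_mul]
  congr 1
  refine Finset.prod_congr rfl fun z hz => ?_
  rw [if_neg]
  exact fun h => (Finset.mem_erase.1 hz).1 (Subtype.ext h)

lemma linking_self (u : Γ.Node) : Γ.linking u.1 u.1 = Γ.totalWeight u.1 := by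
  classical
  rw [linking_eq_prod, ← Finset.mul_prod_erase _ _ (Finset.mem_univ u), Finset.prod_eq_one]
  · rw [mul_one]
    unfold offFactor EdgeOn totalWeight
    rw [geodesic_self]
    simp
  · intro z hz
    unfold offFactor
    rw [geodesic_self, if_neg]
    simpa using fun h => (Finset.mem_erase.1 hz).1 (Subtype.ext h)

lemma rho_eq_mul {a b x : V} (hb : 1 < Γ.valency b) (hab : Γ.graph.Adj a b)
    (hx : Γ.Beyond a b x) :
    Γ.rho a x = Γ.offFactor a x ⟨b, hb⟩ * Γ.rho b x := by
  classical
  unfold rho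
  rw [← Finset.mul_prod_erase _ _ (Finset.mem_univ (⟨b, hb⟩ : Γ.Node)),
    ← Finset.mul_prod_erase Finset.univ (fun z : Γ.Node => if z.1 = b then 1 else _)
      (Finset.mem_univ (⟨b, hb⟩ : Γ.Node))]
  simp only [if_true, one_mul, if_neg hab.ne.symm]
  congr 1
  refine Finset.prod_congr rfl fun z hz => ?_
  have hzb : z.1 ≠ b := fun h => (Finset.mem_erase.1 hz).1 (Subtype.ext h)
  rw [if_neg hzb]
  have hg := hx.geodesic_eq hab
  by_cases hza : z.1 = a
  · rw [if_pos hza]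
    unfold offFactor
    rw [if_neg]
    rw [hza]
    exact (beyond_iff_not_mem hab).1 hx
  · rw [if_neg hza]
    unfold offFactor EdgeOn
    rw [hg]
    simp only [SimpleGraph.Walk.support_cons, SimpleGraph.Walk.edges_cons, List.mem_cons, hza,
      false_or, Sym2.eq_iff, hzb, false_and]
    congr!

/-- Recursion along a branch: passing through b towards c contributes exactly the weights at b other
than those of the incoming and the outgoing edge. -/
lemma rho_step {a b c x : V} (hb : 1 < Γ.valency b) (hab : Γ.graph.Adj a b) (hca : c ≠ a)
    (hx : Γ.Beyond b c x) : Γ.rho a x = Γ.complWeight₂ b a c * Γ.rho b x := by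
  classical
  have hx' := hx.trans_adj hab hca
  rw [rho_eq_mul hb hab hx']
  congr 1
  unfold offFactor complWeight₂ EdgeOn
  rw [hx'.geodesic_eq hab, if_pos (by simp)]
  refine Finset.prod_congr rfl fun f _ => ?_
  have : s(b, f.1) ∈ (Γ.geodesic b x).edges ↔ f.1 = c :=
    ⟨fun h => Beyond.unique h hx, fun h => h ▸ hx⟩
  simp only [SimpleGraph.Walk.edges_cons, List.mem_cons, this, Sym2.eq_iff, hab.ne.symm,
    false_and, true_and, false_or]

lemma rho_of_adj {a b : V} (hb : 1 < Γ.valency b) (hab : Γ.graph.Adj a b) :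
    Γ.rho a b = Γ.complWeight b a := by
  classical
  rw [rho_eq_mul hb hab (beyond_adj hab)]
  have h1 : Γ.rho b b = 1 := by
    unfold rho offFactor
    refine Finset.prod_eq_one fun z _ => ?_
    rw [geodesic_self]
    simp only [SimpleGraph.Walk.support_nil, List.mem_singleton]
    split_ifs <;> rfl
  rw [h1, mul_one]
  unfold offFactor complWeight EdgeOn
  rw [geodesic_adj hab, if_pos (by simp)]
  refine Finset.prod_congr rfl fun f _ => ?_
  simp [hab.ne.symm]

lemma rho_of_leaf {a b : V} (hb : Γ.valency b = 1) (hab : Γ.graph.Adj a b) : Γ.rho a b = 1 := by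
  classical
  refine Finset.prod_eq_one fun z _ => ?_
  split_ifs with h
  · rfl
  · unfold offFactor
    rw [geodesic_adj hab, if_neg]
    have : z.1 ≠ b := fun h => by have := z.2; rw [h, hb] at this; exact lt_irrefl _ this
    simp [h, this]

/-- The comparison is made node by node. A node other than p lies on at most one of the two halves
of the geodesic. At p no edge lies on both halves, so an edge on [x, y] is counted once on either
side of the equation and any other edge twice. -/
lemma linking_mul_linking {x y : V} (p : Γ.Node) (hp : p.1 ∈ (Γ.geodesic x y).support) :
    Γ.totalWeight p.1 * Γ.linking x y = Γ.linking x p.1 * Γ.linking p.1 y := by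
  classical
  have happ := Γ.geodesic_eq_append hp
  have hnodup : ((Γ.geodesic x p.1).append (Γ.geodesic p.1 y)).support.Nodup := by
    rw [← happ]; exact (Γ.geodesic_isPath x y).support_nodup
  have hsep : ∀ z, z ∈ (Γ.geodesic x p.1).support → z ∈ (Γ.geodesic p.1 y).support → z = p.1 := by
    intro z hz hz'
    rw [SimpleGraph.Walk.support_append] at hnodup
    rw [SimpleGraph.Walk.mem_support_iff] at hz'
    rcases hz' with h | h
    · exact h
    · exact (List.disjoint_of_nodup_append hnodup hz h).elim
  have hsupp : ∀ z, z ∈ (Γ.geodesic x y).support ↔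
      z ∈ (Γ.geodesic x p.1).support ∨ z ∈ (Γ.geodesic p.1 y).support := by
    intro z; rw [happ, SimpleGraph.Walk.mem_support_append_iff]
  have hedge : ∀ z e, Γ.EdgeOn x y z e ↔ Γ.EdgeOn x p.1 z e ∨ Γ.EdgeOn p.1 y z e := by
    intro z e; unfold EdgeOn; rw [happ, SimpleGraph.Walk.edges_append, List.mem_append]
  have hmem : ∀ u v z e, Γ.EdgeOn u v z e → z ∈ (Γ.geodesic u v).support ∧
      e ∈ (Γ.geodesic u v).support := fun u v z e h =>
    ⟨SimpleGraph.Walk.fst_mem_support_of_mem_edges _ h,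
      SimpleGraph.Walk.snd_mem_support_of_mem_edges _ h⟩
  rw [linking_eq_prod, linking_eq_prod, linking_eq_prod, ← Finset.prod_mul_distrib,
    ← Finset.mul_prod_erase _ _ (Finset.mem_univ p),
    ← Finset.mul_prod_erase Finset.univ (fun z : Γ.Node => _ * _) (Finset.mem_univ p), ← mul_assoc]
  congr 1
  · unfold offFactor totalWeight
    rw [if_pos hp, if_pos (SimpleGraph.Walk.end_mem_support _),
      if_pos (SimpleGraph.Walk.start_mem_support _), ← Finset.prod_mul_distrib,
      ← Finset.prod_mul_distrib]
    refine Finset.prod_congr rfl fun e _ => ?_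
    have hnot : ¬ (Γ.EdgeOn x p.1 p.1 e.1 ∧ Γ.EdgeOn p.1 y p.1 e.1) := by
      rintro ⟨h1, h2⟩
      exact (show Γ.graph.Adj p.1 e.1 from e.2).ne
        (hsep _ (hmem _ _ _ _ h1).2 (hmem _ _ _ _ h2).2).symm
    rw [hedge]
    by_cases h1 : Γ.EdgeOn x p.1 p.1 e.1 <;> by_cases h2 : Γ.EdgeOn p.1 y p.1 e.1
    · exact absurd ⟨h1, h2⟩ hnot
    all_goals simp [h1, h2]
  · refine Finset.prod_congr rfl fun z hz => ?_
    have hzp : z.1 ≠ p.1 := fun h => (Finset.mem_erase.1 hz).1 (Subtype.ext h)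
    unfold offFactor
    simp only [hsupp]
    by_cases h1 : z.1 ∈ (Γ.geodesic x p.1).support <;>
      by_cases h2 : z.1 ∈ (Γ.geodesic p.1 y).support
    · exact absurd (hsep _ h1 h2) hzp
    · have : ∀ e, ¬ Γ.EdgeOn p.1 y z.1 e := fun e he => h2 (hmem _ _ _ _ he).1
      simp [h1, h2, hedge, this]
    · have : ∀ e, ¬ Γ.EdgeOn x p.1 z.1 e := fun e he => h1 (hmem _ _ _ _ he).1
      simp [h1, h2, hedge, this]
    · simp [h1, h2]

/-- Adjacent nodes. -/
lemma linking_adj (u v : Γ.Node) (h : Γ.graph.Adj u.1 v.1) :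
    Γ.linking u.1 v.1 = Γ.complWeight u.1 v.1 * Γ.complWeight v.1 u.1 := by
  rw [linking_eq_mul_rho u (beyond_adj h), rho_of_adj v.2 h]

/-- On the branch that contains `u` the vector of `u` is a multiple of the one of the branch. -/
lemma linking_of_beyond_rev (u : Γ.Node) {v : V} (h : Γ.graph.Adj u.1 v) {l : Γ.Leaf}
    (hl : Γ.Beyond v u.1 l) : Γ.linking u.1 l = Γ.weight u.1 ⟨v, h⟩ * Γ.rho v l := by
  rcases hl.eq_or_exists with hlu | ⟨c, huc, hcv, hc⟩
  · have h1 := u.2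
    have h2 := l.2
    rw [hlu] at h2
    omega
  · rw [rho_step u.2 h.symm hcv hc, linking_eq_mul_rho u hc, ← mul_assoc]
    congr 1
    have h1 := weight_mul_complWeight u.1 ⟨c, huc⟩
    have h2 := weight_mul_complWeight u.1 ⟨v, h⟩
    have h3 := weight_mul_complWeight₂ (a := v) ⟨c, huc⟩ hcv
    rw [← h2, ← h3] at h1
    exact Nat.eq_of_mul_eq_mul_left (u.weight_pos ⟨c, huc⟩) (h1.trans (mul_left_comm _ _ _))

/-! ### Primitivity of the weight vectors -/

/-- Coprimality leaves at most one edge at v with weight divisible by p. That edge is taken for c,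
unless it is absent or equals the excluded direction a, in which case any other edge will do. -/
lemma exists_star_not_dvd (hΓ : Γ.IsCoprime) {p : ℕ} (hp : p.Prime) (v : Γ.Node) (a : V) :
    ∃ c : Γ.Star v.1, c.1 ≠ a ∧ ∀ f : Γ.Star v.1, f.1 ≠ a → f ≠ c → ¬ p ∣ Γ.weight v.1 f := by
  by_cases h : ∃ c : Γ.Star v.1, c.1 ≠ a ∧ p ∣ Γ.weight v.1 c
  · obtain ⟨c, hca, hc⟩ := h
    refine ⟨c, hca, fun f _ hfc hf => ?_⟩
    exact hp.one_lt.ne' (Nat.dvd_one.1 ((hΓ v f c hfc) ▸ Nat.dvd_gcd hf hc))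
  · push Not at h
    obtain ⟨c, hc, -⟩ := v.exists_star_ne a a
    exact ⟨c, hc, fun f hf _ => h f hf⟩

/-- The leaf is reached by leaving each node along the edge chosen in `exists_star_not_dvd`; what
remains off the path is prime to p. -/
lemma exists_leaf_not_dvd_rho (hΓ : Γ.IsCoprime) {p : ℕ} (hp : p.Prime) {a b : V}
    (hab : Γ.graph.Adj a b) : ∃ l : Γ.Leaf, Γ.Beyond a b l ∧ ¬ p ∣ Γ.rho a l := by
  classical
  refine branch_induction (P := fun a b => ∃ l : Γ.Leaf, Γ.Beyond a b l ∧ ¬ p ∣ Γ.rho a l) ?_ hab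
  intro a b hab ih
  rcases node_or_leaf (Γ := Γ) b with hb | hb
  · obtain ⟨c, hca, hc⟩ := exists_star_not_dvd hΓ hp ⟨b, hb⟩ a
    obtain ⟨l, hl, hpl⟩ := ih c.1 c.2 hca
    refine ⟨l, hl.trans_adj hab hca, ?_⟩
    rw [rho_step hb hab hca hl, hp.prime.dvd_mul, not_or]
    refine ⟨fun h => ?_, hpl⟩
    obtain ⟨f, -, hf⟩ := (Prime.dvd_finsetProd_iff hp.prime _).1 h
    split_ifs at hf with h'
    · exact hp.one_lt.ne' (Nat.dvd_one.1 hf)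
    · push Not at h'
      exact hc f h'.1 (fun h => h'.2 (congrArg Subtype.val h)) hf
  · exact ⟨⟨b, hb⟩, beyond_adj hab, by rw [rho_of_leaf hb hab]; exact hp.one_lt.ne' ∘ Nat.dvd_one.1⟩

lemma isPrimitiveVector_nodeWeight (hΓ : Γ.IsCoprime) (v : Γ.Node) :
    IsPrimitiveVector (Γ.nodeWeight v) := by
  classical
  intro k x hk
  by_contra hunit
  rw [Int.isUnit_iff_natAbs_eq] at hunit
  obtain ⟨p, hp, hpk⟩ := Nat.exists_prime_and_dvd hunit
  obtain ⟨c, -, hc⟩ := exists_star_not_dvd hΓ hp v v.1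
  obtain ⟨l, hl, hpl⟩ := exists_leaf_not_dvd_rho hΓ hp c.2
  have h1 : (p : ℤ) ∣ Γ.nodeWeight v l := by
    rw [hk]
    exact Dvd.dvd.mul_right (Int.natCast_dvd.2 hpk) _
  have h2 : p ∣ Γ.linking v.1 l := Int.natCast_dvd_natCast.1 h1
  rw [linking_eq_mul_rho v hl, hp.prime.dvd_mul] at h2
  refine h2.elim (fun h => ?_) hpl
  obtain ⟨f, -, hf⟩ := (Prime.dvd_finsetProd_iff hp.prime _).1 h
  split_ifs at hf with h'
  · exact hp.one_lt.ne' (Nat.dvd_one.1 hf)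
  · exact hc f (show Γ.graph.Adj v.1 f.1 from f.2).ne.symm
      (fun h => h' (congrArg Subtype.val h)) hf

end SpliceDiagram

namespace SpliceDiagram

variable {V : Type*} [Fintype V] {Γ : SpliceDiagram V}

/-! ### Weights of admissible co-weights -/

lemma mem_support_geodesic_comm {p x y : V} (h : p ∈ (Γ.geodesic x y).support) :
    p ∈ (Γ.geodesic y x).support := by
  rw [← geodesic_reverse]; simpa using h

lemma Leaf.ne_node (l : Γ.Leaf) (v : Γ.Node) : l.1 ≠ v.1 := by
  intro h
  have h1 := l.2
  have h2 := v.2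
  rw [h] at h1
  omega

lemma totalWeight_mul_linking_eq {v : Γ.Node} {e x y : V} (hy : Γ.Beyond v.1 e y)
    (hx : ¬ Γ.Beyond v.1 e x) :
    Γ.totalWeight v.1 * Γ.linking x y = Γ.linking x v.1 * Γ.linking v.1 y :=
  linking_mul_linking v (mem_support_of_beyond hy hx)

/-- After cancelling the common positive factor `complWeight v x * rho v l`, this is the edge
determinant inequality. -/
lemma linking_mul_linking_lt_of_adj (hdet : Γ.EdgeDeterminantCondition) (v x : Γ.Node)
    (h : Γ.graph.Adj v.1 x.1) {l : Γ.Leaf} (hl : Γ.Beyond v.1 x.1 l) :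
    Γ.linking x.1 v.1 * Γ.linking v.1 l < Γ.totalWeight v.1 * Γ.linking x.1 l := by
  have hdet' : Γ.linking x.1 v.1 < Γ.weight x.1 ⟨v.1, h.symm⟩ * Γ.weight v.1 ⟨x.1, h⟩ := by
    have := hdet x v h.symm
    rw [sub_pos] at this
    exact_mod_cast this
  rw [linking_eq_mul_rho v hl, linking_of_beyond_rev x h.symm hl,
    ← weight_mul_complWeight v.1 ⟨x.1, h⟩]
  have hD := v.complWeight_pos x.1
  have hr := rho_pos (Γ := Γ) v.1 l.1
  calc Γ.linking x.1 v.1 * (Γ.complWeight v.1 x.1 * Γ.rho v.1 l.1)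
      < (Γ.weight x.1 ⟨v.1, h.symm⟩ * Γ.weight v.1 ⟨x.1, h⟩) *
        (Γ.complWeight v.1 x.1 * Γ.rho v.1 l.1) :=
        Nat.mul_lt_mul_of_pos_right hdet' (Nat.mul_pos hD hr)
    _ = _ := by ring

/-- The inequality propagates along [v, x]: the first edge gives a strict inequality, and each
further node gives either the same inequality or an equality by multiplicativity. -/
lemma linking_mul_linking_lt (hdet : Γ.EdgeDeterminantCondition) (v x : Γ.Node) {e : V}
    (hx : Γ.Beyond v.1 e x.1) {l : Γ.Leaf} (hl : Γ.Beyond v.1 e l) :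
    Γ.linking x.1 v.1 * Γ.linking v.1 l < Γ.totalWeight v.1 * Γ.linking x.1 l := by
  revert v x l
  have key : ∀ {a b : V}, Γ.graph.Adj a b → ∀ (ha : 1 < Γ.valency a) (x : Γ.Node),
      Γ.Beyond a b x.1 → ∀ l : Γ.Leaf, Γ.Beyond a b l →
      Γ.linking x.1 a * Γ.linking a l < Γ.totalWeight a * Γ.linking x.1 l := by
    intro a b hab
    refine branch_induction (P := fun a b => ∀ (ha : 1 < Γ.valency a) (x : Γ.Node),
      Γ.Beyond a b x.1 → ∀ l : Γ.Leaf, Γ.Beyond a b l →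
      Γ.linking x.1 a * Γ.linking a l < Γ.totalWeight a * Γ.linking x.1 l) ?_ hab
    intro a b hab ih ha x hx l hl
    rcases hx.eq_or_exists with hxb | ⟨c, hbc, hca, hc⟩
    · subst hxb
      exact linking_mul_linking_lt_of_adj hdet ⟨a, ha⟩ x hab hl
    · have hb : 1 < Γ.valency b := by
        refine (node_or_leaf b).resolve_right fun hb => ?_
        exact hca (eq_of_adj_leaf hb hbc hab.symm)
      have h1 := linking_mul_linking_lt_of_adj hdet ⟨a, ha⟩ ⟨b, hb⟩ hab hl
      -- Either l stays in the direction of x from b, and induction applies, or b separates x from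
      -- l, and equality holds.
      have h2 : Γ.linking x.1 b * Γ.linking b l ≤ Γ.totalWeight b * Γ.linking x.1 l := by
        by_cases hlc : Γ.Beyond b c l
        · exact (ih c hbc hca hb x hc l hlc).le
        · exact (linking_mul_linking ⟨b, hb⟩
            (mem_support_geodesic_comm (mem_support_of_beyond hc hlc))).ge
      have hac : ¬ Γ.Beyond b c a := fun h => hca (h.unique (beyond_adj hab.symm))
      have h3 : Γ.totalWeight b * Γ.linking x.1 a = Γ.linking x.1 b * Γ.linking b a :=
        linking_mul_linking ⟨b, hb⟩ (mem_support_geodesic_comm (mem_support_of_beyond hc hac))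
      have hpos : 0 < Γ.totalWeight b := Node.totalWeight_pos ⟨b, hb⟩
      refine lt_of_mul_lt_mul_left (a := Γ.totalWeight b) ?_ (Nat.zero_le _)
      calc Γ.totalWeight b * (Γ.linking x.1 a * Γ.linking a l)
          = Γ.linking x.1 b * (Γ.linking b a * Γ.linking a l) := by
            rw [← mul_assoc, h3, mul_assoc]
        _ < Γ.linking x.1 b * (Γ.totalWeight a * Γ.linking b l) :=
            Nat.mul_lt_mul_of_pos_left h1 (linking_pos _ _)
        _ = Γ.totalWeight a * (Γ.linking x.1 b * Γ.linking b l) := by ring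
        _ ≤ Γ.totalWeight a * (Γ.totalWeight b * Γ.linking x.1 l) := Nat.mul_le_mul_left _ h2
        _ = _ := by ring
  intro v x hx l hl
  exact key hx.adj v.2 x hx l hl

variable (Γ) in
open Classical in
/-- The weight vector of a vertex, with natural entries. -/
def vertexWeightNat (p : V) (l : Γ.Leaf) : ℕ :=
  if Γ.valency p = 1 then (if l.1 = p then 1 else 0) else Γ.linking p l

lemma vertexWeight_eq (p : V) (l : Γ.Leaf) : Γ.vertexWeight p l = Γ.vertexWeightNat p l := by
  unfold vertexWeight vertexWeightNat
  split_ifs <;> simp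

lemma vertexWeightNat_node (p : Γ.Node) (l : Γ.Leaf) :
    Γ.vertexWeightNat p.1 l = Γ.linking p.1 l :=
  if_neg p.2.ne'

lemma vertexWeightNat_leaf (p l : Γ.Leaf) [Decidable (l = p)] :
    Γ.vertexWeightNat p.1 l = if l = p then 1 else 0 := by
  classical
  unfold vertexWeightNat
  rw [if_pos p.2]
  simp only [Subtype.ext_iff]

variable (Γ) in
/-- The minimal weight, with respect to the vector of `p`, of the terms of the series at `v`. -/
def minWeight (p v : V) : ℕ := if Γ.valency p = 1 then 0 else Γ.linking p v

lemma minWeight_node (p : Γ.Node) (v : V) : Γ.minWeight p.1 v = Γ.linking p.1 v :=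
  if_neg p.2.ne'

lemma minWeight_leaf (p : Γ.Leaf) (v : V) : Γ.minWeight p.1 v = 0 := if_pos p.2

variable {v : Γ.Node} {e : Γ.Star v.1} {m : Γ.Leaf →₀ ℕ}

lemma IsAdmissible.beyond (hm : Γ.IsAdmissible v e m) {l : Γ.Leaf} (hl : m l ≠ 0) :
    Γ.Beyond v.1 e.1 l := hm.1 l hl

lemma IsAdmissible.exists_ne_zero (hm : Γ.IsAdmissible v e m) : ∃ l, m l ≠ 0 := by
  by_contra! h
  have h1 := hm.2
  have h2 := v.totalWeight_pos
  simp [h] at h1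
  omega

lemma IsAdmissible.totalWeight_mul (hm : Γ.IsAdmissible v e m) (k : ℕ) :
    Γ.totalWeight v.1 * k = ∑ l : Γ.Leaf, k * (m l * Γ.linking v.1 l) := by
  rw [mul_comm, ← hm.2, Finset.mul_sum]

/-- The node v separates p from every leaf in the support of m, so d_v ℓ_{p,l} = ℓ_{p,v} ℓ_{v,l}
there, and w_v · m = d_v sums this up. For a leaf p the coordinate of m at p is zero. -/
lemma IsAdmissible.sum_eq (hm : Γ.IsAdmissible v e m) {p : V} (hp : ¬ Γ.Beyond v.1 e.1 p) :
    ∑ l, Γ.vertexWeightNat p l * m l = Γ.minWeight p v.1 := by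
  classical
  rcases node_or_leaf (Γ := Γ) p with hn | hn
  · lift p to Γ.Node using hn
    rw [minWeight_node]
    refine Nat.eq_of_mul_eq_mul_left v.totalWeight_pos ?_
    rw [Finset.mul_sum, hm.totalWeight_mul]
    refine Finset.sum_congr rfl fun l _ => ?_
    rw [vertexWeightNat_node]
    by_cases hl : m l = 0
    · simp [hl]
    · rw [← mul_assoc, totalWeight_mul_linking_eq (hm.beyond hl) hp]
      ring
  · lift p to Γ.Leaf using hn
    rw [minWeight_leaf]
    refine Finset.sum_eq_zero fun l _ => ?_
    rw [vertexWeightNat_leaf]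
    by_cases hl : m l = 0
    · simp [hl]
    · have : l ≠ p := by rintro rfl; exact hp (hm.beyond hl)
      simp [this]

/-- The same computation as in `sum_eq`, with the strict inequality `linking_mul_linking_lt` in
place of multiplicativity on the non-empty support of m. -/
lemma IsAdmissible.lt_sum_of_node (hdet : Γ.EdgeDeterminantCondition)
    (hm : Γ.IsAdmissible v e m) {p : Γ.Node} (hp : Γ.Beyond v.1 e.1 p.1) :
    Γ.minWeight p.1 v.1 < ∑ l, Γ.vertexWeightNat p.1 l * m l := by
  obtain ⟨l₀, hl₀⟩ := hm.exists_ne_zero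
  rw [minWeight_node]
  refine lt_of_mul_lt_mul_left (a := Γ.totalWeight v.1) ?_ (Nat.zero_le _)
  rw [Finset.mul_sum, hm.totalWeight_mul]
  have key : ∀ l, m l ≠ 0 → Γ.linking p.1 v.1 * (m l * Γ.linking v.1 l) <
      Γ.totalWeight v.1 * (Γ.vertexWeightNat p.1 l * m l) := by
    intro l hl
    rw [vertexWeightNat_node]
    calc _ = m l * (Γ.linking p.1 v.1 * Γ.linking v.1 l) := by ring
      _ < m l * (Γ.totalWeight v.1 * Γ.linking p.1 l) :=
        Nat.mul_lt_mul_of_pos_left (linking_mul_linking_lt hdet v p hp (hm.beyond hl))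
          (Nat.pos_of_ne_zero hl)
      _ = _ := by ring
  refine Finset.sum_lt_sum (fun l _ => ?_) ⟨l₀, Finset.mem_univ _, key l₀ hl₀⟩
  by_cases hl : m l = 0
  · simp [hl]
  · exact (key l hl).le

lemma IsAdmissible.le_sum (hdet : Γ.EdgeDeterminantCondition) (hm : Γ.IsAdmissible v e m) (p : V) :
    Γ.minWeight p v.1 ≤ ∑ l, Γ.vertexWeightNat p l * m l := by
  by_cases hp : Γ.Beyond v.1 e.1 p
  · rcases node_or_leaf (Γ := Γ) p with hn | hn
    · exact (hm.lt_sum_of_node hdet (p := ⟨p, hn⟩) hp).le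
    · exact (minWeight_leaf ⟨p, hn⟩ v.1).trans_le (Nat.zero_le _)
  · exact (hm.sum_eq hp).ge

lemma IsAdmissible.lt_sum_of_leaf (hm : Γ.IsAdmissible v e m) {p : Γ.Leaf} (hp : e.1 = p.1) :
    Γ.minWeight p.1 v.1 < ∑ l, Γ.vertexWeightNat p.1 l * m l := by
  classical
  obtain ⟨l, hl⟩ := hm.exists_ne_zero
  have h1 : l = p := by
    have := hm.beyond hl
    rw [hp] at this
    exact Subtype.ext (this.eq_of_leaf p.2)
  subst h1
  rw [minWeight_leaf]
  refine Finset.sum_pos' (fun _ _ => Nat.zero_le _) ⟨l, Finset.mem_univ _, ?_⟩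
  rw [vertexWeightNat_leaf, if_pos rfl, one_mul]
  exact Nat.pos_of_ne_zero hl

namespace SpliceTypeSystem

variable (S : Γ.SpliceTypeSystem)

lemma lt_sum_of_higher (v : Γ.Node) (i) {m : Γ.Leaf →₀ ℕ}
    (hm : MvPowerSeries.coeff m (S.higher v i : MvPowerSeries Γ.Leaf ℂ) ≠ 0) (p : Γ.Node) :
    Γ.minWeight p.1 v.1 < ∑ l, Γ.vertexWeightNat p.1 l * m l := by
  simp only [minWeight_node, vertexWeightNat_node]
  by_cases hpv : p = v
  · subst hpv
    rw [linking_self]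
    exact S.higher_self p i m hm
  · exact S.higher_other v i m hm p hpv

lemma le_sum_of_higher (v : Γ.Node) (i) {m : Γ.Leaf →₀ ℕ}
    (hm : MvPowerSeries.coeff m (S.higher v i : MvPowerSeries Γ.Leaf ℂ) ≠ 0) (p : V) :
    Γ.minWeight p v.1 ≤ ∑ l, Γ.vertexWeightNat p l * m l := by
  rcases node_or_leaf (Γ := Γ) p with hn | hn
  · exact (S.lt_sum_of_higher v i hm ⟨p, hn⟩).le
  · exact (minWeight_leaf ⟨p, hn⟩ v.1).trans_le (Nat.zero_le _)

end SpliceTypeSystem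

end SpliceDiagram

/-! ### Recognizing initial forms of power series -/

section InitialForms

variable {σ : Type*} [Fintype σ]

open Classical in
lemma coeff_initialSeries (w : σ → ℝ) (f : MvPowerSeries σ ℂ) (m : σ →₀ ℕ) :
    MvPowerSeries.coeff m (initialSeries w f) =
      if ∀ k, MvPowerSeries.coeff k f ≠ 0 → weightPairing w m ≤ weightPairing w k
      then MvPowerSeries.coeff m f else 0 := rfl

/-- A series whose terms of weight `K` form `P`, and whose other terms have larger weight, has
initial form `P`. -/
lemma initialSeries_add_eq {w : σ → ℝ} {P h : MvPowerSeries σ ℂ} {K : ℝ}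
    (hP : ∀ m, MvPowerSeries.coeff m P ≠ 0 → weightPairing w m = K)
    (hh : ∀ m, MvPowerSeries.coeff m h ≠ 0 → K < weightPairing w m) (hP0 : P ≠ 0) :
    initialSeries w (P + h) = P := by
  classical
  have hh' : ∀ m, weightPairing w m ≤ K → MvPowerSeries.coeff m h = 0 := fun m hm => by
    by_contra hne
    exact (hh m hne).not_ge hm
  ext m
  rw [coeff_initialSeries, map_add]
  split_ifs with hc
  · obtain ⟨k, hk⟩ : ∃ k, MvPowerSeries.coeff k P ≠ 0 := by
      by_contra! hcon
      exact hP0 (MvPowerSeries.ext hcon)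
    have h1 := hc k (by rw [map_add, hh' k (hP k hk).le, add_zero]; exact hk)
    rw [hh' m (h1.trans (hP k hk).le), add_zero]
  · by_contra hne
    refine hc fun k hk => ?_
    rw [hP m (Ne.symm hne)]
    rw [map_add] at hk
    by_cases hPk : MvPowerSeries.coeff k P = 0
    · rw [hPk, zero_add] at hk
      exact (hh k hk).le
    · exact (hP k hPk).ge

end InitialForms

namespace SpliceDiagram

variable {V : Type*} [Fintype V] {Γ : SpliceDiagram V}

namespace SpliceTypeSystem

variable (S : Γ.SpliceTypeSystem)

/-! ### Linear combinations of the series at a node -/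

/-- The coefficient of `z^{m_{v,e}}` in the linear combination of the series at `v` with
coefficients `N`. -/
def combCoeff (v : Γ.Node) (N : Fin (Γ.valency v - 2) → ℂ) (e : Γ.Star v.1) : ℂ :=
  ∑ i, S.coeff v e i * N i

/-- A linear combination of the series at `v`. -/
def comb (v : Γ.Node) (N : Fin (Γ.valency v - 2) → ℂ) : ConvergentSeries Γ.Leaf :=
  ∑ i, N i • S.series v i

/-- The terms of higher order of a linear combination of the series at `v`. -/
def combHigher (v : Γ.Node) (N : Fin (Γ.valency v - 2) → ℂ) : MvPowerSeries Γ.Leaf ℂ :=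
  ∑ i, N i • (S.higher v i : MvPowerSeries Γ.Leaf ℂ)

lemma comb_mem (v : Γ.Node) (N : Fin (Γ.valency v - 2) → ℂ) : S.comb v N ∈ S.ideal :=
  Ideal.sum_mem _ fun i _ => Submodule.smul_of_tower_mem _ _ (Ideal.subset_span ⟨v, i, rfl⟩)

lemma coe_comb (v : Γ.Node) (N : Fin (Γ.valency v - 2) → ℂ) :
    (S.comb v N : MvPowerSeries Γ.Leaf ℂ) =
      (∑ e : Γ.Star v.1, S.combCoeff v N e • MvPowerSeries.monomial (S.coweight v e) (1 : ℂ)) +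
        S.combHigher v N := by
  unfold comb combHigher combCoeff series
  simp only [AddSubmonoidClass.coe_finsetSum, Subalgebra.coe_smul, Subalgebra.coe_add, smul_add,
    Finset.sum_add_distrib, Finset.smul_sum, Finset.sum_smul, smul_smul]
  rw [Finset.sum_comm]
  congr 1
  refine Finset.sum_congr rfl fun e _ => Finset.sum_congr rfl fun i _ => ?_
  rw [mul_comm]
  rfl

lemma exists_of_coeff_combHigher_ne_zero {v : Γ.Node} {N : Fin (Γ.valency v - 2) → ℂ}
    {m : Γ.Leaf →₀ ℕ} (hm : MvPowerSeries.coeff m (S.combHigher v N) ≠ 0) :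
    ∃ i, MvPowerSeries.coeff m (S.higher v i : MvPowerSeries Γ.Leaf ℂ) ≠ 0 := by
  by_contra! h
  refine hm ?_
  unfold combHigher
  simp [h]

lemma coweight_injective (v : Γ.Node) : Function.Injective (S.coweight v) := by
  intro e e' h
  obtain ⟨l, hl⟩ := (S.admissible v e).exists_ne_zero
  exact Subtype.ext (((S.admissible v e).beyond hl).unique
    ((S.admissible v e').beyond (by rwa [← h])))

open Classical in
lemma coeff_sum_monomial (v : Γ.Node) (Z : Finset (Γ.Star v.1)) (q : Γ.Star v.1 → ℂ)
    (m : Γ.Leaf →₀ ℕ) :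
    MvPowerSeries.coeff m
      (∑ e ∈ Z, q e • MvPowerSeries.monomial (S.coweight v e) (1 : ℂ)) =
      ∑ e ∈ Z, if m = S.coweight v e then q e else 0 := by
  simp [MvPowerSeries.coeff_monomial]

open Classical in
lemma coeff_coweight_sum_monomial (v : Γ.Node) (Z : Finset (Γ.Star v.1)) (q : Γ.Star v.1 → ℂ)
    {e : Γ.Star v.1} (he : e ∈ Z) :
    MvPowerSeries.coeff (S.coweight v e)
      (∑ e ∈ Z, q e • MvPowerSeries.monomial (S.coweight v e) (1 : ℂ)) = q e := by
  rw [coeff_sum_monomial, Finset.sum_eq_single e]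
  · simp
  · intro b _ hb
    rw [if_neg]
    exact fun h => hb (S.coweight_injective v h).symm
  · exact fun h => absurd he h

open Classical in
-- Z collects the monomials of minimal weight K. The other monomials must be heavier or have been
-- eliminated, and `e₀` guarantees that the part over Z does not vanish.
lemma initialSeries_comb {w : Γ.Leaf → ℝ} {K : ℝ} {v : Γ.Node} {N : Fin (Γ.valency v - 2) → ℂ}
    (Z : Finset (Γ.Star v.1)) (hZ : ∀ e ∈ Z, weightPairing w (S.coweight v e) = K)
    (hZ' : ∀ e ∉ Z, S.combCoeff v N e ≠ 0 → K < weightPairing w (S.coweight v e))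
    (hh : ∀ i m, MvPowerSeries.coeff m (S.higher v i : MvPowerSeries Γ.Leaf ℂ) ≠ 0 →
      K < weightPairing w m) {e₀ : Γ.Star v.1} (he₀ : e₀ ∈ Z) (hne : S.combCoeff v N e₀ ≠ 0) :
    initialSeries w (S.comb v N : MvPowerSeries Γ.Leaf ℂ) =
      ∑ e ∈ Z, S.combCoeff v N e • MvPowerSeries.monomial (S.coweight v e) (1 : ℂ) := by
  rw [coe_comb, ← Finset.sum_add_sum_compl Z, add_assoc]
  refine initialSeries_add_eq (K := K) (fun m hm => ?_) (fun m hm => ?_) fun h => hne ?_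
  · rw [coeff_sum_monomial] at hm
    obtain ⟨e, he, h⟩ := Finset.exists_ne_zero_of_sum_ne_zero hm
    rw [← hZ e he]
    congr 1
    by_contra hcon
    exact h (if_neg hcon)
  · rw [map_add] at hm
    by_cases h1 : MvPowerSeries.coeff m (S.combHigher v N) = 0
    · rw [h1, add_zero, coeff_sum_monomial] at hm
      obtain ⟨e, he, h⟩ := Finset.exists_ne_zero_of_sum_ne_zero hm
      have hme : m = S.coweight v e := by
        by_contra hcon
        exact h (if_neg hcon)
      rw [if_pos hme] at h
      rw [hme]
      exact hZ' e (Finset.mem_compl.1 he) h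
    · obtain ⟨i, hi⟩ := S.exists_of_coeff_combHigher_ne_zero h1
      exact hh i m hi
  · rw [← S.coeff_coweight_sum_monomial v Z (S.combCoeff v N) he₀, h, map_zero]

open Classical in
/-- The Hamm determinant conditions allow to solve the system at `v` for all but two of the
monomials. -/
lemma exists_dual (v : Γ.Node) {p q : Γ.Star v.1} (hpq : p ≠ q) :
    ∃ N : Γ.Star v.1 → Fin (Γ.valency v - 2) → ℂ,
      (∀ e e', e ≠ p → e ≠ q → e' ≠ p → e' ≠ q →
        S.combCoeff v (N e') e = if e = e' then 1 else 0) ∧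
      (∀ i j, ∑ e ∈ Finset.univ.filter (fun e => e ≠ p ∧ e ≠ q), S.coeff v e i * N e j =
        if i = j then 1 else 0) ∧
      (∀ e, e ≠ p → e ≠ q → S.combCoeff v (N e) p ≠ 0) := by
  let K : Type _ := {e : Γ.Star v.1 // e ≠ p ∧ e ≠ q}
  have hcard : Fintype.card K = Γ.valency v - 2 := by
    have h1 : (Finset.univ.filter (fun e : Γ.Star v.1 => e ≠ p ∧ e ≠ q)) =
        Finset.univ \ {p, q} := by
      ext e; simp
    rw [Fintype.card_subtype, h1, Finset.card_sdiff_of_subset (Finset.subset_univ _),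
      Finset.card_univ, card_star, Finset.card_pair hpq]
  let ε : Fin (Γ.valency v - 2) ≃ K := (Fintype.equivFinOfCardEq hcard).symm
  let rows : Fin (Γ.valency v - 2) ↪ Γ.Star v.1 :=
    ⟨fun k => (ε k).1, fun a b h => ε.injective (Subtype.ext h)⟩
  let A : Matrix (Fin (Γ.valency v - 2)) (Fin (Γ.valency v - 2)) ℂ :=
    Matrix.of fun i j => S.coeff v (rows i) j
  have hA : IsUnit A.det := (S.hamm v rows).isUnit
  let N : Γ.Star v.1 → Fin (Γ.valency v - 2) → ℂ := fun e i =>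
    if he : e ≠ p ∧ e ≠ q then A⁻¹ i (ε.symm ⟨e, he⟩) else 0
  have hN : ∀ k i, N (ε k).1 i = A⁻¹ i k := fun k i => by
    simp only [N]
    rw [dif_pos (ε k).2]
    simp
  have h1 : ∀ e e', e ≠ p → e ≠ q → e' ≠ p → e' ≠ q →
        S.combCoeff v (N e') e = if e = e' then 1 else 0 := by
    intro e e' h1 h2 h3 h4
    obtain ⟨k, hk⟩ := ε.surjective ⟨e, h1, h2⟩
    obtain ⟨k', hk'⟩ := ε.surjective ⟨e', h3, h4⟩
    have e1 : e = (ε k).1 := by rw [hk]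
    have e2 : e' = (ε k').1 := by rw [hk']
    subst e1 e2
    have := congrFun (congrFun (Matrix.mul_nonsing_inv A hA) k) k'
    rw [Matrix.mul_apply, Matrix.one_apply] at this
    simp only [combCoeff, hN]
    refine this.trans ?_
    simp [Subtype.ext_iff.symm]
  refine ⟨N, h1, fun i j => ?_, fun e hep heq hzero => ?_⟩
  · have h2 : ∑ e ∈ Finset.univ.filter (fun e : Γ.Star v.1 => e ≠ p ∧ e ≠ q),
        S.coeff v e i * N e j = ∑ e : K, S.coeff v e.1 i * N e.1 j :=
      Finset.sum_subtype _ (by simp) _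
    rw [h2, ← ε.sum_comp]
    -- The inverse is also used on the other side: this is what recovers the original series from
    -- the new combinations.
    have := congrFun (congrFun (Matrix.nonsing_inv_mul A hA) j) i
    rw [Matrix.mul_apply, Matrix.one_apply] at this
    simp only [hN, eq_comm (a := i)]
    rw [← this]
    exact Finset.sum_congr rfl fun k _ => mul_comm _ _
  -- Exchange the row e for the row p. If the coefficient at p vanished, `N e` would lie in the
  -- kernel of this other maximal minor, hence be zero, although its coefficient at e is one.
  · let rows' : Fin (Γ.valency v - 2) ↪ Γ.Star v.1 :=
      ⟨fun k => if rows k = e then p else rows k, fun a b hab => by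
        have hp : ∀ k, rows k ≠ p := fun k => (ε k).2.1
        dsimp only at hab
        split_ifs at hab with ha hb hb
        · exact rows.injective (ha.trans hb.symm)
        · exact absurd hab.symm (hp b)
        · exact absurd hab (hp a)
        · exact rows.injective hab⟩
    have hker : (Matrix.of fun i j => S.coeff v (rows' i) j).mulVec (N e) = 0 := by
      funext k
      change S.combCoeff v (N e) (if rows k = e then p else rows k) = 0
      split_ifs with hk
      · exact hzero
      · exact (h1 _ _ (ε k).2.1 (ε k).2.2 hep heq).trans (if_neg hk)
    have hz := Matrix.eq_zero_of_mulVec_eq_zero (S.hamm v rows') hker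
    have h3 := h1 e e hep heq hep heq
    rw [hz] at h3
    simp [combCoeff] at h3

/-! ### Initial ideals that contain monomials -/

/-- Solve for the monomial at `e₀`, keeping only those at `e₁` and `e₂` besides it. Both survivors
and the higher terms are heavier, so the initial form is a single monomial. -/
lemma not_mem_localTrop_of_lt {w : Γ.Leaf → ℝ} {K : ℝ} {v : Γ.Node} {e₀ e₁ e₂ : Γ.Star v.1}
    (h01 : e₀ ≠ e₁) (h02 : e₀ ≠ e₂) (h12 : e₁ ≠ e₂)
    (h0 : weightPairing w (S.coweight v e₀) = K) (h1 : K < weightPairing w (S.coweight v e₁))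
    (h2 : K < weightPairing w (S.coweight v e₂))
    (hh : ∀ i m, MvPowerSeries.coeff m (S.higher v i : MvPowerSeries Γ.Leaf ℂ) ≠ 0 →
      K < weightPairing w m) : w ∉ localTrop S.ideal := by
  classical
  intro hw
  obtain ⟨N, hN, -, -⟩ := S.exists_dual v h12
  have hone : S.combCoeff v (N e₀) e₀ = 1 := by rw [hN e₀ e₀ h01 h02 h01 h02, if_pos rfl]
  have key := S.initialSeries_comb (w := w) (K := K) (v := v) (N := N e₀) {e₀}
    (by simpa using h0) (fun e he hne => ?_) hh (Finset.mem_singleton_self _)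
    (by rw [hone]; exact one_ne_zero)
  · refine hw.2 (S.coweight v e₀) (Ideal.subset_span ⟨S.comb v (N e₀), S.comb_mem v _, ?_⟩)
    refine Subtype.ext (key.trans ?_)
    rw [Finset.sum_singleton, hone, one_smul]
    rfl
  · have he : e ≠ e₀ := by simpa using he
    by_cases he1 : e = e₁
    · rwa [he1]
    by_cases he2 : e = e₂
    · rwa [he2]
    exact absurd (by rw [hN e e₀ he1 he2 h01 h02, if_neg he]) hne

/-! ### Residuals of tropical weights with respect to a node vector -/

section Residual

variable {S} {w r : Γ.Leaf → ℝ} {x : Γ.Node} {c : ℝ}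

lemma weightPairing_residual (hw : ∀ l, w l = c * Γ.linking x.1 l + r l) (m : Γ.Leaf →₀ ℕ) :
    weightPairing w m =
      c * ((∑ l, Γ.vertexWeightNat x.1 l * m l : ℕ) : ℝ) + ∑ l, r l * m l := by
  unfold weightPairing
  push_cast
  rw [Finset.mul_sum, ← Finset.sum_add_distrib]
  refine Finset.sum_congr rfl fun l _ => ?_
  rw [hw, vertexWeightNat_node]
  ring

lemma weightPairing_coweight_eq (hw : ∀ l, w l = c * Γ.linking x.1 l + r l) {v : Γ.Node}
    {e : Γ.Star v.1} (hx : ¬ Γ.Beyond v.1 e.1 x.1)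
    (hr : ∀ l : Γ.Leaf, Γ.Beyond v.1 e.1 l → r l = 0) :
    weightPairing w (S.coweight v e) = c * Γ.minWeight x.1 v.1 := by
  have hm := S.admissible v e
  rw [weightPairing_residual hw, hm.sum_eq hx, Finset.sum_eq_zero, add_zero]
  intro l _
  by_cases hl : S.coweight v e l = 0
  · simp [hl]
  · rw [hr l (hm.beyond hl), zero_mul]

lemma lt_weightPairing_of_lt (hw : ∀ l, w l = c * Γ.linking x.1 l + r l) (hc : 0 < c)
    (hr : ∀ l, 0 ≤ r l) {v : Γ.Node} {m : Γ.Leaf →₀ ℕ}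
    (hm : Γ.minWeight x.1 v.1 < ∑ l, Γ.vertexWeightNat x.1 l * m l) :
    c * Γ.minWeight x.1 v.1 < weightPairing w m := by
  rw [weightPairing_residual hw]
  have h1 : c * (Γ.minWeight x.1 v.1 : ℝ) <
      c * ((∑ l, Γ.vertexWeightNat x.1 l * m l : ℕ) : ℝ) :=
    mul_lt_mul_of_pos_left (Nat.cast_lt.2 hm) hc
  have h2 : 0 ≤ ∑ l, r l * m l := Finset.sum_nonneg fun l _ => mul_nonneg (hr l) (Nat.cast_nonneg _)
  linarith

lemma lt_weightPairing_coweight (hdet : Γ.EdgeDeterminantCondition)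
    (hw : ∀ l, w l = c * Γ.linking x.1 l + r l) (hc : 0 < c)
    (hr : ∀ l, 0 ≤ r l) {v : Γ.Node} {e : Γ.Star v.1}
    (hre : ∀ l : Γ.Leaf, Γ.Beyond v.1 e.1 l → 0 < r l) :
    c * Γ.minWeight x.1 v.1 < weightPairing w (S.coweight v e) := by
  have hm := S.admissible v e
  rw [weightPairing_residual hw]
  have h1 : c * (Γ.minWeight x.1 v.1 : ℝ) ≤
      c * ((∑ l, Γ.vertexWeightNat x.1 l * S.coweight v e l : ℕ) : ℝ) :=
    mul_le_mul_of_nonneg_left (Nat.cast_le.2 (hm.le_sum hdet _)) hc.le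
  obtain ⟨l, hl⟩ := hm.exists_ne_zero
  have h2 : 0 < ∑ l, r l * S.coweight v e l :=
    Finset.sum_pos' (fun l _ => mul_nonneg (hr l) (Nat.cast_nonneg _))
      ⟨l, Finset.mem_univ _, mul_pos (hre l (hm.beyond hl)) (Nat.cast_pos.2 (Nat.pos_of_ne_zero hl))⟩
  linarith

/-- The residual of a weight vector in the local tropicalization either vanishes or is positive
on all leaves of a branch that does not contain `x`. -/
lemma residual_uniform (hdet : Γ.EdgeDeterminantCondition) (hT : w ∈ localTrop S.ideal)
    (hw : ∀ l, w l = c * Γ.linking x.1 l + r l) (hc : 0 < c) (hr : ∀ l, 0 ≤ r l) {a b : V}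
    (hab : Γ.graph.Adj a b) (hx : ¬ Γ.Beyond a b x.1) :
    (∀ l : Γ.Leaf, Γ.Beyond a b l → 0 < r l) ∨ (∀ l : Γ.Leaf, Γ.Beyond a b l → r l = 0) := by
  revert hx
  refine branch_induction (P := fun a b => ¬ Γ.Beyond a b x.1 →
    (∀ l : Γ.Leaf, Γ.Beyond a b l → 0 < r l) ∨ (∀ l : Γ.Leaf, Γ.Beyond a b l → r l = 0)) ?_ hab
  intro a b hab ih hx
  rcases node_or_leaf (Γ := Γ) b with hb | hb
  · by_contra! hcon
    obtain ⟨⟨l₁, hl₁, hr₁⟩, l₂, hl₂, hr₂⟩ := hcon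
    have hstep : ∀ l : Γ.Leaf, Γ.Beyond a b l →
        ∃ c, Γ.graph.Adj b c ∧ c ≠ a ∧ Γ.Beyond b c l := fun l hl =>
      hl.eq_or_exists.resolve_left (Leaf.ne_node l ⟨b, hb⟩)
    obtain ⟨c₁, hbc₁, hc₁a, hc₁⟩ := hstep l₁ hl₁
    obtain ⟨c₂, hbc₂, hc₂a, hc₂⟩ := hstep l₂ hl₂
    have hu₁ := (ih c₁ hbc₁ hc₁a fun h => hx (h.trans_adj hab hc₁a)).resolve_left
      fun h => hr₁.not_gt (h l₁ hc₁)
    have hu₂ := (ih c₂ hbc₂ hc₂a fun h => hx (h.trans_adj hab hc₂a)).resolve_right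
      fun h => hr₂ (h l₂ hc₂)
    have h12 : c₁ ≠ c₂ := by
      rintro rfl
      exact hr₂ (hu₁ l₂ hc₂)
    let B : Γ.Node := ⟨b, hb⟩
    -- Three directions at b: towards `c₁` the residual vanishes and the weight is exactly K;
    -- towards `c₂` it is positive; towards a lies x, and the edge determinant condition makes the
    -- term heavier.
    refine S.not_mem_localTrop_of_lt (v := B) (K := c * Γ.minWeight x.1 B.1)
      (e₀ := ⟨c₁, hbc₁⟩) (e₁ := ⟨c₂, hbc₂⟩) (e₂ := ⟨a, hab.symm⟩) ?_ ?_ ?_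
      (weightPairing_coweight_eq hw (fun h => hx (h.trans_adj hab hc₁a)) hu₁)
      (lt_weightPairing_coweight hdet hw hc hr hu₂) ?_ ?_ hT
    · exact fun h => h12 (congrArg Subtype.val h)
    · exact fun h => hc₁a (congrArg Subtype.val h)
    · exact fun h => hc₂a (congrArg Subtype.val h)
    · exact lt_weightPairing_of_lt hw hc hr ((S.admissible B ⟨a, hab.symm⟩).lt_sum_of_node hdet
        ((beyond_iff_not_beyond hab.symm).2 hx))
    · exact fun i m hm => lt_weightPairing_of_lt hw hc hr (S.lt_sum_of_higher B i hm x)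
  · rcases (hr ⟨b, hb⟩).lt_or_eq with h | h
    · refine Or.inl fun l hl => ?_
      obtain rfl : l = ⟨b, hb⟩ := Subtype.ext (hl.eq_of_leaf hb)
      exact h
    · refine Or.inr fun l hl => ?_
      obtain rfl : l = ⟨b, hb⟩ := Subtype.ext (hl.eq_of_leaf hb)
      exact h.symm

/-- If the residual were non-zero in two directions at x, these together with the direction of `l₀`,
where it vanishes, would produce a monomial initial form at x. -/
lemma exists_direction_of_residual (hdet : Γ.EdgeDeterminantCondition)
    (hT : w ∈ localTrop S.ideal) (hw : ∀ l, w l = c * Γ.linking x.1 l + r l) (hc : 0 < c)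
    (hr : ∀ l, 0 ≤ r l) {l₀ : Γ.Leaf} (hl₀ : r l₀ = 0) :
    ∃ e, Γ.graph.Adj x.1 e ∧ ∀ l : Γ.Leaf, ¬ Γ.Beyond x.1 e l → r l = 0 := by
  obtain ⟨e₀, hxe₀, he₀⟩ := exists_beyond (l₀.ne_node x)
  by_cases h : ∃ l₁, r l₁ ≠ 0
  · obtain ⟨l₁, hl₁⟩ := h
    obtain ⟨e₁, hxe₁, he₁⟩ := exists_beyond (l₁.ne_node x)
    refine ⟨e₁, hxe₁, fun l₂ hl₂ => ?_⟩
    by_contra hrl₂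
    obtain ⟨e₂, hxe₂, he₂⟩ := exists_beyond (l₂.ne_node x)
    have hu₀ := (residual_uniform hdet hT hw hc hr hxe₀ (not_beyond_self _ _)).resolve_left
      fun h => (h l₀ he₀).ne' hl₀
    have hu₁ := (residual_uniform hdet hT hw hc hr hxe₁ (not_beyond_self _ _)).resolve_right
      fun h => hl₁ (h l₁ he₁)
    have hu₂ := (residual_uniform hdet hT hw hc hr hxe₂ (not_beyond_self _ _)).resolve_right
      fun h => hrl₂ (h l₂ he₂)
    refine S.not_mem_localTrop_of_lt (v := x) (K := c * Γ.minWeight x.1 x.1)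
      (e₀ := ⟨e₀, hxe₀⟩) (e₁ := ⟨e₁, hxe₁⟩) (e₂ := ⟨e₂, hxe₂⟩) ?_ ?_ ?_
      (weightPairing_coweight_eq hw (not_beyond_self _ _) hu₀)
      (lt_weightPairing_coweight hdet hw hc hr hu₁) (lt_weightPairing_coweight hdet hw hc hr hu₂)
      (fun i m hm => lt_weightPairing_of_lt hw hc hr (S.lt_sum_of_higher _ i hm x)) hT
    · intro h
      obtain rfl : e₀ = e₁ := congrArg Subtype.val h
      exact hl₁ (hu₀ l₁ he₁)
    · intro h
      obtain rfl : e₀ = e₂ := congrArg Subtype.val h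
      exact hrl₂ (hu₀ l₂ he₂)
    · intro h
      obtain rfl : e₁ = e₂ := congrArg Subtype.val h
      exact hl₂ he₂
  · push Not at h
    exact ⟨e₀, hxe₀, fun l _ => h l⟩

end Residual

/-- The number c is the largest one with c w_x ≤ w, that is, the minimum of the quotients of
coordinates; the residual w - c w_x then vanishes at a leaf. -/
lemma exists_direction (hdet : Γ.EdgeDeterminantCondition) {w : Γ.Leaf → ℝ}
    (hT : w ∈ positiveLocalTrop S.ideal) (x : Γ.Node) :
    ∃ (c : ℝ) (e : V), 0 < c ∧ Γ.graph.Adj x.1 e ∧ (∀ l : Γ.Leaf, c * Γ.linking x.1 l ≤ w l) ∧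
      ∀ l : Γ.Leaf, ¬ Γ.Beyond x.1 e l → w l = c * Γ.linking x.1 l := by
  have hℓ : ∀ l : Γ.Leaf, (0 : ℝ) < Γ.linking x.1 l := fun l => Nat.cast_pos.2 (linking_pos _ _)
  obtain ⟨g, -, -⟩ := x.exists_star_ne x.1 x.1
  obtain ⟨l', -⟩ := exists_leaf_beyond g.2
  obtain ⟨l₀, -, hl₀⟩ := Finset.exists_min_image Finset.univ
    (fun l : Γ.Leaf => w l / Γ.linking x.1 l) ⟨l', Finset.mem_univ _⟩
  have hc : 0 < w l₀ / Γ.linking x.1 l₀ := div_pos (hT.2 l₀) (hℓ l₀)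
  have hle : ∀ l : Γ.Leaf, w l₀ / Γ.linking x.1 l₀ * Γ.linking x.1 l ≤ w l := fun l =>
    (le_div_iff₀ (hℓ l)).1 (hl₀ l (Finset.mem_univ _))
  obtain ⟨e, hxe, he⟩ := exists_direction_of_residual (S := S) (x := x)
    (c := w l₀ / Γ.linking x.1 l₀) (r := fun l => w l - w l₀ / Γ.linking x.1 l₀ * Γ.linking x.1 l)
    hdet hT.1 (fun l => by ring) hc (fun l => sub_nonneg.2 (hle l)) (l₀ := l₀)
    (by rw [div_mul_cancel₀ _ (hℓ l₀).ne', sub_self])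
  exact ⟨_, e, hc, hxe, hle, fun l hl => sub_eq_zero.1 (he l hl)⟩

/-- The positive local tropicalization is contained in the support of the splice fan. -/
theorem exists_mem_spliceCone (hdet : Γ.EdgeDeterminantCondition) {w : Γ.Leaf → ℝ}
    (hT : w ∈ positiveLocalTrop S.ideal) :
    ∃ (u v : V) (s t : ℝ), Γ.graph.Adj u v ∧ 0 ≤ s ∧ 0 ≤ t ∧
      w = s • Γ.vertexWeight u + t • Γ.vertexWeight v := by
  classical
  choose c f hc hadj hle heq using S.exists_direction hdet hT
  obtain ⟨x₀, hx₀⟩ := Γ.exists_node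
  -- Each node points in a direction outside of which w is a multiple of its vector. At a node with
  -- the smallest branch ahead, the neighbour pointed to is a leaf or points back, since otherwise
  -- its own branch would be smaller.
  obtain ⟨x, -, hx⟩ := Finset.exists_min_image Finset.univ
    (fun x : Γ.Node => Γ.branchCard x.1 (f x)) ⟨⟨x₀, hx₀⟩, Finset.mem_univ _⟩
  rcases node_or_leaf (Γ := Γ) (f x) with hy | hy
  · obtain ⟨y, hxy⟩ : ∃ y : Γ.Node, y.1 = f x := ⟨⟨_, hy⟩, rfl⟩
    have hA : Γ.graph.Adj x.1 y.1 := hxy ▸ hadj x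
    have hfy : f y = x.1 := by
      by_contra hne
      refine (hx y (Finset.mem_univ _)).not_gt ?_
      rw [← hxy]
      exact branchCard_lt hA hne
    set dx : ℝ := ((Γ.weight x.1 ⟨y.1, hA⟩ : ℕ) : ℝ) with hdx
    set dy : ℝ := ((Γ.weight y.1 ⟨x.1, hA.symm⟩ : ℕ) : ℝ) with hdy
    set Dx : ℝ := ((Γ.complWeight x.1 y.1 : ℕ) : ℝ) with hDx
    set Dy : ℝ := ((Γ.complWeight y.1 x.1 : ℕ) : ℝ) with hDy
    have hdx0 : 0 < dx := Nat.cast_pos.2 (x.weight_pos _)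
    have hdy0 : 0 < dy := Nat.cast_pos.2 (y.weight_pos _)
    have hΔ : 0 < dx * dy - Dx * Dy := by
      have := hdet x y hA
      rw [linking_adj x y hA] at this
      have h2 : ((0 : ℤ) : ℝ) < _ := Int.cast_lt.2 this
      push_cast at h2
      exact h2
    have hx1 : ∀ l : Γ.Leaf, Γ.Beyond y.1 x.1 l → (Γ.linking x.1 l : ℝ) = dx * Γ.rho y.1 l :=
      fun l hl => by rw [linking_of_beyond_rev x hA hl]; push_cast; rfl
    have hx2 : ∀ l : Γ.Leaf, Γ.Beyond x.1 y.1 l → (Γ.linking x.1 l : ℝ) = Dx * Γ.rho x.1 l :=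
      fun l hl => by rw [linking_eq_mul_rho x hl]; push_cast; rfl
    have hy1 : ∀ l : Γ.Leaf, Γ.Beyond x.1 y.1 l → (Γ.linking y.1 l : ℝ) = dy * Γ.rho x.1 l :=
      fun l hl => by rw [linking_of_beyond_rev y hA.symm hl]; push_cast; rfl
    have hy2 : ∀ l : Γ.Leaf, Γ.Beyond y.1 x.1 l → (Γ.linking y.1 l : ℝ) = Dy * Γ.rho y.1 l :=
      fun l hl => by rw [linking_eq_mul_rho y hl]; push_cast; rfl
    have hwx : ∀ l : Γ.Leaf, Γ.Beyond y.1 x.1 l → w l = c x * (dx * Γ.rho y.1 l) := fun l hl => by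
      rw [← hx1 l hl]
      refine heq x l ?_
      rw [← hxy]
      exact (beyond_iff_not_beyond hA.symm).1 hl
    have hwy : ∀ l : Γ.Leaf, Γ.Beyond x.1 y.1 l → w l = c y * (dy * Γ.rho x.1 l) := fun l hl => by
      rw [← hy1 l hl]
      refine heq y l ?_
      rw [hfy]
      exact (beyond_iff_not_beyond hA).1 hl
    have hs : c y * Dy ≤ c x * dx := by
      obtain ⟨l, hl⟩ := exists_leaf_beyond hA.symm
      have h1 := hle y l
      rw [hwx l hl, hy2 l hl, ← mul_assoc, ← mul_assoc] at h1
      exact le_of_mul_le_mul_right h1 (Nat.cast_pos.2 (rho_pos _ _))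
    have ht : c x * Dx ≤ c y * dy := by
      obtain ⟨l, hl⟩ := exists_leaf_beyond hA
      have h1 := hle x l
      rw [hwy l hl, hx2 l hl, ← mul_assoc, ← mul_assoc] at h1
      exact le_of_mul_le_mul_right h1 (Nat.cast_pos.2 (rho_pos _ _))
    -- Cramer's rule. On the side of x the equation reads s dx + t Dy = c_x dx, on the side of y it
    -- reads s Dx + t dy = c_y dy; the determinant is the edge determinant. The inequalities `hs`
    -- and `ht` give non-negativity.
    refine ⟨x.1, y.1, dy * (c x * dx - c y * Dy) / (dx * dy - Dx * Dy),
      dx * (c y * dy - c x * Dx) / (dx * dy - Dx * Dy), hA,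
      div_nonneg (mul_nonneg hdy0.le (sub_nonneg.2 hs)) hΔ.le,
      div_nonneg (mul_nonneg hdx0.le (sub_nonneg.2 ht)) hΔ.le, ?_⟩
    have hΔ' := hΔ.ne'
    funext l
    simp only [Pi.add_apply, Pi.smul_apply, smul_eq_mul, vertexWeight_eq, vertexWeightNat_node]
    by_cases hl : Γ.Beyond x.1 y.1 l
    · rw [hwy l hl, hx2 l hl, hy1 l hl]
      rw [div_mul_eq_mul_div, div_mul_eq_mul_div, ← add_div, eq_div_iff hΔ']
      ring
    · rw [beyond_iff_not_beyond hA, not_not] at hl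
      rw [hwx l hl, hx1 l hl, hy2 l hl]
      rw [div_mul_eq_mul_div, div_mul_eq_mul_div, ← add_div, eq_div_iff hΔ']
      ring
  -- The branch ahead is a single leaf, so the residual is a multiple of its basis vector.
  · refine ⟨x.1, f x, c x, w ⟨f x, hy⟩ - c x * Γ.linking x.1 (f x), hadj x, (hc x).le,
      sub_nonneg.2 (hle x ⟨f x, hy⟩), ?_⟩
    funext l
    simp only [Pi.add_apply, Pi.smul_apply, smul_eq_mul, vertexWeight_eq, vertexWeightNat_node]
    rw [vertexWeightNat_leaf ⟨f x, hy⟩ l]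
    by_cases hl : l = ⟨f x, hy⟩
    · rw [if_pos hl, hl]; push_cast; ring
    · rw [if_neg hl, heq x l fun h => hl (Subtype.ext (h.eq_of_leaf hy))]
      push_cast; ring

end SpliceTypeSystem

end SpliceDiagram

/-! ### Irreducible components of integral schemes -/

/-- The local ring in question is the residue field at P, a simple module. -/
lemma componentMultiplicity_self {R : Type*} [CommRing R] (P : Ideal R) [P.IsPrime] :
    componentMultiplicity P P = 1 := by
  unfold componentMultiplicity
  rw [Module.length_eq_one_iff, isSimpleModule_iff_isCoatom, Localization.AtPrime.map_eq_maximalIdeal]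
  exact (IsLocalRing.maximalIdeal.isMaximal _).out

lemma componentCount_eq_one {R : Type*} [CommRing R] (P : Ideal R) [hP : P.IsPrime] :
    componentCount P = 1 := by
  have hmin : P.IsMinimalPrime P := ⟨⟨hP, le_rfl⟩, fun q hq _ => hq.2⟩
  have huniq : ∀ Q : {Q : Ideal R // P.IsMinimalPrime Q}, Q = ⟨P, hmin⟩ := fun Q =>
    Subtype.ext (le_antisymm (Q.2.2 ⟨hP, le_rfl⟩ Q.2.le) Q.2.le)
  unfold componentCount
  rw [finsum_eq_single _ ⟨P, hmin⟩ fun Q hQ => absurd (huniq Q) hQ]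
  exact componentMultiplicity_self P

/-! ### Koszul syzygies -/

section Koszul

variable {R J : Type*} [CommRing R]

/-- All relations between the members of the family `B` in `s` are generated by the trivial
ones. -/
def HasKoszulSyzygies (B : J → R) (s : Finset J) : Prop :=
  ∀ a : J → R, ∑ j ∈ s, a j * B j = 0 → ∃ c : J → J → R, (∀ i j, c i j = - c j i) ∧
    (∀ i, c i i = 0) ∧ ∀ j ∈ s, a j = ∑ i ∈ s, c j i * B i

open Classical in
-- By regularity the coefficient of the new member is a combination Σ b_i B_i of the old ones. Then
-- the a_i + b_i B_j form a relation among the old members, to which the hypothesis applies.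
lemma HasKoszulSyzygies.insert {B : J → R} {s : Finset J} (hs : HasKoszulSyzygies B s) {j : J}
    (hj : j ∉ s)
    (hreg : ∀ a, a * B j ∈ Ideal.span (B '' (s : Set J)) → a ∈ Ideal.span (B '' (s : Set J))) :
    HasKoszulSyzygies B (insert j s) := by
  intro a ha
  rw [Finset.sum_insert hj] at ha
  have hmem : a j ∈ Ideal.span (B '' (s : Set J)) := by
    refine hreg _ ?_
    rw [eq_neg_of_add_eq_zero_left ha]
    exact neg_mem (Ideal.sum_mem _ fun i hi =>
      Ideal.mul_mem_left _ _ (Ideal.subset_span ⟨i, hi, rfl⟩))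
  obtain ⟨b, hb⟩ : ∃ b : J → R, ∑ i ∈ s, b i * B i = a j := by
    obtain ⟨b, hb⟩ := (Submodule.mem_span_image_finset_iff_exists_fun R).1 hmem
    refine ⟨fun i => if h : i ∈ s then b ⟨i, h⟩ else 0, ?_⟩
    rw [← hb, ← Finset.sum_coe_sort]
    exact Finset.sum_congr rfl fun i _ => by simp
  obtain ⟨c, hc, hc0, hcs⟩ := hs (fun i => a i + b i * B j) (by
    rw [← ha, ← hb, Finset.sum_mul, ← Finset.sum_add_distrib]
    exact Finset.sum_congr rfl fun i _ => by ring)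
  -- The antisymmetric matrix for s is bordered by the row b and the column -b.
  refine ⟨fun i k => if i = j then (if k = j then 0 else b k) else
    (if k = j then - b i else c i k), fun i k => ?_, fun i => ?_, fun i hi => ?_⟩
  · by_cases hi : i = j <;> by_cases hk : k = j <;> simp [hi, hk, hc i k]
  · by_cases hi : i = j <;> simp [hi, hc0]
  · have hne : ∀ k ∈ s, k ≠ j := fun k hk => by rintro rfl; exact hj hk
    rw [Finset.sum_insert hj]
    by_cases hij : i = j
    · subst hij
      simp only [if_true, zero_mul, zero_add]
      rw [← hb]
      exact Finset.sum_congr rfl fun k hk => by rw [if_neg (hne k hk)]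
    · have his : i ∈ s := (Finset.mem_insert.1 hi).resolve_left hij
      simp only [if_neg hij, if_true]
      have h1 : ∑ k ∈ s, (if k = j then - b i else c i k) * B k = ∑ k ∈ s, c i k * B k :=
        Finset.sum_congr rfl fun k hk => by rw [if_neg (hne k hk)]
      rw [h1, ← hcs i his]
      ring

lemma hasKoszulSyzygies_of_regular {B : J → R}
    (hreg : ∀ (s : Finset J) (j : J), j ∉ s → ∀ a,
      a * B j ∈ Ideal.span (B '' (s : Set J)) → a ∈ Ideal.span (B '' (s : Set J)))
    (s : Finset J) : HasKoszulSyzygies B s := by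
  classical
  induction s using Finset.induction_on with
  | empty => exact fun a _ => ⟨fun _ _ => 0, by simp, by simp, by simp⟩
  | insert j s hj ih => exact ih.insert hj (hreg s j hj)

/-- The terms at (i, j) and (j, i) cancel. The vanishing diagonal is a separate assumption because
antisymmetry alone yields only 2 c_{ii} = 0. -/
lemma sum_sum_eq_zero_of_antisymm {A : Type*} [CommRing A] (s : Finset J) (c : J → J → A)
    (G : J → A) (hc : ∀ i j, c i j = - c j i) (hc0 : ∀ i, c i i = 0) :
    ∑ j ∈ s, (∑ i ∈ s, c j i * G i) * G j = 0 := by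
  classical
  simp only [Finset.sum_mul]
  rw [← Finset.sum_product']
  refine Finset.sum_involution (fun p _ => (p.2, p.1)) ?_ ?_ ?_ ?_
  · rintro ⟨i, j⟩ _
    simp only
    rw [hc i j]
    ring
  · rintro ⟨i, j⟩ _ hne h
    obtain rfl : j = i := congrArg Prod.fst h
    exact hne (by simp [hc0])
  · rintro ⟨i, j⟩ h
    simpa [and_comm] using h
  · rintro ⟨i, j⟩ _
    rfl

variable [Fintype J]

/-- If the constant coefficients of the series `G` only have Koszul syzygies, then the ideal
generated by `G` is saturated with respect to `X`. -/
lemma mem_span_of_X_mul_mem {G : J → PowerSeries R}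
    (hK : HasKoszulSyzygies (fun j => PowerSeries.constantCoeff (G j)) Finset.univ)
    {f : PowerSeries R} (hf : PowerSeries.X * f ∈ Ideal.span (Set.range G)) :
    f ∈ Ideal.span (Set.range G) := by
  obtain ⟨a, ha⟩ := (Ideal.mem_span_range_iff_exists_fun).1 hf
  have h0 : ∑ j, PowerSeries.constantCoeff (a j) * PowerSeries.constantCoeff (G j) = 0 := by
    have := congrArg (PowerSeries.constantCoeff (R := R)) ha
    simpa using this
  obtain ⟨c, hc, hc0, hcs⟩ := hK _ h0
  -- The Koszul relation of the constant terms is lifted with the same coefficients to a relation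
  -- between the G. Subtracting it does not change the sum and makes every coefficient divisible by
  -- X.
  have hdvd : ∀ j, ∃ b, a j - ∑ i, PowerSeries.C (c j i) * G i = PowerSeries.X * b := by
    intro j
    refine PowerSeries.X_dvd_iff.2 ?_
    simp [hcs j (Finset.mem_univ j)]
  choose b hb using hdvd
  have hsum : PowerSeries.X * f = PowerSeries.X * ∑ j, b j * G j := by
    have h1 := sum_sum_eq_zero_of_antisymm Finset.univ (fun j i => PowerSeries.C (c j i)) G
      (fun i j => by rw [hc i j, map_neg]) (fun i => by rw [hc0, map_zero])
    rw [← ha, Finset.mul_sum, ← sub_zero (∑ j, a j * G j), ← h1, ← Finset.sum_sub_distrib]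
    refine Finset.sum_congr rfl fun j _ => ?_
    rw [← mul_assoc, ← hb j]
    ring
  have hfb : f = ∑ j, b j * G j := by
    ext n
    have := congrArg (PowerSeries.coeff (n + 1)) hsum
    rwa [PowerSeries.coeff_succ_X_mul, PowerSeries.coeff_succ_X_mul] at this
  rw [hfb]
  exact Ideal.sum_mem _ fun j _ => Ideal.mul_mem_left _ _ (Ideal.subset_span ⟨j, rfl⟩)

lemma mem_span_of_X_pow_mul_mem {G : J → PowerSeries R}
    (hK : HasKoszulSyzygies (fun j => PowerSeries.constantCoeff (G j)) Finset.univ) (n : ℕ)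
    {f : PowerSeries R} (hf : PowerSeries.X ^ n * f ∈ Ideal.span (Set.range G)) :
    f ∈ Ideal.span (Set.range G) := by
  induction n with
  | zero => simpa using hf
  | succ n ih => exact ih (mem_span_of_X_mul_mem hK (by rwa [← mul_assoc, ← pow_succ']))

lemma constantCoeff_mem_span {G : J → PowerSeries R} {f : PowerSeries R}
    (hf : f ∈ Ideal.span (Set.range G)) :
    PowerSeries.constantCoeff f ∈
      Ideal.span (Set.range fun j => PowerSeries.constantCoeff (G j)) := by
  obtain ⟨a, rfl⟩ := (Ideal.mem_span_range_iff_exists_fun).1 hf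
  rw [map_sum]
  refine Ideal.sum_mem _ fun j _ => ?_
  rw [map_mul]
  exact Ideal.mul_mem_left _ _ (Ideal.subset_span ⟨j, rfl⟩)

end Koszul

/-! ### Binomial ideals -/

section Binomial

variable {M : Type*} [AddCommGroup M]

/-- The twisted quotient map `x^m ↦ χ(m) x^{[m]}`. -/
def twistedQuotient (L : Submodule ℤ M) (χ : M →+ Additive ℂˣ) :
    AddMonoidAlgebra ℂ M →ₐ[ℂ] AddMonoidAlgebra ℂ (M ⧸ L) :=
  AddMonoidAlgebra.lift ℂ (AddMonoidAlgebra ℂ (M ⧸ L)) M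
    { toFun := fun m => AddMonoidAlgebra.single (L.mkQ m.toAdd) ((χ m.toAdd).toMul : ℂ)
      map_one' := by simp [AddMonoidAlgebra.one_def]
      map_mul' := fun m m' => by simp [AddMonoidAlgebra.single_mul_single] }

lemma twistedQuotient_single (L : Submodule ℤ M) (χ : M →+ Additive ℂˣ) (m : M) (r : ℂ) :
    twistedQuotient L χ (AddMonoidAlgebra.single m r) =
      AddMonoidAlgebra.single (L.mkQ m) (r * (χ m).toMul) := by
  unfold twistedQuotient
  rw [AddMonoidAlgebra.lift_single]
  simp [AddMonoidAlgebra.smul_single]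

variable {J : Type*}

/-- The binomial `x^m - q`. -/
def torusBinomial (m : M) (q : ℂ) : AddMonoidAlgebra ℂ M :=
  AddMonoidAlgebra.single m 1 - AddMonoidAlgebra.single 0 q

lemma twistedQuotient_torusBinomial (L : Submodule ℤ M) (χ : M →+ Additive ℂˣ) {m : M}
    (hm : m ∈ L) : twistedQuotient L χ (torusBinomial m ((χ m).toMul : ℂ)) = 0 := by
  have : L.mkQ m = 0 := by simpa using hm
  rw [torusBinomial, map_sub, twistedQuotient_single, twistedQuotient_single, this]
  simp

/-- The exponents whose binomial lies in I form a subgroup: products telescope, and inverses differ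
by a unit. -/
lemma torusBinomial_mem_of_mem_span (χ : M →+ Additive ℂˣ) (T : Set M)
    {I : Ideal (AddMonoidAlgebra ℂ M)}
    (hI : ∀ m ∈ T, torusBinomial m ((χ m).toMul : ℂ) ∈ I) {m : M} (hm : m ∈ Submodule.span ℤ T) :
    torusBinomial m ((χ m).toMul : ℂ) ∈ I := by
  rw [← Submodule.mem_toAddSubgroup, Submodule.span_int_eq_addSubgroupClosure] at hm
  induction hm using AddSubgroup.closure_induction with
  | mem m hm => exact hI m hm
  | zero => simp [torusBinomial]
  | add a b _ _ ha hb =>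
    have : torusBinomial (a + b) ((χ (a + b)).toMul : ℂ) =
        AddMonoidAlgebra.single b 1 * torusBinomial a ((χ a).toMul : ℂ) +
        AddMonoidAlgebra.single 0 ((χ a).toMul : ℂ) * torusBinomial b ((χ b).toMul : ℂ) := by
      simp [torusBinomial, mul_sub, AddMonoidAlgebra.single_mul_single, add_comm a b, mul_comm]
    rw [this]
    exact add_mem (Ideal.mul_mem_left _ _ ha) (Ideal.mul_mem_left _ _ hb)
  | neg a _ ha =>
    have : torusBinomial (-a) ((χ (-a)).toMul : ℂ) =
        AddMonoidAlgebra.single (-a) (- ((χ a).toMul : ℂ)⁻¹) *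
          torusBinomial a ((χ a).toMul : ℂ) := by
      simp [torusBinomial, mul_sub, AddMonoidAlgebra.single_mul_single]
      abel
    rw [this]
    exact Ideal.mul_mem_left _ _ ha

/-- The kernel of the twisted quotient map is generated by binomials. -/
lemma ker_twistedQuotient (χ : M →+ Additive ℂˣ) (T : Set M) :
    RingHom.ker (twistedQuotient (Submodule.span ℤ T) χ) =
      Ideal.span ((fun m => torusBinomial m ((χ m).toMul : ℂ)) '' T) := by
  set L := Submodule.span ℤ T with hL
  set I := Ideal.span ((fun m => torusBinomial m ((χ m).toMul : ℂ)) '' T) with hI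
  refine le_antisymm (fun f hf => ?_) ?_
  · have hT : ∀ m ∈ T, torusBinomial m ((χ m).toMul : ℂ) ∈ I := fun m hm =>
      Ideal.subset_span (Set.mem_image_of_mem (fun m => torusBinomial m ((χ m).toMul : ℂ)) hm)
    have hI' : ∀ m ∈ L, torusBinomial m ((χ m).toMul : ℂ) ∈ I := fun m hm =>
      torusBinomial_mem_of_mem_span χ T (I := I) hT hm
    let sec : M ⧸ L → M := Function.surjInv L.mkQ_surjective
    have hsec : ∀ q, L.mkQ (sec q) = q := Function.surjInv_eq L.mkQ_surjective
    -- A candidate left inverse modulo I, defined by a set-theoretic section of M → M/L.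
    -- Representatives of the same class differ by an element of L, whose binomial lies in I, so ψ
    -- undoes the twisted quotient modulo I.
    let ψ : AddMonoidAlgebra ℂ (M ⧸ L) →ₗ[ℂ] (AddMonoidAlgebra ℂ M ⧸ I) :=
      (Finsupp.linearCombination ℂ fun q => ((χ (sec q)).toMul : ℂ)⁻¹ •
        Ideal.Quotient.mk I (AddMonoidAlgebra.single (sec q) 1)) ∘ₗ
      (AddMonoidAlgebra.coeffLinearEquiv ℂ).toLinearMap
    have hψ : ∀ q r, ψ (AddMonoidAlgebra.single q r) =
        r • ((χ (sec q)).toMul : ℂ)⁻¹ • Ideal.Quotient.mk I (AddMonoidAlgebra.single (sec q) 1) := by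
      intro q r
      exact Finsupp.linearCombination_single _ _ _
    have hcomp : ∀ f, ψ (twistedQuotient L χ f) = Ideal.Quotient.mk I f := by
      intro f
      induction f using AddMonoidAlgebra.induction_linear with
      | zero => simp
      | add f g hf hg => rw [map_add, map_add, hf, hg, map_add]
      | single m r =>
        rw [twistedQuotient_single, hψ]
        set s := sec (L.mkQ m) with hs
        have hmem : m - s ∈ L := by
          rw [← Submodule.Quotient.mk_eq_zero, ← Submodule.mkQ_apply, map_sub, hsec, sub_self]
        have h1 := hI' _ hmem
        have h2 : AddMonoidAlgebra.single m r - (r * ((χ m).toMul : ℂ) * ((χ s).toMul : ℂ)⁻¹) •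
            AddMonoidAlgebra.single s (1 : ℂ) =
            AddMonoidAlgebra.single s r * torusBinomial (m - s) ((χ (m - s)).toMul : ℂ) := by
          simp [torusBinomial, mul_sub, AddMonoidAlgebra.single_mul_single, div_eq_mul_inv, mul_assoc]
        rw [smul_smul, ← Ideal.Quotient.mkₐ_eq_mk ℂ, ← map_smul, Ideal.Quotient.mkₐ_eq_mk,
          eq_comm, Ideal.Quotient.eq, h2]
        exact Ideal.mul_mem_left _ _ h1
    rw [← Ideal.Quotient.eq_zero_iff_mem, ← hcomp, (RingHom.mem_ker).1 hf, map_zero]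
  · rw [hI, Ideal.span_le]
    rintro _ ⟨m, hm, rfl⟩
    exact twistedQuotient_torusBinomial L χ (Submodule.subset_span hm)

/-- If m lies in the full lattice, its coordinates are those of k m divided by k, so they have the
same support. -/
lemma saturated_span_image {v : J → M} (hv : LinearIndependent ℤ v)
    (hsat : ∀ (k : ℤ) (m : M), k ≠ 0 → k • m ∈ Submodule.span ℤ (Set.range v) →
      m ∈ Submodule.span ℤ (Set.range v)) (s : Set J) (k : ℤ) (m : M) (hk : k ≠ 0)
    (hm : k • m ∈ Submodule.span ℤ (v '' s)) : m ∈ Submodule.span ℤ (v '' s) := by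
  obtain ⟨c, rfl⟩ := Finsupp.mem_span_range_iff_exists_finsupp.1
    (hsat k m hk (Submodule.span_mono (Set.image_subset_range _ _) hm))
  rw [Finsupp.mem_span_image_iff_linearCombination] at hm ⊢
  obtain ⟨d, hd, hdc⟩ := hm
  refine ⟨c, ?_, rfl⟩
  have h1 : d = k • c := by
    refine hv ?_
    rw [hdc, map_smul]
    rfl
  rw [Finsupp.mem_supported] at hd ⊢
  intro j hj
  refine hd ?_
  rw [h1]
  simpa [hk] using hj

variable [Module.Finite ℤ M]

/-- The quotient M/L is finitely generated and torsion free, and its group algebra is a Laurent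
polynomial ring. -/
lemma isDomain_of_saturated {L : Submodule ℤ M}
    (hL : ∀ (k : ℤ) (m : M), k ≠ 0 → k • m ∈ L → m ∈ L) :
    IsDomain (AddMonoidAlgebra ℂ (M ⧸ L)) := by
  have : IsAddTorsionFree (M ⧸ L) := by
    refine ⟨fun n hn x y hxy => ?_⟩
    obtain ⟨x, rfl⟩ := L.mkQ_surjective x
    obtain ⟨y, rfl⟩ := L.mkQ_surjective y
    simp only at hxy
    rw [← sub_eq_zero, ← map_sub, Submodule.mkQ_apply, Submodule.Quotient.mk_eq_zero]
    refine hL n _ (Int.natCast_ne_zero.2 hn) ?_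
    rw [← Submodule.Quotient.mk_eq_zero, ← Submodule.mkQ_apply, map_zsmul, map_sub, zsmul_sub,
      natCast_zsmul, natCast_zsmul, hxy, sub_self]
  have : AddMonoid.FG (M ⧸ L) := by
    rw [← AddGroup.fg_iff_addMonoid_fg, ← Module.Finite.iff_addGroup_fg]
    infer_instance
  infer_instance

/-- A character with prescribed values on a basis of a saturated sublattice. -/
lemma exists_character {v : J → M} (hv : LinearIndependent ℤ v)
    (hsat : ∀ (k : ℤ) (m : M), k ≠ 0 → k • m ∈ Submodule.span ℤ (Set.range v) →
      m ∈ Submodule.span ℤ (Set.range v)) (q : J → ℂˣ) :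
    ∃ χ : M →+ Additive ℂˣ, ∀ j, χ (v j) = Additive.ofMul (q j) := by
  set L := Submodule.span ℤ (Set.range v) with hL
  have : Module.IsTorsionFree ℤ (M ⧸ L) := by
    refine ⟨fun k hk x y hxy => ?_⟩
    obtain ⟨x, rfl⟩ := L.mkQ_surjective x
    obtain ⟨y, rfl⟩ := L.mkQ_surjective y
    simp only at hxy
    rw [← sub_eq_zero, ← map_sub, Submodule.mkQ_apply, Submodule.Quotient.mk_eq_zero]
    refine hsat k _ hk.ne_zero ?_
    rw [← Submodule.Quotient.mk_eq_zero, ← Submodule.mkQ_apply, map_zsmul, map_sub, zsmul_sub,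
      hxy, sub_self]
  -- The torsion-free quotient is projective, so L is a direct summand, and a homomorphism given on
  -- its basis extends to M through the projection π.
  obtain ⟨s, hs⟩ := Module.projective_lifting_property L.mkQ LinearMap.id L.mkQ_surjective
  have hs' : ∀ x, L.mkQ (s x) = x := fun x => LinearMap.congr_fun hs x
  let π : M →ₗ[ℤ] L := LinearMap.codRestrict L (LinearMap.id - s ∘ₗ L.mkQ) fun m => by
    rw [← Submodule.Quotient.mk_eq_zero, ← Submodule.mkQ_apply]
    simp only [LinearMap.sub_apply, LinearMap.id_apply, LinearMap.comp_apply, map_sub, hs',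
      sub_self]
  let χ := ((Module.Basis.span hv).constr ℤ fun j => Additive.ofMul (q j)) ∘ₗ π
  refine ⟨χ.toAddMonoidHom, fun j => ?_⟩
  have h0 : L.mkQ (v j) = 0 := by
    rw [Submodule.mkQ_apply, Submodule.Quotient.mk_eq_zero]
    exact Submodule.subset_span ⟨j, rfl⟩
  have hπ : π (v j) = Module.Basis.span hv j := by
    refine Subtype.ext ?_
    rw [Module.Basis.span_apply]
    change v j - s (L.mkQ (v j)) = v j
    rw [h0, map_zero, sub_zero]
  change ((Module.Basis.span hv).constr ℤ fun j => Additive.ofMul (q j)) (π (v j)) = _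
  rw [hπ, Module.Basis.constr_basis]

/-- After twisting by a character the ideal is the kernel of a map to the group algebra of M/L, a
domain. -/
theorem isPrime_span_torusBinomial {v : J → M} (hv : LinearIndependent ℤ v)
    (hsat : ∀ (k : ℤ) (m : M), k ≠ 0 → k • m ∈ Submodule.span ℤ (Set.range v) →
      m ∈ Submodule.span ℤ (Set.range v)) (q : J → ℂˣ) :
    (Ideal.span (Set.range fun j => torusBinomial (v j) (q j : ℂ))).IsPrime := by
  obtain ⟨χ, hχ⟩ := exists_character hv hsat q
  have h : (Set.range fun j => torusBinomial (v j) (q j : ℂ)) =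
      (fun m => torusBinomial m ((χ m).toMul : ℂ)) '' Set.range v := by
    rw [← Set.range_comp]
    congr 1
    funext j
    simp [hχ]
  rw [h, ← ker_twistedQuotient]
  have := isDomain_of_saturated hsat
  exact RingHom.ker_isPrime _

/-- Modulo any subfamily the ring embeds in a domain, where a further binomial is non-zero because
its exponent is independent of those already used. So the binomials are regular in any order. -/
theorem hasKoszulSyzygies_torusBinomial {v : J → M} (hv : LinearIndependent ℤ v)
    (hsat : ∀ (k : ℤ) (m : M), k ≠ 0 → k • m ∈ Submodule.span ℤ (Set.range v) →
      m ∈ Submodule.span ℤ (Set.range v)) (q : J → ℂˣ) (s : Finset J) :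
    HasKoszulSyzygies (fun j => torusBinomial (v j) (q j : ℂ)) s := by
  obtain ⟨χ, hχ⟩ := exists_character hv hsat q
  refine hasKoszulSyzygies_of_regular (fun s j hj a ha => ?_) s
  have h : (fun j => torusBinomial (v j) (q j : ℂ)) '' (s : Set J) =
      (fun m => torusBinomial m ((χ m).toMul : ℂ)) '' (v '' (s : Set J)) := by
    rw [← Set.image_comp]
    refine Set.image_congr fun j _ => ?_
    simp [hχ]
  rw [h, ← ker_twistedQuotient, RingHom.mem_ker] at ha ⊢
  have := isDomain_of_saturated (saturated_span_image hv hsat s)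
  rw [map_mul] at ha
  refine (mul_eq_zero.1 ha).resolve_right fun h0 => ?_
  have hmem : (Submodule.span ℤ (v '' (s : Set J))).mkQ (v j) ≠ 0 := by
    rw [Submodule.mkQ_apply, Ne, Submodule.Quotient.mk_eq_zero]
    exact hv.notMem_span_image hj
  rw [torusBinomial, map_sub, twistedQuotient_single, twistedQuotient_single, map_zero,
    sub_eq_zero, AddMonoidAlgebra.single_inj] at h0
  rcases h0 with h0 | h0
  · exact hmem h0.1
  · simp at h0

end Binomial

/-! ### Homogeneous components on the torus and the torus initial ideal -/

section WeightComponents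

variable {σ : Type*}

/-- Natural exponents as integral exponents. -/
def expCast : (σ →₀ ℕ) →+ (σ →₀ ℤ) := Finsupp.mapRange.addMonoidHom (Nat.castAddMonoidHom ℤ)

@[simp] lemma expCast_apply (m : σ →₀ ℕ) (i : σ) : expCast m i = m i := rfl

variable [Fintype σ]

lemma torus_prod_pow (m : σ →₀ ℕ) :
    (m.prod fun i k => (AddMonoidAlgebra.single (Finsupp.single i (1 : ℤ)) (1 : ℂ) :
      TorusRing σ) ^ k) = AddMonoidAlgebra.single (expCast m) 1 := by
  classical
  rw [Finsupp.prod_fintype _ _ (by simp)]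
  simp only [AddMonoidAlgebra.single_pow, one_pow, AddMonoidAlgebra.prod_single,
    Finset.prod_const_one]
  congr 1
  ext i
  simp [Finsupp.finsetSum_apply, Finsupp.single_apply]

lemma toTorusRing_monomial (m : σ →₀ ℕ) (c : ℂ) :
    toTorusRing (MvPolynomial.monomial m c) = AddMonoidAlgebra.single (expCast m) c := by
  unfold toTorusRing
  rw [MvPolynomial.aeval_monomial, torus_prod_pow, AddMonoidAlgebra.coe_algebraMap]
  simp [AddMonoidAlgebra.single_mul_single]

lemma toTorusRing_eq_sum (p : MvPolynomial σ ℂ) (s : Finset (σ →₀ ℕ)) (hs : p.support ⊆ s) :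
    toTorusRing p = ∑ m ∈ s, AddMonoidAlgebra.single (expCast m) (p.coeff m) := by
  conv_lhs => rw [p.as_sum, map_sum]
  simp only [toTorusRing_monomial]
  refine Finset.sum_subset hs fun m _ hm => ?_
  rw [MvPolynomial.notMem_support_iff.1 hm, AddMonoidAlgebra.single_zero]

lemma weightPairing_add (w : σ → ℝ) (m m' : σ →₀ ℕ) :
    weightPairing w (m + m') = weightPairing w m + weightPairing w m' := by
  simp [weightPairing, mul_add, Finset.sum_add_distrib]

lemma weightPairing_natCast (w : σ → ℕ) (m : σ →₀ ℕ) :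
    weightPairing (fun i => (w i : ℝ)) m = ((∑ i, w i * m i : ℕ) : ℝ) := by
  simp [weightPairing]

variable {w : σ → ℝ}

lemma finite_weightPairing_le (hw : ∀ i, 0 < w i) (K : ℝ) :
    {m : σ →₀ ℕ | weightPairing w m ≤ K}.Finite := by
  classical
  refine (Set.finite_Icc 0 (Finsupp.equivFunOnFinite.symm fun i => ⌊K / w i⌋₊)).subset
    fun m hm => ⟨zero_le, fun i => ?_⟩
  refine Nat.le_floor ((le_div_iff₀ (hw i)).2 (le_trans ?_ hm))
  rw [mul_comm]
  exact Finset.single_le_sum (f := fun i => w i * (m i : ℝ))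
    (fun j _ => mul_nonneg (hw j).le (Nat.cast_nonneg _)) (Finset.mem_univ i)

lemma finite_weightPairing_eq (hw : ∀ i, 0 < w i) (K : ℝ) :
    {m : σ →₀ ℕ | weightPairing w m = K}.Finite :=
  (finite_weightPairing_le hw K).subset fun _ h => le_of_eq h

/-- The component of weight `K` of a power series, as an element of the coordinate ring of the
torus. -/
def weightComponent (hw : ∀ i, 0 < w i) (K : ℝ) : MvPowerSeries σ ℂ →+ TorusRing σ where
  toFun f := ∑ m ∈ (finite_weightPairing_eq hw K).toFinset,
    AddMonoidAlgebra.single (expCast m) (MvPowerSeries.coeff m f)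
  map_zero' := by simp
  map_add' f g := by simp [AddMonoidAlgebra.single_add, Finset.sum_add_distrib]

lemma weightComponent_apply (hw : ∀ i, 0 < w i) (K : ℝ) (f : MvPowerSeries σ ℂ) :
    weightComponent hw K f = ∑ m ∈ (finite_weightPairing_eq hw K).toFinset,
      AddMonoidAlgebra.single (expCast m) (MvPowerSeries.coeff m f) := rfl

lemma weightComponent_mul_monomial (hw : ∀ i, 0 < w i) (K : ℝ) (f : MvPowerSeries σ ℂ)
    (m : σ →₀ ℕ) (c : ℂ) :
    weightComponent hw K (f * MvPowerSeries.monomial m c) =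
      weightComponent hw (K - weightPairing w m) f * AddMonoidAlgebra.single (expCast m) c := by
  classical
  rw [weightComponent_apply, weightComponent_apply, Finset.sum_mul]
  simp only [AddMonoidAlgebra.single_mul_single, MvPowerSeries.coeff_mul_monomial]
  symm
  refine Finset.sum_of_injOn (fun k => k + m) (add_left_injective m).injOn ?_ ?_ ?_
  · intro k hk
    simp only [Set.Finite.coe_toFinset, Set.mem_ofPred_eq] at hk ⊢
    rw [weightPairing_add, hk]
    ring
  · intro k hk hk'
    rw [if_neg, AddMonoidAlgebra.single_zero]
    intro hmk
    refine hk' ⟨k - m, ?_, tsub_add_cancel_of_le hmk⟩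
    have h1 : weightPairing w k = weightPairing w (k - m) + weightPairing w m := by
      rw [← weightPairing_add, tsub_add_cancel_of_le hmk]
    simp only [Set.Finite.coe_toFinset, Set.Finite.mem_toFinset, Set.mem_ofPred_eq] at hk ⊢
    linarith
  · intro k _
    rw [if_pos (le_add_of_nonneg_left (zero_le (a := k))), add_tsub_cancel_right, map_add]

lemma weightComponent_mul_coe (hw : ∀ i, 0 < w i) (K α : ℝ) (f : MvPowerSeries σ ℂ)
    (p : MvPolynomial σ ℂ) (hp : ∀ m ∈ p.support, weightPairing w m = α) :
    weightComponent hw K (f * (p : MvPowerSeries σ ℂ)) =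
      weightComponent hw (K - α) f * toTorusRing p := by
  have h1 : (p : MvPowerSeries σ ℂ) = ∑ m ∈ p.support, MvPowerSeries.monomial m (p.coeff m) := by
    conv_lhs => rw [p.as_sum]
    rw [← MvPolynomial.coeToMvPowerSeries.ringHom_apply, map_sum]
    simp
  rw [h1, Finset.mul_sum, map_sum, toTorusRing_eq_sum p p.support subset_rfl, Finset.mul_sum]
  refine Finset.sum_congr rfl fun m hm => ?_
  rw [weightComponent_mul_monomial, hp m hm]

lemma weightComponent_monomial (hw : ∀ i, 0 < w i) (m : σ →₀ ℕ) (c : ℂ) :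
    weightComponent hw (weightPairing w m) (MvPowerSeries.monomial m c) =
      AddMonoidAlgebra.single (expCast m) c := by
  classical
  rw [weightComponent_apply, Finset.sum_eq_single m]
  · rw [MvPowerSeries.coeff_monomial_same]
  · intro k _ hk
    rw [MvPowerSeries.coeff_monomial_ne hk, AddMonoidAlgebra.single_zero]
  · intro h
    exact absurd (by simp) h

open Classical in
lemma toTorusRing_eq_sum_weightComponent (hw : ∀ i, 0 < w i) (p : MvPolynomial σ ℂ) :
    toTorusRing p = ∑ K ∈ p.support.image (weightPairing w),
      weightComponent hw K (p : MvPowerSeries σ ℂ) := by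
  rw [toTorusRing_eq_sum p p.support subset_rfl,
    ← Finset.sum_fiberwise_of_maps_to (t := p.support.image (weightPairing w))
      (g := weightPairing w) fun m hm => Finset.mem_image_of_mem _ hm]
  refine Finset.sum_congr rfl fun K _ => ?_
  rw [weightComponent_apply]
  refine Finset.sum_subset_zero_on_sdiff (fun m hm => ?_) (fun m hm => ?_) fun m _ => ?_
  · simpa using (Finset.mem_filter.1 hm).2
  · simp only [Finset.mem_sdiff, Set.Finite.mem_toFinset, Set.mem_ofPred_eq, Finset.mem_filter,
      not_and] at hm
    have : m ∉ p.support := fun h => hm.2 h hm.1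
    rw [MvPolynomial.coeff_coe, MvPolynomial.notMem_support_iff.1 this,
      AddMonoidAlgebra.single_zero]
  · rw [MvPolynomial.coeff_coe]

/-! ### Initial forms -/

lemma le_of_coeff_initialSeries_ne_zero {f : MvPowerSeries σ ℂ} {m k : σ →₀ ℕ}
    (hm : MvPowerSeries.coeff m (initialSeries w f) ≠ 0) (hk : MvPowerSeries.coeff k f ≠ 0) :
    weightPairing w m ≤ weightPairing w k := by
  rw [coeff_initialSeries] at hm
  split_ifs at hm with h
  · exact h k hk
  · exact absurd rfl hm

lemma coeff_ne_zero_of_initialSeries {f : MvPowerSeries σ ℂ} {m : σ →₀ ℕ}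
    (hm : MvPowerSeries.coeff m (initialSeries w f) ≠ 0) : MvPowerSeries.coeff m f ≠ 0 := by
  rw [coeff_initialSeries] at hm
  split_ifs at hm with h
  · exact hm
  · exact absurd rfl hm

lemma exists_polynomial_eq_initialSeries (hw : ∀ i, 0 < w i) (f : MvPowerSeries σ ℂ) :
    ∃ (p : MvPolynomial σ ℂ) (α : ℝ), (p : MvPowerSeries σ ℂ) = initialSeries w f ∧
      ∀ m ∈ p.support, weightPairing w m = α := by
  classical
  by_cases h : ∃ m₀, MvPowerSeries.coeff m₀ (initialSeries w f) ≠ 0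
  · obtain ⟨m₀, hm₀⟩ := h
    have hα : ∀ m, MvPowerSeries.coeff m (initialSeries w f) ≠ 0 →
        weightPairing w m = weightPairing w m₀ := fun m hm =>
      le_antisymm (le_of_coeff_initialSeries_ne_zero hm (coeff_ne_zero_of_initialSeries hm₀))
        (le_of_coeff_initialSeries_ne_zero hm₀ (coeff_ne_zero_of_initialSeries hm))
    have hp : ((∑ m ∈ (finite_weightPairing_eq hw (weightPairing w m₀)).toFinset,
        MvPolynomial.monomial m (MvPowerSeries.coeff m (initialSeries w f)) :
          MvPolynomial σ ℂ) : MvPowerSeries σ ℂ) = initialSeries w f := by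
      ext k
      rw [MvPolynomial.coeff_coe, MvPolynomial.coeff_sum]
      simp only [MvPolynomial.coeff_monomial]
      rw [Finset.sum_ite_eq']
      split_ifs with hk
      · rfl
      · by_contra hne
        exact hk (by simpa using hα k (Ne.symm hne))
    refine ⟨_, weightPairing w m₀, hp, fun m hm => hα m ?_⟩
    rw [← hp, MvPolynomial.coeff_coe]
    exact MvPolynomial.mem_support_iff.1 hm
  · push Not at h
    exact ⟨0, 0, by ext m; rw [h m]; simp, by simp⟩

/-- The initial form as a weight component. -/
lemma weightComponent_eq_toTorusRing (hw : ∀ i, 0 < w i) {K : ℝ} {f : MvPowerSeries σ ℂ}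
    {p : MvPolynomial σ ℂ} (hp : (p : MvPowerSeries σ ℂ) = initialSeries w f) {m₀ : σ →₀ ℕ}
    (hm₀ : m₀ ∈ p.support) (hK : weightPairing w m₀ = K) :
    weightComponent hw K f = toTorusRing p := by
  have hpc : ∀ m, p.coeff m = MvPowerSeries.coeff m (initialSeries w f) := fun m => by
    rw [← hp, MvPolynomial.coeff_coe]
  have hm₀' : MvPowerSeries.coeff m₀ (initialSeries w f) ≠ 0 := by
    rw [← hpc]; exact MvPolynomial.mem_support_iff.1 hm₀
  rw [toTorusRing_eq_sum p (finite_weightPairing_eq hw K).toFinset, weightComponent_apply]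
  · refine Finset.sum_congr rfl fun m hm => ?_
    rw [hpc, coeff_initialSeries, if_pos]
    intro k hk
    have hmK : weightPairing w m = K := by simpa using hm
    rw [hmK, ← hK]
    exact le_of_coeff_initialSeries_ne_zero hm₀' hk
  · intro m hm
    have hm' : MvPowerSeries.coeff m (initialSeries w f) ≠ 0 := by
      rw [← hpc]; exact MvPolynomial.mem_support_iff.1 hm
    simp only [Set.Finite.mem_toFinset, Set.mem_ofPred_eq]
    rw [← hK]
    exact le_antisymm
      (le_of_coeff_initialSeries_ne_zero hm' (coeff_ne_zero_of_initialSeries hm₀'))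
      (le_of_coeff_initialSeries_ne_zero hm₀' (coeff_ne_zero_of_initialSeries hm'))

/-- The generators of the initial ideal are w-homogeneous polynomials, so a component of a power
series multiple is a component of the multiplier times the generator. -/
lemma weightComponent_mem_torusInitialIdeal (hw : ∀ i, 0 < w i) {I : Ideal (ConvergentSeries σ)}
    {f : ConvergentSeries σ} (hf : f ∈ initialIdeal w I) (K : ℝ) :
    weightComponent hw K (f : MvPowerSeries σ ℂ) ∈ torusInitialIdeal w I := by
  -- An arbitrary multiplier b is included so that the span induction survives multiplication by
  -- scalars.
  have key : ∀ (b : MvPowerSeries σ ℂ) (K : ℝ),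
      weightComponent hw K (b * (f : MvPowerSeries σ ℂ)) ∈ torusInitialIdeal w I := by
    unfold initialIdeal at hf
    induction hf using Submodule.span_induction with
    | mem x hx =>
      obtain ⟨g, hg, rfl⟩ := hx
      intro b K
      obtain ⟨p, α, hp, hα⟩ := exists_polynomial_eq_initialSeries hw (g : MvPowerSeries σ ℂ)
      change weightComponent hw K (b * initialSeries w (g : MvPowerSeries σ ℂ)) ∈ _
      rw [← hp, weightComponent_mul_coe hw K α b p hα]
      exact Ideal.mul_mem_left _ _ (Ideal.subset_span ⟨p, g, hg, hp, rfl⟩)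
    | zero => intro b K; simp
    | add x y _ _ hx hy =>
      intro b K
      rw [Subalgebra.coe_add, mul_add, map_add]
      exact add_mem (hx b K) (hy b K)
    | smul a x _ hx =>
      intro b K
      rw [smul_eq_mul, Subalgebra.coe_mul, ← mul_assoc]
      exact hx _ K
  simpa using key 1 K

/-- A monomial in the initial ideal would become a unit on the torus. -/
lemma mem_localTrop_of_torusInitialIdeal_ne_top (hw : ∀ i, 0 < w i)
    {I : Ideal (ConvergentSeries σ)} (hI : torusInitialIdeal w I ≠ ⊤) : w ∈ localTrop I := by
  refine ⟨fun i => (hw i).le, fun m hm => hI ?_⟩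
  have h := weightComponent_mem_torusInitialIdeal hw hm (weightPairing w m)
  change weightComponent hw _ (MvPowerSeries.monomial m 1) ∈ _ at h
  rw [weightComponent_monomial] at h
  refine Ideal.eq_top_of_isUnit_mem _ h ?_
  refine IsUnit.of_mul_eq_one (AddMonoidAlgebra.single (-expCast m) 1) ?_
  rw [AddMonoidAlgebra.single_mul_single]
  simp [AddMonoidAlgebra.one_def]

/-- The torus ideal is generated by w-initial forms, not by all elements of the initial ideal. A
w-initial form is a polynomial, hence the finite sum of its w'-components, which belong to the torus
ideal of w'. -/
lemma torusInitialIdeal_le_of_initialIdeal_eq {w' : σ → ℝ} (hw' : ∀ i, 0 < w' i)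
    {I : Ideal (ConvergentSeries σ)} (h : initialIdeal w I = initialIdeal w' I) :
    torusInitialIdeal w I ≤ torusInitialIdeal w' I := by
  classical
  refine Ideal.span_le.2 ?_
  rintro _ ⟨p, f, hf, hp, rfl⟩
  have hmem : initialForm w f ∈ initialIdeal w' I := by
    rw [← h]; exact Ideal.subset_span ⟨f, hf, rfl⟩
  rw [toTorusRing_eq_sum_weightComponent hw' p, hp]
  exact Ideal.sum_mem _ fun K _ => weightComponent_mem_torusInitialIdeal hw' hmem K

end WeightComponents

/-! ### The one-parameter degeneration z_i ↦ x_i t^{w_i} -/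

section Degeneration

variable {σ : Type*} [Fintype σ]

lemma HasKoszulSyzygies.units_mul {R J : Type*} [CommRing R] {B : J → R} {s : Finset J}
    (h : HasKoszulSyzygies B s) (u : J → Rˣ) : HasKoszulSyzygies (fun j => u j * B j) s := by
  intro a ha
  obtain ⟨c, hc, hc0, hcs⟩ := h (fun j => a j * u j) (by simpa only [mul_assoc] using ha)
  refine ⟨fun j i => ↑(u j)⁻¹ * c j i * ↑(u i)⁻¹, fun i j => ?_, fun i => ?_, fun j hj => ?_⟩
  · simp only; rw [hc i j]; ring
  · simp only; rw [hc0]; ring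
  · have h1 := hcs j hj
    calc a j = ↑(u j)⁻¹ * (a j * u j) := by rw [mul_comm (a j), Units.inv_mul_cancel_left]
      _ = ↑(u j)⁻¹ * ∑ i ∈ s, c j i * B i := by rw [← h1]
      _ = _ := by
        rw [Finset.mul_sum]
        refine Finset.sum_congr rfl fun i _ => ?_
        rw [mul_assoc (_ * _), Units.inv_mul_cancel_left, mul_assoc]

/-- The series `x_i t^{w_i}`. -/
def weightedVariable (w : σ → ℕ) (i : σ) : PowerSeries (TorusRing σ) :=
  PowerSeries.C (AddMonoidAlgebra.single (Finsupp.single i (1 : ℤ)) (1 : ℂ)) * PowerSeries.X ^ w i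

lemma hasSubst_weightedVariable {w : σ → ℕ} (hw : ∀ i, 0 < w i) :
    MvPowerSeries.HasSubst (weightedVariable w) := by
  refine MvPowerSeries.hasSubst_of_constantCoeff_zero fun i => ?_
  change PowerSeries.constantCoeff (weightedVariable w i) = 0
  rw [← PowerSeries.coeff_zero_eq_constantCoeff_apply, weightedVariable, PowerSeries.coeff_C_mul_X_pow,
    if_neg (hw i).ne]

/-- The substitution `z_i ↦ x_i t^{w_i}`. -/
def weightedSubst {w : σ → ℕ} (hw : ∀ i, 0 < w i) :
    MvPowerSeries σ ℂ →ₐ[ℂ] PowerSeries (TorusRing σ) :=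
  MvPowerSeries.substAlgHom (hasSubst_weightedVariable hw)

lemma prod_weightedVariable (w : σ → ℕ) (d : σ →₀ ℕ) :
    (d.prod fun i k => weightedVariable w i ^ k) =
      PowerSeries.C (AddMonoidAlgebra.single (expCast d) (1 : ℂ)) *
        PowerSeries.X ^ (∑ i, w i * d i) := by
  rw [← torus_prod_pow, Finsupp.prod_fintype _ _ (by simp), Finsupp.prod_fintype _ _ (by simp)]
  simp only [weightedVariable, mul_pow, Finset.prod_mul_distrib,
    ← map_pow, ← map_prod, ← pow_mul, Finset.prod_pow_eq_pow_sum]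

/-- A monomial of exponent d goes to x^d t^{w·d}. Positivity of w leaves finitely many d for each
power of t. -/
lemma coeff_weightedSubst {w : σ → ℕ} (hw : ∀ i, 0 < w i)
    (hw' : ∀ i, (0 : ℝ) < (fun i => (w i : ℝ)) i) (f : MvPowerSeries σ ℂ) (n : ℕ) :
    PowerSeries.coeff n (weightedSubst hw f) = weightComponent hw' n f := by
  classical
  unfold weightedSubst
  rw [MvPowerSeries.coe_substAlgHom, PowerSeries.coeff, MvPowerSeries.coeff_subst
    (hasSubst_weightedVariable hw), weightComponent_apply]
  rw [finsum_eq_sum_of_support_subset (s := (finite_weightPairing_eq hw' n).toFinset)]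
  · refine Finset.sum_congr rfl fun d hd => ?_
    rw [prod_weightedVariable]
    change _ • PowerSeries.coeff n _ = _
    rw [PowerSeries.coeff_C_mul_X_pow, if_pos, AddMonoidAlgebra.smul_single]
    · simp
    · have : weightPairing (fun i => (w i : ℝ)) d = n := by simpa using hd
      rw [weightPairing_natCast] at this
      exact_mod_cast this.symm
  · intro d hd
    rw [Function.mem_support, prod_weightedVariable] at hd
    change _ • PowerSeries.coeff n _ ≠ 0 at hd
    rw [PowerSeries.coeff_C_mul_X_pow] at hd
    simp only [Set.Finite.coe_toFinset, Set.mem_ofPred_eq, weightPairing_natCast]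
    by_contra hne
    refine hd ?_
    rw [if_neg, smul_zero]
    exact fun h => hne (by rw [h])

lemma weightedSubst_eq_X_pow_mul {w : σ → ℕ} (hw : ∀ i, 0 < w i)
    (hw' : ∀ i, (0 : ℝ) < (fun i => (w i : ℝ)) i) {f : MvPowerSeries σ ℂ} {n : ℕ}
    (hf : ∀ m, MvPowerSeries.coeff m f ≠ 0 → n ≤ ∑ i, w i * m i) :
    ∃ g, weightedSubst hw f = PowerSeries.X ^ n * g ∧
      PowerSeries.constantCoeff g = weightComponent hw' n f := by
  have hdvd : PowerSeries.X ^ n ∣ weightedSubst hw f := by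
    rw [PowerSeries.X_pow_dvd_iff]
    intro k hk
    rw [coeff_weightedSubst hw hw', weightComponent_apply]
    refine Finset.sum_eq_zero fun m hm => ?_
    have hmk : weightPairing (fun i => (w i : ℝ)) m = k := by simpa using hm
    rw [weightPairing_natCast] at hmk
    have hmk' : ∑ i, w i * m i = k := by exact_mod_cast hmk
    have : MvPowerSeries.coeff m f = 0 := by
      by_contra hne
      exact absurd (hf m hne) (by omega)
    rw [this, AddMonoidAlgebra.single_zero]
  obtain ⟨g, hg⟩ := hdvd
  refine ⟨g, hg, ?_⟩
  rw [← coeff_weightedSubst hw hw', hg]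
  have := PowerSeries.coeff_X_pow_mul g n 0
  rw [zero_add] at this
  rw [this, PowerSeries.coeff_zero_eq_constantCoeff_apply]

/-- If the initial forms of generators of an ideal only have Koszul syzygies, then they generate
the ideal of all initial forms. -/
theorem weightComponent_mem_span {J : Type*} [Fintype J] {w : σ → ℕ} (hw : ∀ i, 0 < w i)
    (hw' : ∀ i, (0 : ℝ) < (fun i => (w i : ℝ)) i) (F : J → ConvergentSeries σ) (α : J → ℕ)
    (hF : ∀ j m, MvPowerSeries.coeff m (F j : MvPowerSeries σ ℂ) ≠ 0 → α j ≤ ∑ i, w i * m i)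
    (hK : HasKoszulSyzygies
      (fun j => weightComponent hw' (α j) (F j : MvPowerSeries σ ℂ)) Finset.univ)
    {f : ConvergentSeries σ} (hf : f ∈ Ideal.span (Set.range F)) {n : ℕ}
    (hn : ∀ m, MvPowerSeries.coeff m (f : MvPowerSeries σ ℂ) ≠ 0 → n ≤ ∑ i, w i * m i) :
    weightComponent hw' n (f : MvPowerSeries σ ℂ) ∈
      Ideal.span (Set.range fun j => weightComponent hw' (α j) (F j : MvPowerSeries σ ℂ)) := by
  -- The generators become t^{α_j} G_j and f becomes t^n g. Since t^n g lies in the ideal of the G,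
  -- saturation removes t^n, and reduction modulo t gives the claim.
  choose G hG hG0 using fun j => weightedSubst_eq_X_pow_mul hw hw' (hF j)
  obtain ⟨g, hg, hg0⟩ := weightedSubst_eq_X_pow_mul hw hw' hn
  have hmem : weightedSubst hw (f : MvPowerSeries σ ℂ) ∈ Ideal.span (Set.range G) := by
    obtain ⟨a, rfl⟩ := (Ideal.mem_span_range_iff_exists_fun).1 hf
    rw [AddSubmonoidClass.coe_finsetSum, map_sum]
    refine Ideal.sum_mem _ fun j _ => ?_
    rw [Subalgebra.coe_mul, map_mul, hG j]
    exact Ideal.mul_mem_left _ _ (Ideal.mul_mem_left _ _ (Ideal.subset_span ⟨j, rfl⟩))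
  rw [hg] at hmem
  simp only [← hG0] at hK ⊢
  rw [← hg0]
  exact constantCoeff_mem_span (mem_span_of_X_pow_mul_mem hK n hmem)

end Degeneration

/-! ### Approximation of real weights -/

/-- For slopes near ρ only finitely many points can compete with x, so strict minimality persists at
a nearby rational slope q; clearing denominators gives a and b. -/
lemma exists_nat_weights_of_unique {P : Set (ℕ × ℕ)} {ρ : ℝ} (hρ : 0 < ρ) {x : ℕ × ℕ}
    (hx : ∀ y ∈ P, y ≠ x → (x.1 : ℝ) + ρ * x.2 < y.1 + ρ * y.2) :
    ∃ a b : ℕ, 0 < a ∧ 0 < b ∧ ∀ y ∈ P, y ≠ x → a * x.1 + b * x.2 < a * y.1 + b * y.2 := by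
  -- The bounds are such that a point outside this box is beaten by x for every slope strictly
  -- between ρ/2 and 2ρ.
  have hfin : {y : ℕ × ℕ | (y.1 : ℝ) ≤ x.1 + 2 * ρ * x.2 ∧
      (y.2 : ℝ) ≤ x.2 + 2 * x.1 / ρ}.Finite := by
    refine (Set.finite_Iic (⌊(x.1 : ℝ) + 2 * ρ * x.2⌋₊, ⌊(x.2 : ℝ) + 2 * x.1 / ρ⌋₊)).subset ?_
    exact fun y hy => ⟨Nat.le_floor hy.1, Nat.le_floor hy.2⟩
  have hev : ∀ᶠ r in nhds ρ, ∀ y ∈ {y : ℕ × ℕ | (y.1 : ℝ) ≤ x.1 + 2 * ρ * x.2 ∧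
      (y.2 : ℝ) ≤ x.2 + 2 * x.1 / ρ}, y ∈ P → y ≠ x → (x.1 : ℝ) + r * x.2 < y.1 + r * y.2 := by
    rw [Filter.eventually_all_finite hfin]
    intro y _
    by_cases hy : y ∈ P ∧ y ≠ x
    · have hc : Continuous fun r : ℝ => (y.1 : ℝ) + r * y.2 - ((x.1 : ℝ) + r * x.2) := by fun_prop
      have := hc.continuousAt.eventually (lt_mem_nhds (sub_pos.2 (hx y hy.1 hy.2)))
      filter_upwards [this] with r hr _ _
      exact sub_pos.1 hr
    · exact Filter.Eventually.of_forall fun r h1 h2 => absurd ⟨h1, h2⟩ hy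
  have hev2 : ∀ᶠ r in nhds ρ, ρ / 2 < r ∧ r < 2 * ρ :=
    (lt_mem_nhds (by linarith)).and (gt_mem_nhds (by linarith))
  obtain ⟨ε, hε, hball⟩ := Metric.eventually_nhds_iff.1 (hev.and hev2)
  obtain ⟨q, hq1, hq2⟩ := exists_rat_btwn (show ρ < ρ + ε by linarith)
  obtain ⟨hq3, hq4, hq5⟩ := hball (y := (q : ℝ)) (by
    rw [Real.dist_eq, abs_lt]; constructor <;> linarith)
  have hq0 : 0 < q := by exact_mod_cast hρ.trans hq1
  have hqn : 0 < q.num := Rat.num_pos.2 hq0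
  have hqd : (0 : ℝ) < q.den := Nat.cast_pos.2 q.den_pos
  refine ⟨q.den, q.num.toNat, q.den_pos, by omega, fun y hyP hyx => ?_⟩
  have hnum : ((q.num.toNat : ℕ) : ℝ) = q * q.den := by
    have h1 : ((q.num.toNat : ℕ) : ℝ) = ((q.num.toNat : ℤ) : ℝ) := by push_cast; rfl
    rw [h1, Int.toNat_of_nonneg hqn.le]
    have := Rat.mul_den_eq_num q
    exact_mod_cast this.symm
  have hmain : (x.1 : ℝ) + q * x.2 < y.1 + q * y.2 := by
    by_cases hy : (y.1 : ℝ) ≤ x.1 + 2 * ρ * x.2 ∧ (y.2 : ℝ) ≤ x.2 + 2 * x.1 / ρ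
    · exact hq3 y hy hyP hyx
    · rw [not_and_or, not_le, not_le] at hy
      have hq' : (0 : ℝ) < q := hρ.trans hq1
      have hx2 : (0 : ℝ) ≤ x.2 := Nat.cast_nonneg _
      have hx1 : (0 : ℝ) ≤ x.1 := Nat.cast_nonneg _
      rcases hy with hy | hy
      · have : (q : ℝ) * x.2 ≤ 2 * ρ * x.2 := mul_le_mul_of_nonneg_right hq5.le hx2
        have h3 : (0 : ℝ) ≤ q * y.2 := mul_nonneg hq'.le (Nat.cast_nonneg _)
        linarith
      · have h1 : (q : ℝ) * (x.2 + 2 * x.1 / ρ) < q * y.2 := mul_lt_mul_of_pos_left hy hq'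
        have h2 : (x.1 : ℝ) ≤ q * (2 * x.1 / ρ) := by
          rw [← mul_div_assoc, le_div_iff₀ hρ]
          nlinarith
        have h3 : (0 : ℝ) ≤ y.1 := Nat.cast_nonneg _
        linarith
  have : (q.den : ℝ) * x.1 + (q.num.toNat : ℕ) * x.2 < q.den * y.1 + (q.num.toNat : ℕ) * y.2 := by
    rw [hnum]
    nlinarith
  exact_mod_cast this

/-- A positive linear functional on a set of pairs of natural numbers may be replaced by one with
integral coefficients without changing the set of minimal points. -/
lemma exists_nat_weights {P : Set (ℕ × ℕ)} (hP : P.Nonempty) {a b : ℝ} (ha : 0 < a) (hb : 0 < b) :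
    ∃ a' b' : ℕ, 0 < a' ∧ 0 < b' ∧ ∀ x ∈ P,
      ((∀ y ∈ P, a * x.1 + b * x.2 ≤ a * y.1 + b * y.2) ↔
        (∀ y ∈ P, a' * x.1 + b' * x.2 ≤ a' * y.1 + b' * y.2)) := by
  -- A tie between two distinct points forces a/b to be rational, and the functional is proportional
  -- to an integral one. Without ties the minimizer is unique and the preceding lemma applies.
  by_cases h : ∃ x ∈ P, ∃ x' ∈ P, x ≠ x' ∧ a * x.1 + b * x.2 = a * x'.1 + b * x'.2
  · obtain ⟨x, -, x', -, hne, heq⟩ := h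
    have h1 : a * ((x.1 : ℝ) - x'.1) = b * ((x'.2 : ℝ) - x.2) := by linarith
    have hne1 : x.1 ≠ x'.1 := by
      intro h
      rw [h, sub_self, mul_zero] at h1
      have h2 : (x'.2 : ℝ) - x.2 = 0 := (mul_eq_zero.1 h1.symm).resolve_left hb.ne'
      exact hne (Prod.ext h (by exact_mod_cast (sub_eq_zero.1 h2).symm))
    have habs : a * |(x.1 : ℝ) - x'.1| = b * |(x'.2 : ℝ) - x.2| := by
      rw [← abs_of_pos ha, ← abs_mul, h1, abs_mul, abs_of_pos hb]
    set i : ℕ := ((x.1 : ℤ) - x'.1).natAbs with hi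
    set j : ℕ := ((x'.2 : ℤ) - x.2).natAbs with hj
    have hi' : (i : ℝ) = |(x.1 : ℝ) - x'.1| := by
      rw [hi, Nat.cast_natAbs]; push_cast; rfl
    have hj' : (j : ℝ) = |(x'.2 : ℝ) - x.2| := by
      rw [hj, Nat.cast_natAbs]; push_cast; rfl
    rw [← hi', ← hj'] at habs
    have hi0 : 0 < i := by omega
    have hi0' : (0 : ℝ) < i := Nat.cast_pos.2 hi0
    have hj0' : (0 : ℝ) < j := by
      by_contra hcon
      have : (j : ℝ) = 0 := le_antisymm (not_lt.1 hcon) (Nat.cast_nonneg _)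
      rw [this, mul_zero] at habs
      exact (mul_pos ha hi0').ne' habs
    -- Since a i = b j, the functional equals b/i times the integral one with coefficients j and i.
    refine ⟨j, i, Nat.cast_pos.1 hj0', hi0, fun y _ => forall₂_congr fun z _ => ?_⟩
    have key : ∀ y : ℕ × ℕ, a * y.1 + b * y.2 = b / i * ((j * y.1 + i * y.2 : ℕ) : ℝ) := by
      intro y
      have : a = b * j / i := by rw [eq_div_iff hi0'.ne']; exact habs
      rw [this]
      push_cast
      field_simp
    rw [key y, key z, mul_le_mul_iff_of_pos_left (div_pos hb hi0')]
    exact Nat.cast_le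
  · push Not at h
    obtain ⟨x₀, hx₀⟩ := hP
    have hfin : (P ∩ {y : ℕ × ℕ | a * y.1 + b * y.2 ≤ a * x₀.1 + b * x₀.2}).Finite := by
      refine (Set.finite_Iic (⌊(a * x₀.1 + b * x₀.2) / a⌋₊,
        ⌊(a * x₀.1 + b * x₀.2) / b⌋₊)).subset ?_
      rintro y ⟨-, hy⟩
      have hy' : a * (y.1 : ℝ) + b * y.2 ≤ a * x₀.1 + b * x₀.2 := hy
      have h1 : 0 ≤ a * (y.1 : ℝ) := mul_nonneg ha.le (Nat.cast_nonneg _)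
      have h2 : 0 ≤ b * (y.2 : ℝ) := mul_nonneg hb.le (Nat.cast_nonneg _)
      exact ⟨Nat.le_floor ((le_div_iff₀ ha).2 (by linarith)),
        Nat.le_floor ((le_div_iff₀ hb).2 (by linarith))⟩
    obtain ⟨x, hx, hmin⟩ := Set.exists_min_image _ (fun y : ℕ × ℕ => a * (y.1 : ℝ) + b * y.2) hfin
      ⟨x₀, hx₀, le_refl (a * (x₀.1 : ℝ) + b * x₀.2)⟩
    have hmin' : ∀ y ∈ P, a * (x.1 : ℝ) + b * x.2 ≤ a * y.1 + b * y.2 := by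
      intro y hy
      by_cases hyx : a * (y.1 : ℝ) + b * y.2 ≤ a * x₀.1 + b * x₀.2
      · exact hmin y ⟨hy, hyx⟩
      · have : a * (x.1 : ℝ) + b * x.2 ≤ a * x₀.1 + b * x₀.2 := hx.2
        linarith
    have hlt : ∀ y ∈ P, y ≠ x → a * (x.1 : ℝ) + b * x.2 < a * y.1 + b * y.2 := fun y hy hne =>
      lt_of_le_of_ne (hmin' y hy) (h x hx.1 y hy hne.symm)
    obtain ⟨a', b', ha', hb', hab⟩ := exists_nat_weights_of_unique (P := P) (div_pos hb ha)
      (x := x) fun y hy hne => by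
        have h1 := div_lt_div_of_pos_right (hlt y hy hne) ha
        rw [add_div, add_div, mul_div_cancel_left₀ _ ha.ne', mul_div_cancel_left₀ _ ha.ne',
          mul_div_right_comm, mul_div_right_comm] at h1
        exact h1
    refine ⟨a', b', ha', hb', fun y hy => ⟨fun hy' => ?_, fun hy' => ?_⟩⟩
    · have hyx : y = x := by
        by_contra hne
        exact (hlt y hy hne).not_ge (hy' x hx.1)
      subst hyx
      intro z hz
      by_cases hzy : z = y
      · rw [hzy]
      · exact (hab z hz hzy).le
    · have hyx : y = x := by
        by_contra hne
        exact (hab y hy hne).not_ge (hy' x hx.1)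
      rw [hyx]
      exact hmin'

namespace SpliceDiagram

variable {V : Type*} [Fintype V] {Γ : SpliceDiagram V}

/-! ### The lattice of an edge -/

lemma beyond_iff_of_adj {x e a b : V} (hab : Γ.graph.Adj a b) (hxa : x ≠ a) (hxb : x ≠ b) :
    Γ.Beyond x e a ↔ Γ.Beyond x e b := by
  have key : ∀ {a b : V}, Γ.graph.Adj a b → x ≠ a → x ≠ b → Γ.Beyond x e a → Γ.Beyond x e b := by
    intro a b hab hxa hxb ha
    by_contra hb
    have := mem_support_of_beyond ha hb
    rw [geodesic_adj hab.symm] at this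
    simp [hxa, hxb] at this
  exact ⟨key hab hxa hxb, key hab.symm hxb hxa⟩

variable (Γ) in
/-- For an edge `[u, v]`, the choice at each node of the direction towards the edge and of another
direction. -/
structure EdgeOrientation (u v : V) where
  toward : (x : Γ.Node) → Γ.Star x.1
  base : (x : Γ.Node) → Γ.Star x.1
  base_ne : ∀ x, base x ≠ toward x
  toward_beyond : ∀ x, Γ.Beyond x.1 (toward x) u ∨ Γ.Beyond x.1 (toward x) v
  not_beyond_left : ∀ x e, e ≠ toward x → ¬ Γ.Beyond x.1 e.1 u
  not_beyond_right : ∀ x e, e ≠ toward x → ¬ Γ.Beyond x.1 e.1 v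

lemma nonempty_edgeOrientation {u v : V} (huv : Γ.graph.Adj u v) :
    Nonempty (Γ.EdgeOrientation u v) := by
  have h : ∀ x : Γ.Node, ∃ t : Γ.Star x.1, (Γ.Beyond x.1 t u ∨ Γ.Beyond x.1 t v) ∧
      ∀ e : Γ.Star x.1, e ≠ t → ¬ Γ.Beyond x.1 e.1 u ∧ ¬ Γ.Beyond x.1 e.1 v := by
    intro x
    by_cases hxu : x.1 = u
    · refine ⟨⟨v, hxu ▸ huv⟩, Or.inr (beyond_adj (hxu ▸ huv)), fun e he => ⟨?_, fun h => ?_⟩⟩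
      · rw [← hxu]; exact not_beyond_self _ _
      · exact he (Subtype.ext (h.unique (beyond_adj (hxu ▸ huv))))
    · obtain ⟨t, hxt, ht⟩ := exists_beyond (Γ := Γ) (Ne.symm hxu)
      refine ⟨⟨t, hxt⟩, Or.inl ht, fun e he => ⟨fun h => he (Subtype.ext (h.unique ht)),
        fun h => ?_⟩⟩
      by_cases hxv : x.1 = v
      · rw [← hxv] at h; exact not_beyond_self _ _ h
      · exact he (Subtype.ext (((beyond_iff_of_adj huv hxu hxv).2 h).unique ht))
  choose t ht ht' using h
  choose b hb _ using fun x : Γ.Node => x.exists_star_ne (t x).1 (t x).1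
  exact ⟨⟨t, b, fun x h => hb x (congrArg Subtype.val h), ht, fun x e he => (ht' x e he).1,
    fun x e he => (ht' x e he).2⟩⟩

/-- The pairing of integral vectors. -/
def intPairing (g : Γ.Leaf → ℤ) : (Γ.Leaf →₀ ℤ) →ₗ[ℤ] ℤ := ∑ l, g l • Finsupp.lapply l

lemma intPairing_apply (g : Γ.Leaf → ℤ) (y : Γ.Leaf →₀ ℤ) :
    intPairing g y = ∑ l, g l * y l := by
  simp [intPairing]

/-- This is w_v · m = d_v divided by the common factor `complWeight v e`. -/
lemma IsAdmissible.sum_rho {v : Γ.Node} {e : Γ.Star v.1} {m : Γ.Leaf →₀ ℕ}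
    (hm : Γ.IsAdmissible v e m) : ∑ l : Γ.Leaf, Γ.rho v.1 l * m l = Γ.weight v.1 e := by
  refine Nat.eq_of_mul_eq_mul_left (v.complWeight_pos e.1) ?_
  rw [mul_comm _ (Γ.weight v.1 e), weight_mul_complWeight, ← hm.2, Finset.mul_sum]
  refine Finset.sum_congr rfl fun l _ => ?_
  by_cases hl : m l = 0
  · simp [hl]
  · rw [linking_eq_mul_rho v (hm.beyond hl)]
    ring

open Classical in
lemma isCoprime_weight_complWeight₂ (hΓ : Γ.IsCoprime) (b : Γ.Node) (c : Γ.Star b.1) (a : V) :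
    (Γ.weight b.1 c).Coprime (Γ.complWeight₂ b.1 a c) := by
  refine Nat.Coprime.prod_right fun f _ => ?_
  split_ifs with h
  · exact Nat.coprime_one_right _
  · push Not at h
    exact hΓ b c f fun hcf => h.2 (congrArg Subtype.val hcf.symm)

open Classical in
lemma weight_dvd_complWeight₂ (b : Γ.Node) {c c' : Γ.Star b.1} {a : V} (hca : c.1 ≠ a)
    (hcc' : c ≠ c') : Γ.weight b.1 c ∣ Γ.complWeight₂ b.1 a c' := by
  have h := Finset.dvd_prod_of_mem (fun f : Γ.Star b.1 =>
    if f.1 = a ∨ f.1 = c'.1 then 1 else Γ.weight b.1 f) (Finset.mem_univ c)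
  have hne : ¬ (c.1 = a ∨ c.1 = c'.1) := by
    rintro (h | h)
    exacts [hca h, hcc' (Subtype.ext h)]
  simp only [if_neg hne] at h
  exact h

namespace EdgeOrientation

variable {u v : V} (o : Γ.EdgeOrientation u v) (S : Γ.SpliceTypeSystem)

/-- The index set of the equations of the initial degeneration. -/
abbrev Index : Type _ := Σ x : Γ.Node, {e : Γ.Star x.1 // e ≠ o.base x ∧ e ≠ o.toward x}

open Classical in
instance : Fintype o.Index := inferInstance

/-- The difference of the exponents of a binomial of the initial degeneration. -/
def exponent (j : o.Index) : Γ.Leaf →₀ ℤ :=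
  expCast (S.coweight j.1 j.2.1) - expCast (S.coweight j.1 (o.base j.1))

variable {o S}

lemma sub_mem_span (x : Γ.Node) {e : Γ.Star x.1} (he : e ≠ o.toward x) :
    expCast (S.coweight x e) - expCast (S.coweight x (o.base x)) ∈
      Submodule.span ℤ (Set.range (o.exponent S)) := by
  by_cases heb : e = o.base x
  · rw [heb, sub_self]
    exact zero_mem _
  · exact Submodule.subset_span ⟨⟨x, e, heb, he⟩, rfl⟩

open Classical in
-- This is where coprimality makes the lattice saturated. Split y over the branches at b. The
-- pairing of each part with `rho b` is divisible by the weight of its edge, so subtracting a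
-- multiple of the co-weight of that edge brings the part into the scope of induction. The multiples
-- sum to zero, hence the subtracted terms combine into exponent differences at b. The assumption
-- `ho` says that `toward` points to a throughout the branch.
lemma mem_span_of_rho (hΓ : Γ.IsCoprime) {a b : V} (hab : Γ.graph.Adj a b)
    (ho : ∀ x : Γ.Node, Γ.Beyond a b x.1 → ∀ e, e ≠ o.toward x → ¬ Γ.Beyond x.1 e.1 a)
    (y : Γ.Leaf →₀ ℤ) (hy : ∀ l, y l ≠ 0 → Γ.Beyond a b l)
    (hy0 : ∑ l : Γ.Leaf, (Γ.rho a l : ℤ) * y l = 0) :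
    y ∈ Submodule.span ℤ (Set.range (o.exponent S)) := by
  revert ho y
  refine branch_induction (P := fun a b =>
    (∀ x : Γ.Node, Γ.Beyond a b x.1 → ∀ e, e ≠ o.toward x → ¬ Γ.Beyond x.1 e.1 a) →
    ∀ y : Γ.Leaf →₀ ℤ, (∀ l, y l ≠ 0 → Γ.Beyond a b l) →
    ∑ l : Γ.Leaf, (Γ.rho a l : ℤ) * y l = 0 →
    y ∈ Submodule.span ℤ (Set.range (o.exponent S))) ?_ hab
  intro a b hab ih ho y hy hy0
  rcases node_or_leaf (Γ := Γ) b with hb | hb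
  · let b' : Γ.Node := ⟨b, hb⟩
    have htow : (o.toward b').1 = a := by
      by_contra hne
      exact ho b' (beyond_adj hab) ⟨a, hab.symm⟩ (fun h => hne (congrArg Subtype.val h).symm)
        (beyond_adj hab.symm)
    let T : Finset (Γ.Star b) := Finset.univ.filter fun c => c.1 ≠ a
    have hT : ∀ c, c ∈ T ↔ c.1 ≠ a := fun c => by simp [T]
    have hsplit : ∀ l, y l = ∑ c ∈ T, if Γ.Beyond b c.1 l then y l else 0 := by
      intro l
      by_cases hl : y l = 0
      · simp [hl]
      · obtain ⟨c, hbc, hca, hc⟩ := (hy l hl).eq_or_exists.resolve_left (Leaf.ne_node l b')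
        rw [Finset.sum_eq_single_of_mem (⟨c, hbc⟩ : Γ.Star b) ((hT _).2 hca), if_pos hc]
        intro c' _ hc'
        rw [if_neg]
        exact fun h => hc' (Subtype.ext (h.unique hc))
    let s : Γ.Star b → ℤ := fun c => ∑ l : Γ.Leaf, (Γ.rho b l : ℤ) *
      if Γ.Beyond b c.1 l then y l else 0
    have hs : ∑ c ∈ T, (Γ.complWeight₂ b a c.1 : ℤ) * s c = 0 := by
      rw [← hy0]
      simp only [s, Finset.mul_sum]
      rw [Finset.sum_comm]
      refine Finset.sum_congr rfl fun l _ => ?_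
      conv_rhs => rw [hsplit l, Finset.mul_sum]
      refine Finset.sum_congr rfl fun c hc => ?_
      split_ifs with h
      · rw [rho_step hb hab ((hT c).1 hc) h]
        push_cast
        ring
      · simp
    -- In the relation `hs` every other term contains the weight of c as a factor, while the
    -- coefficient of s_c is prime to it.
    have hdvd : ∀ c ∈ T, (Γ.weight b c : ℤ) ∣ s c := by
      intro c hc
      have h1 : (Γ.weight b c : ℤ) ∣ (Γ.complWeight₂ b a c.1 : ℤ) * s c := by
        rw [← Finset.add_sum_erase T _ hc] at hs
        rw [eq_neg_of_add_eq_zero_left hs, dvd_neg]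
        refine Finset.dvd_sum fun c' hc' => Dvd.dvd.mul_right ?_ _
        exact Int.natCast_dvd_natCast.2 (weight_dvd_complWeight₂ b' ((hT c).1 hc)
          (Finset.ne_of_mem_erase hc').symm)
      exact (Nat.isCoprime_iff_coprime.2
        (isCoprime_weight_complWeight₂ hΓ b' c a)).dvd_of_dvd_mul_left h1
    choose! k hk using hdvd
    -- With s_c equal to k_c times the weight of c, each term of `hs` acquires the same coefficient
    -- `complWeight b a`, which is cancelled.
    have hksum : ∑ c ∈ T, k c = 0 := by
      have h1 : (Γ.complWeight b a : ℤ) * ∑ c ∈ T, k c = 0 := by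
        rw [← hs, Finset.mul_sum]
        refine Finset.sum_congr rfl fun c hc => ?_
        rw [hk c hc, ← weight_mul_complWeight₂ c ((hT c).1 hc)]
        push_cast
        ring
      refine (mul_eq_zero.1 h1).resolve_left ?_
      exact_mod_cast (Node.complWeight_pos b' a).ne'
    let z : Γ.Star b → (Γ.Leaf →₀ ℤ) := fun c =>
      y.filter (fun l : Γ.Leaf => Γ.Beyond b c.1 l.1) - k c • expCast (S.coweight b' c)
    have hz : ∀ c ∈ T, z c ∈ Submodule.span ℤ (Set.range (o.exponent S)) := by
      intro c hc
      have hadm := S.admissible b' c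
      refine ih c.1 c.2 ((hT c).1 hc) (fun x hx e he hxb => ?_) (z c) (fun l hl => ?_) ?_
      · have hxa : Γ.Beyond a b x.1 := hx.trans_adj hab ((hT c).1 hc)
        refine ho x hxa e he ((beyond_iff_of_adj hab ?_ ?_).2 hxb)
        · intro h; rw [h] at hxa; exact not_beyond_self _ _ hxa
        · intro h; rw [h] at hx; exact not_beyond_self _ _ hx
      · by_contra hcon
        refine hl ?_
        have hm : S.coweight b' c l = 0 := by
          by_contra hne
          exact hcon (hadm.beyond hne)
        simp [z, hcon, hm]
      · have h1 : ∑ l : Γ.Leaf, (Γ.rho b l : ℤ) * z c l =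
            s c - k c * ∑ l : Γ.Leaf, (Γ.rho b l : ℤ) * S.coweight b' c l := by
          simp only [s, Finset.mul_sum]
          rw [← Finset.sum_sub_distrib]
          refine Finset.sum_congr rfl fun l _ => ?_
          simp only [z, Finsupp.sub_apply, Finsupp.filter_apply, Finsupp.smul_apply, expCast_apply,
            smul_eq_mul]
          ring
        have h2 : ∑ l : Γ.Leaf, (Γ.rho b l : ℤ) * S.coweight b' c l = Γ.weight b c := by
          exact_mod_cast hadm.sum_rho
        rw [h1, h2, hk c hc]
        ring
    -- The base co-weight may be inserted freely, because the k_c sum to zero.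
    have hysum : y = ∑ c ∈ T, z c + ∑ c ∈ T, k c • (expCast (S.coweight b' c) -
        expCast (S.coweight b' (o.base b'))) := by
      have h1 : ∑ c ∈ T, k c • expCast (S.coweight b' (o.base b')) = 0 := by
        rw [← Finset.sum_smul, hksum, zero_smul]
      simp only [smul_sub, Finset.sum_sub_distrib, h1, z]
      ext l
      simp only [sub_zero, sub_add_cancel, Finsupp.finsetSum_apply, Finsupp.filter_apply]
      exact hsplit l
    rw [hysum]
    refine add_mem (Submodule.sum_mem _ hz) (Submodule.sum_mem _ fun c hc => ?_)
    refine Submodule.smul_mem _ _ (sub_mem_span b' fun h => (hT c).1 hc ?_)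
    rw [h, htow]
  · have hsup : ∀ l, l ≠ (⟨b, hb⟩ : Γ.Leaf) → y l = 0 := fun l hl => by
      by_contra hne
      exact hl (Subtype.ext ((hy l hne).eq_of_leaf hb))
    rw [Finset.sum_eq_single (⟨b, hb⟩ : Γ.Leaf) (fun l _ hl => by rw [hsup l hl, mul_zero])
      (fun h => absurd (Finset.mem_univ _) h), rho_of_leaf hb hab] at hy0
    have : y = 0 := by
      ext l
      by_cases hl : l = ⟨b, hb⟩
      · rw [hl]; simpa using hy0
      · exact hsup l hl
    rw [this]
    exact zero_mem _

end EdgeOrientation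

lemma length_geodesic_lt {u x y : V} (h : y ∈ (Γ.geodesic u x).support) (hne : y ≠ x) :
    (Γ.geodesic u y).length < (Γ.geodesic u x).length := by
  rw [Γ.geodesic_eq_append h, SimpleGraph.Walk.length_append]
  have : (Γ.geodesic y x).length ≠ 0 := fun h0 => hne (SimpleGraph.Walk.eq_of_length_eq_zero h0)
  omega

open Classical in
/-- The part of the weight vector of the node `p` in the direction of `c`. -/
def branchWeight (p : Γ.Node) (c : V) (l : Γ.Leaf) : ℤ :=
  if Γ.Beyond p.1 c l then Γ.linking p.1 l else 0

open Classical in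
-- Seen from p, every leaf in the support of m lies behind x, thus in the direction of x: the
-- pairing sees either the whole of m or nothing.
lemma IsAdmissible.sum_branchWeight {x p : Γ.Node} {e : Γ.Star x.1} {m : Γ.Leaf →₀ ℕ}
    (hm : Γ.IsAdmissible x e m) (hxp : x ≠ p) (hp : ¬ Γ.Beyond x.1 e.1 p.1) (c : V) :
    ∑ l, branchWeight p c l * m l = if Γ.Beyond p.1 c x.1 then (Γ.linking p.1 x.1 : ℤ) else 0 := by
  have h1 : ∀ l, branchWeight p c l * m l =
      if Γ.Beyond p.1 c x.1 then (Γ.vertexWeightNat p.1 l * m l : ℤ) else 0 := by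
    intro l
    by_cases hl : m l = 0
    · simp [hl]
    · have h2 := mem_support_of_beyond (hm.beyond hl) hp
      have h3 := beyond_iff_of_mem_support (e := c) h2 (fun h => hxp (Subtype.ext h))
      simp only [branchWeight, h3, vertexWeightNat_node]
      split_ifs <;> simp
  simp only [h1]
  split_ifs with h
  · rw [← minWeight_node, ← hm.sum_eq hp]
    push_cast
    rfl
  · simp

open Classical in
lemma IsAdmissible.sum_branchWeight_self {x : Γ.Node} {e : Γ.Star x.1} {m : Γ.Leaf →₀ ℕ}
    (hm : Γ.IsAdmissible x e m) (c : V) :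
    ∑ l, branchWeight x c l * m l = if e.1 = c then (Γ.totalWeight x.1 : ℤ) else 0 := by
  have h1 : ∀ l, branchWeight x c l * m l =
      if e.1 = c then ((m l * Γ.linking x.1 l : ℕ) : ℤ) else 0 := by
    intro l
    by_cases hl : m l = 0
    · simp [hl]
    · have h2 := hm.beyond hl
      have h3 : Γ.Beyond x.1 c l ↔ e.1 = c := ⟨fun h => h2.unique h, fun h => h ▸ h2⟩
      simp only [branchWeight, h3]
      split_ifs <;> simp [mul_comm]
  simp only [h1]
  split_ifs with h
  · rw [← hm.2]
    push_cast
    rfl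
  · simp

namespace EdgeOrientation

variable {u : Γ.Node} {v : V} {o : Γ.EdgeOrientation u.1 v} {S : Γ.SpliceTypeSystem}

lemma toward_left (huv : Γ.graph.Adj u.1 v) : (o.toward u).1 = v :=
  ((o.toward_beyond u).resolve_left (not_beyond_self _ _)).unique (beyond_adj huv)

lemma intPairing_exponent (g : Γ.Leaf → ℤ) (j : o.Index) :
    intPairing g (o.exponent S j) = ∑ l, g l * S.coweight j.1 j.2.1 l -
      ∑ l, g l * S.coweight j.1 (o.base j.1) l := by
  rw [exponent, map_sub, intPairing_apply, intPairing_apply]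
  rfl

open Classical in
-- Triangularity by distance from u. The functional `branchWeight x c` takes the value d_x on the
-- exponent (x, c) and vanishes on the other exponents at x. On those of another node it can be
-- non-zero only if that node lies on [u, x] strictly before x, and their coefficients are already
-- known to vanish.
lemma linearIndependent_exponent : LinearIndependent ℤ (o.exponent S) := by
  rw [Fintype.linearIndependent_iff]
  intro g hg
  have key : ∀ n : ℕ, ∀ j : o.Index, (Γ.geodesic u.1 j.1.1).length = n → g j = 0 := by
    intro n
    induction n using Nat.strong_induction_on with
    | _ n ih =>
      rintro ⟨x, c, hcb, hct⟩ hn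
      have h := congrArg (intPairing (branchWeight x c.1)) hg
      rw [map_sum, map_zero] at h
      simp only [map_smul, smul_eq_mul] at h
      rw [Finset.sum_eq_single (⟨x, c, hcb, hct⟩ : o.Index)] at h
      · rw [intPairing_exponent, (S.admissible x c).sum_branchWeight_self, if_pos rfl,
          (S.admissible x _).sum_branchWeight_self,
          if_neg (fun h => hcb (Subtype.ext h.symm)), sub_zero] at h
        refine (mul_eq_zero.1 h).resolve_right ?_
        exact_mod_cast x.totalWeight_pos.ne'
      · rintro ⟨x', e, heb, het⟩ - hne
        by_cases hx : x' = x
        · subst hx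
          rw [intPairing_exponent, (S.admissible x' e).sum_branchWeight_self,
            (S.admissible x' _).sum_branchWeight_self,
            if_neg, if_neg (fun h => hcb (Subtype.ext h.symm)), sub_zero, mul_zero]
          intro h
          have : e = c := Subtype.ext h
          subst this
          exact hne rfl
        · have hsmall : ∀ e' : Γ.Star x'.1, e' ≠ o.toward x' → Γ.Beyond x'.1 e'.1 x.1 →
              g ⟨x', e, heb, het⟩ = 0 := by
            intro e' he' hb
            refine ih _ ?_ ⟨x', e, heb, het⟩ rfl
            rw [← hn]
            exact length_geodesic_lt
              (mem_support_of_beyond hb (o.not_beyond_left x' e' he'))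
              fun h => hx (Subtype.ext h)
          by_cases h1 : Γ.Beyond x'.1 e.1 x.1
          · rw [hsmall e het h1, zero_mul]
          by_cases h2 : Γ.Beyond x'.1 (o.base x').1 x.1
          · rw [hsmall _ (o.base_ne x') h2, zero_mul]
          rw [intPairing_exponent, (S.admissible x' e).sum_branchWeight hx h1,
            (S.admissible x' _).sum_branchWeight hx h2, sub_self, mul_zero]
      · exact fun h => absurd (Finset.mem_univ _) h
  exact fun j => key _ j rfl

open Classical in
-- The two functionals are w_u and its restriction to the v-side of the edge. Vanishing of both
-- means that each half of y is killed by the corresponding `rho`, so that `mem_span_of_rho` applies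
-- on both sides. A description as a kernel makes saturation evident.
lemma mem_span_exponent_iff (hΓ : Γ.IsCoprime) (huv : Γ.graph.Adj u.1 v) (y : Γ.Leaf →₀ ℤ) :
    y ∈ Submodule.span ℤ (Set.range (o.exponent S)) ↔
      intPairing (branchWeight u v) y = 0 ∧ intPairing (fun l => (Γ.linking u.1 l : ℤ)) y = 0 := by
  constructor
  · intro hy
    change y ∈ LinearMap.ker (intPairing (branchWeight u v)) ⊓
      LinearMap.ker (intPairing fun l => (Γ.linking u.1 l : ℤ))
    refine Submodule.span_le.2 ?_ hy
    rintro _ ⟨⟨x, e, heb, het⟩, rfl⟩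
    refine ⟨?_, ?_⟩
    · rw [SetLike.mem_coe, LinearMap.mem_ker, intPairing_exponent]
      by_cases hxu : x = u
      · subst hxu
        rw [(S.admissible x e).sum_branchWeight_self, (S.admissible x _).sum_branchWeight_self,
          if_neg, if_neg, sub_self]
        · exact fun h => o.base_ne x (Subtype.ext (h.trans (toward_left huv).symm))
        · exact fun h => het (Subtype.ext (h.trans (toward_left huv).symm))
      · rw [(S.admissible x e).sum_branchWeight hxu (o.not_beyond_left x e het),
          (S.admissible x _).sum_branchWeight hxu (o.not_beyond_left x _ (o.base_ne x)), sub_self]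
    · rw [SetLike.mem_coe, LinearMap.mem_ker, intPairing_exponent]
      have h1 := (S.admissible x e).sum_eq (o.not_beyond_left x e het)
      have h2 := (S.admissible x _).sum_eq (o.not_beyond_left x _ (o.base_ne x))
      simp only [vertexWeightNat_node] at h1 h2
      rw [sub_eq_zero]
      exact_mod_cast h1.trans h2.symm
  · rintro ⟨h1, h2⟩
    rw [intPairing_apply] at h1 h2
    have h3 : ∑ l : Γ.Leaf, (if Γ.Beyond u.1 v l then 0 else (Γ.linking u.1 l : ℤ)) * y l = 0 := by
      refine Eq.trans ?_ (sub_eq_zero.2 (h2.trans h1.symm))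
      rw [← Finset.sum_sub_distrib]
      refine Finset.sum_congr rfl fun l _ => ?_
      unfold branchWeight
      split_ifs <;> ring
    have hsplit : y = y.filter (fun l : Γ.Leaf => Γ.Beyond u.1 v l.1) +
        y.filter (fun l : Γ.Leaf => ¬ Γ.Beyond u.1 v l.1) :=
      (Finsupp.filter_add_filter_not _ _).symm
    rw [hsplit]
    refine add_mem (mem_span_of_rho hΓ huv (fun x _ e he => o.not_beyond_left x e he) _ ?_ ?_)
      (mem_span_of_rho hΓ huv.symm (fun x _ e he => o.not_beyond_right x e he) _ ?_ ?_)
    · intro l hl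
      by_contra hcon
      exact hl (Finsupp.filter_apply_neg _ _ hcon)
    · have : (Γ.complWeight u.1 v : ℤ) ≠ 0 := by exact_mod_cast (u.complWeight_pos v).ne'
      refine (mul_eq_zero.1 (Eq.trans ?_ h1)).resolve_left this
      rw [Finset.mul_sum]
      refine Finset.sum_congr rfl fun l _ => ?_
      by_cases hl : Γ.Beyond u.1 v l
      · rw [Finsupp.filter_apply, if_pos hl, branchWeight, if_pos hl, linking_eq_mul_rho u hl]
        push_cast
        ring
      · rw [Finsupp.filter_apply, if_neg hl, branchWeight, if_neg hl]
        ring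
    · intro l hl
      by_contra hcon
      exact hl (Finsupp.filter_apply_neg _ _ (not_not.2 ((beyond_iff_not_beyond huv).2 hcon)))
    · have : (Γ.weight u.1 ⟨v, huv⟩ : ℤ) ≠ 0 := by exact_mod_cast (u.weight_pos _).ne'
      refine (mul_eq_zero.1 (Eq.trans ?_ h3)).resolve_left this
      rw [Finset.mul_sum]
      refine Finset.sum_congr rfl fun l _ => ?_
      by_cases hl : Γ.Beyond u.1 v l
      · rw [Finsupp.filter_apply, if_neg (not_not.2 hl), if_pos hl]
        ring
      · rw [Finsupp.filter_apply, if_pos hl, if_neg hl, linking_of_beyond_rev u huv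
          (not_not.1 ((not_congr (beyond_iff_not_beyond huv)).1 hl))]
        push_cast
        ring

lemma mem_span_exponent_of_smul (hΓ : Γ.IsCoprime) (huv : Γ.graph.Adj u.1 v) (k : ℤ)
    (m : Γ.Leaf →₀ ℤ) (hk : k ≠ 0)
    (h : k • m ∈ Submodule.span ℤ (Set.range (o.exponent S))) :
    m ∈ Submodule.span ℤ (Set.range (o.exponent S)) := by
  rw [mem_span_exponent_iff hΓ huv] at h ⊢
  simpa [hk] using h

end EdgeOrientation

end SpliceDiagram

namespace SpliceDiagram

variable {V : Type*} [Fintype V] {Γ : SpliceDiagram V}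

/-! ### The initial ideal in the interior of the cone of an edge -/

lemma Beyond.ne_left {x e y : V} (h : Γ.Beyond x e y) : x ≠ y := by
  rintro rfl
  exact not_beyond_self _ _ h

lemma weightPairing_edge (a b : ℝ) (u v : V) (m : Γ.Leaf →₀ ℕ) :
    weightPairing (a • Γ.vertexWeight u + b • Γ.vertexWeight v) m =
      a * (∑ l, Γ.vertexWeightNat u l * m l : ℕ) + b * (∑ l, Γ.vertexWeightNat v l * m l : ℕ) := by
  simp only [weightPairing, Pi.add_apply, Pi.smul_apply, smul_eq_mul, vertexWeight_eq]
  push_cast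
  rw [Finset.mul_sum, Finset.mul_sum, ← Finset.sum_add_distrib]
  exact Finset.sum_congr rfl fun l _ => by ring

lemma vertexWeight_node_pos (u : Γ.Node) (l : Γ.Leaf) : 0 < Γ.vertexWeight u.1 l := by
  rw [vertexWeight_eq, vertexWeightNat_node]
  exact_mod_cast linking_pos _ _

lemma vertexWeight_nonneg (v : V) (l : Γ.Leaf) : 0 ≤ Γ.vertexWeight v l := by
  rw [vertexWeight_eq]
  exact Nat.cast_nonneg _

lemma edge_pos (u : Γ.Node) (v : V) {a b : ℝ} (ha : 0 < a) (hb : 0 ≤ b) (l : Γ.Leaf) :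
    0 < (a • Γ.vertexWeight u.1 + b • Γ.vertexWeight v) l :=
  add_pos_of_pos_of_nonneg (mul_pos ha (vertexWeight_node_pos u l))
    (mul_nonneg hb (vertexWeight_nonneg v l))

namespace EdgeOrientation

variable {u : Γ.Node} {v : V} (o : Γ.EdgeOrientation u.1 v) (S : Γ.SpliceTypeSystem)

open Classical in
/-- The coefficients of the linear combinations of the series at `x` that eliminate all terms but
three. -/
def dual (x : Γ.Node) : Γ.Star x.1 → Fin (Γ.valency x - 2) → ℂ :=
  (S.exists_dual x (o.base_ne x)).choose

/-- Generators of the ideal of the system that are adapted to the edge. -/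
def series (j : o.Index) : ConvergentSeries Γ.Leaf := S.comb j.1 (o.dual S j.1 j.2.1)

/-- The coefficient of the term in the direction `base` of an adapted generator. -/
def baseCoeff (j : o.Index) : ℂ := S.combCoeff j.1 (o.dual S j.1 j.2.1) (o.base j.1)

lemma baseCoeff_ne_zero (j : o.Index) : o.baseCoeff S j ≠ 0 := by
  classical
  exact (S.exists_dual j.1 (o.base_ne j.1)).choose_spec.2.2 j.2.1 j.2.2.1 j.2.2.2

open Classical in
lemma combCoeff_dual (j : o.Index) {e : Γ.Star j.1.1} (hb : e ≠ o.base j.1)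
    (ht : e ≠ o.toward j.1) :
    S.combCoeff j.1 (o.dual S j.1 j.2.1) e = if e = j.2.1 then 1 else 0 := by
  exact (S.exists_dual j.1 (o.base_ne j.1)).choose_spec.1 e j.2.1 hb ht j.2.2.1 j.2.2.2

/-- The passage to the adapted generators is an invertible linear change at each node; its inverse
is the second property in `exists_dual`. -/
lemma ideal_eq_span_series : S.ideal = Ideal.span (Set.range (o.series S)) := by
  classical
  refine le_antisymm (Ideal.span_le.2 ?_) (Ideal.span_le.2 ?_)
  · rintro _ ⟨x, i, rfl⟩
    have h := (S.exists_dual x (o.base_ne x)).choose_spec.2.1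
    have h1 : S.series x i = ∑ e ∈ Finset.univ.filter (fun e => e ≠ o.base x ∧ e ≠ o.toward x),
        S.coeff x e i • S.comb x (o.dual S x e) := by
      simp only [SpliceTypeSystem.comb, Finset.smul_sum, smul_smul]
      rw [Finset.sum_comm]
      simp only [← Finset.sum_smul, dual, h, ite_smul, one_smul, zero_smul]
      simp
    rw [h1, SetLike.mem_coe]
    refine Ideal.sum_mem _ fun e he => Submodule.smul_of_tower_mem _ _ ?_
    rw [Finset.mem_filter] at he
    exact Ideal.subset_span ⟨⟨x, e, he.2⟩, rfl⟩
  · rintro _ ⟨j, rfl⟩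
    exact S.comb_mem _ _

/-- The binomial part of an adapted generator. -/
def initialBinomial (j : o.Index) : MvPolynomial Γ.Leaf ℂ :=
  MvPolynomial.monomial (S.coweight j.1 j.2.1) 1 +
    MvPolynomial.monomial (S.coweight j.1 (o.base j.1)) (o.baseCoeff S j)

variable {o S}

lemma coweight_mem_support_initialBinomial (j : o.Index) :
    S.coweight j.1 j.2.1 ∈ (o.initialBinomial S j).support := by
  classical
  have hne : S.coweight j.1 (o.base j.1) ≠ S.coweight j.1 j.2.1 :=
    fun h => j.2.2.1 (S.coweight_injective j.1 h).symm
  rw [MvPolynomial.mem_support_iff, initialBinomial, MvPolynomial.coeff_add,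
    MvPolynomial.coeff_monomial, MvPolynomial.coeff_monomial, if_pos rfl, if_neg hne]
  simp

variable {a b : ℝ}

lemma weightPairing_coweight {x : Γ.Node} {e : Γ.Star x.1} (he : e ≠ o.toward x) :
    weightPairing (a • Γ.vertexWeight u.1 + b • Γ.vertexWeight v) (S.coweight x e) =
      a * Γ.minWeight u.1 x.1 + b * Γ.minWeight v x.1 := by
  rw [weightPairing_edge, (S.admissible x e).sum_eq (o.not_beyond_left x e he),
    (S.admissible x e).sum_eq (o.not_beyond_right x e he)]

/-- For x ≠ u the node u itself lies in the direction `toward x`, and strictness comes from w_u. For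
x = u that direction is v, and strictness comes from w_v, whether v is a node or a leaf. -/
lemma lt_weightPairing_coweight_toward (hdet : Γ.EdgeDeterminantCondition)
    (huv : Γ.graph.Adj u.1 v) (ha : 0 < a) (hb : 0 < b) (x : Γ.Node) :
    a * Γ.minWeight u.1 x.1 + b * Γ.minWeight v x.1 <
      weightPairing (a • Γ.vertexWeight u.1 + b • Γ.vertexWeight v)
        (S.coweight x (o.toward x)) := by
  rw [weightPairing_edge]
  have hadm := S.admissible x (o.toward x)
  by_cases hxu : x = u
  · subst hxu
    have h1 : (o.toward x).1 = v := toward_left huv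
    refine add_lt_add_of_le_of_lt
      (mul_le_mul_of_nonneg_left (Nat.cast_le.2 (hadm.le_sum hdet _)) ha.le)
      (mul_lt_mul_of_pos_left (Nat.cast_lt.2 ?_) hb)
    rcases node_or_leaf (Γ := Γ) v with hn | hn
    · exact hadm.lt_sum_of_node hdet (p := ⟨v, hn⟩) (by rw [h1]; exact beyond_adj huv)
    · exact hadm.lt_sum_of_leaf (p := ⟨v, hn⟩) h1
  · refine add_lt_add_of_lt_of_le
      (mul_lt_mul_of_pos_left (Nat.cast_lt.2 (hadm.lt_sum_of_node hdet ?_)) ha)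
      (mul_le_mul_of_nonneg_left (Nat.cast_le.2 (hadm.le_sum hdet _)) hb.le)
    rcases o.toward_beyond x with h | h
    · exact h
    · exact (beyond_iff_of_adj huv (fun h => hxu (Subtype.ext h)) h.ne_left).2 h

/-- Of the three surviving monomials the one towards the edge is heavier; the other two share the
minimal weight for all a, b > 0, so the binomial does not depend on a and b. -/
lemma initialSeries_series (hdet : Γ.EdgeDeterminantCondition) (huv : Γ.graph.Adj u.1 v)
    (ha : 0 < a) (hb : 0 < b) (j : o.Index) :
    initialSeries (a • Γ.vertexWeight u.1 + b • Γ.vertexWeight v)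
      (o.series S j : MvPowerSeries Γ.Leaf ℂ) = (o.initialBinomial S j : MvPowerSeries Γ.Leaf ℂ) := by
  classical
  rw [series, S.initialSeries_comb (K := a * Γ.minWeight u.1 j.1.1 + b * Γ.minWeight v j.1.1)
    {j.2.1, o.base j.1} ?_ ?_ ?_ (e₀ := j.2.1) (by simp) ?_]
  · rw [Finset.sum_pair j.2.2.1, o.combCoeff_dual S j j.2.2.1 j.2.2.2, if_pos rfl, initialBinomial,
      MvPolynomial.coe_add, MvPolynomial.coe_monomial, MvPolynomial.coe_monomial, one_smul,
      ← map_smul, smul_eq_mul, mul_one]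
    rfl
  · intro e he
    rw [Finset.mem_insert, Finset.mem_singleton] at he
    refine weightPairing_coweight (o := o) ?_
    rcases he with rfl | rfl
    exacts [j.2.2.2, o.base_ne _]
  · intro e he hne
    rw [Finset.mem_insert, Finset.mem_singleton, not_or] at he
    have : e = o.toward j.1 := by
      by_contra ht
      rw [o.combCoeff_dual S j he.2 ht, if_neg he.1] at hne
      exact hne rfl
    rw [this]
    exact lt_weightPairing_coweight_toward hdet huv ha hb j.1
  · intro i m hm
    rw [weightPairing_edge]
    exact add_lt_add_of_lt_of_le
      (mul_lt_mul_of_pos_left (Nat.cast_lt.2 (S.lt_sum_of_higher _ i hm u)) ha)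
      (mul_le_mul_of_nonneg_left (Nat.cast_le.2 (S.le_sum_of_higher _ i hm v)) hb.le)
  · rw [o.combCoeff_dual S j j.2.2.1 j.2.2.2, if_pos rfl]
    exact one_ne_zero

end EdgeOrientation

end SpliceDiagram

/-- A Laurent monomial, as a unit. -/
def torusMonomial {M : Type*} [AddCommGroup M] (m : M) : (AddMonoidAlgebra ℂ M)ˣ where
  val := AddMonoidAlgebra.single m 1
  inv := AddMonoidAlgebra.single (-m) 1
  val_inv := by
    rw [AddMonoidAlgebra.single_mul_single, add_neg_cancel, one_mul, AddMonoidAlgebra.one_def]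
  inv_val := by
    rw [AddMonoidAlgebra.single_mul_single, neg_add_cancel, one_mul, AddMonoidAlgebra.one_def]

lemma Ideal.span_range_units_mul {R J : Type*} [CommRing R] (u : J → Rˣ) (B : J → R) :
    Ideal.span (Set.range fun j => u j * B j) = Ideal.span (Set.range B) := by
  refine le_antisymm (Ideal.span_le.2 ?_) (Ideal.span_le.2 ?_)
  · rintro _ ⟨j, rfl⟩
    exact Ideal.mul_mem_left _ _ (Ideal.subset_span ⟨j, rfl⟩)
  · rintro _ ⟨j, rfl⟩
    have h : (u j : R) * B j ∈ Ideal.span (Set.range fun j => u j * B j) :=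
      Ideal.subset_span ⟨j, rfl⟩
    exact ((Ideal.span _).unit_mul_mem_iff_mem (u j).isUnit).1 h

/-! ### The torus initial ideal equals the binomial ideal -/

namespace SpliceDiagram

variable {V : Type*} [Fintype V] {Γ : SpliceDiagram V}

/-- Initial forms with respect to `a w_u + b w_v` can be computed with integral `a` and `b`. -/
lemma exists_nat_initialSeries_eq (u v : V) {a b : ℝ} (ha : 0 < a) (hb : 0 < b)
    {f : MvPowerSeries Γ.Leaf ℂ} (hf : f ≠ 0) : ∃ a' b' : ℕ, 0 < a' ∧ 0 < b' ∧
      initialSeries (a • Γ.vertexWeight u + b • Γ.vertexWeight v) f =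
        initialSeries ((a' : ℝ) • Γ.vertexWeight u + (b' : ℝ) • Γ.vertexWeight v) f := by
  classical
  -- The weight of an exponent is a linear functional of its pair of weights for w_u and w_v, so
  -- only the image of the support in ℕ × ℕ matters.
  let ψ : (Γ.Leaf →₀ ℕ) → ℕ × ℕ := fun m =>
    (∑ l, Γ.vertexWeightNat u l * m l, ∑ l, Γ.vertexWeightNat v l * m l)
  let P : Set (ℕ × ℕ) := ψ '' {m | MvPowerSeries.coeff m f ≠ 0}
  have hP : P.Nonempty := by
    obtain ⟨m, hm⟩ : ∃ m, MvPowerSeries.coeff m f ≠ 0 := by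
      by_contra! hcon
      exact hf (MvPowerSeries.ext hcon)
    exact ⟨_, m, hm, rfl⟩
  obtain ⟨a', b', ha', hb', h⟩ := exists_nat_weights hP ha hb
  refine ⟨a', b', ha', hb', ?_⟩
  ext m
  rw [coeff_initialSeries, coeff_initialSeries]
  by_cases hm : MvPowerSeries.coeff m f = 0
  · simp [hm]
  have h1 := h (ψ m) ⟨m, hm, rfl⟩
  simp only [P, Set.forall_mem_image, Set.mem_ofPred_eq] at h1
  refine if_congr ?_ rfl rfl
  simp only [weightPairing_edge]
  refine Iff.trans h1 (forall₂_congr fun k hk => ?_)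
  simp only [ψ]
  exact_mod_cast Iff.rfl

namespace EdgeOrientation

variable {u : Γ.Node} {v : V} {o : Γ.EdgeOrientation u.1 v} {S : Γ.SpliceTypeSystem} {a b : ℝ}

lemma toTorusRing_initialBinomial (j : o.Index) :
    toTorusRing (o.initialBinomial S j) =
      (torusMonomial (expCast (S.coweight j.1 (o.base j.1))) : TorusRing Γ.Leaf) *
        torusBinomial (o.exponent S j) (-o.baseCoeff S j) := by
  rw [initialBinomial, map_add, toTorusRing_monomial, toTorusRing_monomial, torusBinomial, exponent,
    AddMonoidAlgebra.single_neg, sub_neg_eq_add, mul_add]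
  simp [torusMonomial, AddMonoidAlgebra.single_mul_single]

variable (o S) in
/-- The ideal of the initial degeneration on the torus. -/
def binomialIdeal : Ideal (TorusRing Γ.Leaf) :=
  Ideal.span (Set.range fun j : o.Index => toTorusRing (o.initialBinomial S j))

lemma binomialIdeal_eq : o.binomialIdeal S = Ideal.span (Set.range fun j : o.Index =>
    torusBinomial (o.exponent S j) ((-Units.mk0 _ (o.baseCoeff_ne_zero S j) : ℂˣ) : ℂ)) := by
  simp only [binomialIdeal, toTorusRing_initialBinomial]
  exact Ideal.span_range_units_mul _ _

lemma isPrime_binomialIdeal (hΓ : Γ.IsCoprime) (huv : Γ.graph.Adj u.1 v) :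
    (o.binomialIdeal S).IsPrime := by
  rw [binomialIdeal_eq]
  exact isPrime_span_torusBinomial linearIndependent_exponent
    (fun k m => mem_span_exponent_of_smul hΓ huv k m) _

lemma hasKoszulSyzygies_initialBinomial (hΓ : Γ.IsCoprime) (huv : Γ.graph.Adj u.1 v) :
    HasKoszulSyzygies (fun j : o.Index => toTorusRing (o.initialBinomial S j)) Finset.univ := by
  simp only [toTorusRing_initialBinomial]
  exact (hasKoszulSyzygies_torusBinomial linearIndependent_exponent
    (fun k m => mem_span_exponent_of_smul hΓ huv k m)
    (fun j => -Units.mk0 _ (o.baseCoeff_ne_zero S j)) Finset.univ).units_mul _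

/-- The degeneration argument needs integral weights. For each f the coefficients a and b are
replaced by integers with the same initial form of f; the initial binomials of the generators are
unaffected. -/
lemma torusInitialIdeal_le (hΓ : Γ.IsCoprime) (hdet : Γ.EdgeDeterminantCondition)
    (huv : Γ.graph.Adj u.1 v) (ha : 0 < a) (hb : 0 < b) :
    torusInitialIdeal (a • Γ.vertexWeight u.1 + b • Γ.vertexWeight v) S.ideal ≤
      o.binomialIdeal S := by
  classical
  refine Ideal.span_le.2 ?_
  rintro _ ⟨p, f, hf, hp, rfl⟩
  rw [SetLike.mem_coe]
  by_cases hp0 : p = 0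
  · rw [hp0, map_zero]
    exact zero_mem _
  obtain ⟨m₀, hm₀⟩ := MvPolynomial.support_nonempty.2 hp0
  change (p : MvPowerSeries Γ.Leaf ℂ) = initialSeries _ (f : MvPowerSeries Γ.Leaf ℂ) at hp
  have hm₀' : MvPowerSeries.coeff m₀ (p : MvPowerSeries Γ.Leaf ℂ) ≠ 0 := by
    rw [MvPolynomial.coeff_coe]
    exact MvPolynomial.mem_support_iff.1 hm₀
  have hf0 : (f : MvPowerSeries Γ.Leaf ℂ) ≠ 0 := by
    rintro h
    rw [hp] at hm₀'
    exact coeff_ne_zero_of_initialSeries hm₀' (by rw [h, map_zero])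
  obtain ⟨a', b', ha', hb', hab⟩ := exists_nat_initialSeries_eq u.1 v ha hb hf0
  rw [hab] at hp
  let w' : Γ.Leaf → ℕ := fun l => a' * Γ.vertexWeightNat u.1 l + b' * Γ.vertexWeightNat v l
  have hw' : (a' : ℝ) • Γ.vertexWeight u.1 + (b' : ℝ) • Γ.vertexWeight v =
      fun l => (w' l : ℝ) := by
    ext l
    simp [w', vertexWeight_eq]
  have ha'' : (0 : ℝ) < a' := Nat.cast_pos.2 ha'
  have hb'' : (0 : ℝ) < b' := Nat.cast_pos.2 hb'
  have hpos : ∀ l, (0 : ℝ) < (fun l => (w' l : ℝ)) l := fun l => by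
    rw [← hw']
    exact edge_pos u v ha'' hb''.le l
  have hpos' : ∀ l, 0 < w' l := fun l => Nat.cast_pos.1 (hpos l)
  let α : o.Index → ℕ := fun j => a' * Γ.minWeight u.1 j.1.1 + b' * Γ.minWeight v j.1.1
  have hinit : ∀ j : o.Index, (o.initialBinomial S j : MvPowerSeries Γ.Leaf ℂ) =
      initialSeries (fun l => (w' l : ℝ)) (o.series S j : MvPowerSeries Γ.Leaf ℂ) := fun j => by
    rw [← hw', initialSeries_series hdet huv ha'' hb'']
  have hα : ∀ j : o.Index, weightPairing (fun l => (w' l : ℝ)) (S.coweight j.1 j.2.1) = α j := by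
    intro j
    rw [← hw', weightPairing_coweight j.2.2.2]
    push_cast [α]
    rfl
  have hcomp : ∀ j : o.Index, weightComponent hpos (α j) (o.series S j : MvPowerSeries Γ.Leaf ℂ) =
      toTorusRing (o.initialBinomial S j) := fun j =>
    weightComponent_eq_toTorusRing hpos (hinit j) (coweight_mem_support_initialBinomial j) (hα j)
  have hmain := weightComponent_mem_span hpos' hpos (o.series S) α (fun j m hm => ?_) ?_
    (f := f) (by rwa [← ideal_eq_span_series]) (n := ∑ i, w' i * m₀ i) (fun m hm => ?_)
  · simp only [hcomp] at hmain
    rw [weightComponent_eq_toTorusRing hpos (by rw [hp, hw']) hm₀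
      (weightPairing_natCast w' m₀)] at hmain
    exact hmain
  · have h1 : MvPowerSeries.coeff (S.coweight j.1 j.2.1)
        (initialSeries (fun l => (w' l : ℝ)) (o.series S j : MvPowerSeries Γ.Leaf ℂ)) ≠ 0 := by
      rw [← hinit, MvPolynomial.coeff_coe]
      exact MvPolynomial.mem_support_iff.1 (coweight_mem_support_initialBinomial j)
    have h2 := le_of_coeff_initialSeries_ne_zero h1 hm
    rw [hα, weightPairing_natCast] at h2
    exact_mod_cast h2
  · simp only [hcomp]
    exact hasKoszulSyzygies_initialBinomial hΓ huv
  · rw [hp, hw'] at hm₀'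
    have h2 := le_of_coeff_initialSeries_ne_zero hm₀' hm
    rw [weightPairing_natCast, weightPairing_natCast] at h2
    exact_mod_cast h2

lemma le_torusInitialIdeal (hdet : Γ.EdgeDeterminantCondition)
    (huv : Γ.graph.Adj u.1 v) (ha : 0 < a) (hb : 0 < b) :
    o.binomialIdeal S ≤
      torusInitialIdeal (a • Γ.vertexWeight u.1 + b • Γ.vertexWeight v) S.ideal := by
  refine Ideal.span_le.2 ?_
  rintro _ ⟨j, rfl⟩
  exact Ideal.subset_span ⟨_, o.series S j, S.comb_mem _ _,
    (initialSeries_series hdet huv ha hb j).symm, rfl⟩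

end EdgeOrientation

theorem isPrime_torusInitialIdeal (hΓ : Γ.IsCoprime) (hdet : Γ.EdgeDeterminantCondition)
    (S : Γ.SpliceTypeSystem) {u : Γ.Node} {v : V} (huv : Γ.graph.Adj u.1 v) {a b : ℝ} (ha : 0 < a)
    (hb : 0 < b) :
    (torusInitialIdeal (a • Γ.vertexWeight u.1 + b • Γ.vertexWeight v) S.ideal).IsPrime := by
  obtain ⟨o⟩ := nonempty_edgeOrientation huv
  rw [le_antisymm (EdgeOrientation.torusInitialIdeal_le (o := o) hΓ hdet huv ha hb)
    (EdgeOrientation.le_torusInitialIdeal hdet huv ha hb)]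
  exact EdgeOrientation.isPrime_binomialIdeal hΓ huv

/-- The endpoints of an edge are not both leaves. -/
lemma node_of_adj {u v : V} (huv : Γ.graph.Adj u v) : 1 < Γ.valency u ∨ 1 < Γ.valency v := by
  by_contra! h
  have hu := (node_or_leaf (Γ := Γ) u).resolve_left h.1.not_gt
  have hv := (node_or_leaf (Γ := Γ) v).resolve_left h.2.not_gt
  obtain ⟨x, hx⟩ := Γ.exists_node
  by_cases hxu : Γ.Beyond u v x
  · have := hxu.eq_of_leaf hv
    rw [this] at hx
    exact h.2.not_gt hx
  · have := (not_not.1 ((not_congr (beyond_iff_not_beyond huv)).1 hxu)).eq_of_leaf hu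
    rw [this] at hx
    exact h.1.not_gt hx

theorem mem_positiveLocalTrop_and_tropicalMultiplicity (hΓ : Γ.IsCoprime)
    (hdet : Γ.EdgeDeterminantCondition) (S : Γ.SpliceTypeSystem) {u v : V}
    (huv : Γ.graph.Adj u v) {a b : ℝ} (ha : 0 < a) (hb : 0 < b) :
    a • Γ.vertexWeight u + b • Γ.vertexWeight v ∈ positiveLocalTrop S.ideal ∧
      tropicalMultiplicity S.ideal (a • Γ.vertexWeight u + b • Γ.vertexWeight v) = 1 := by
  have key : ∀ (u : Γ.Node) {v : V} (_ : Γ.graph.Adj u.1 v) {a b : ℝ} (_ : 0 < a) (_ : 0 < b),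
      a • Γ.vertexWeight u.1 + b • Γ.vertexWeight v ∈ positiveLocalTrop S.ideal ∧
      tropicalMultiplicity S.ideal (a • Γ.vertexWeight u.1 + b • Γ.vertexWeight v) = 1 := by
    intro u v huv a b ha hb
    have hprime := isPrime_torusInitialIdeal hΓ hdet S huv ha hb
    have hpos := edge_pos u v ha hb.le
    exact ⟨⟨mem_localTrop_of_torusInitialIdeal_ne_top hpos hprime.ne_top, hpos⟩,
      componentCount_eq_one _⟩
  rcases node_of_adj huv with h | h
  · exact key ⟨u, h⟩ huv ha hb
  · rw [add_comm]
    exact key ⟨v, h⟩ huv.symm hb ha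

end SpliceDiagram

/-! ### Relative interiors of cones -/

section RelInterior

open Topology

variable {σ : Type*} {τ : PointedCone ℝ (σ → ℝ)} {w y : σ → ℝ}

lemma mem_of_mem_relInterior (hw : w ∈ relInterior τ) : w ∈ τ := intrinsicInterior_subset hw

/-- The line through w in the direction y stays in the affine span of the cone, where the relative
interior is open. -/
lemma eventually_add_smul_mem_relInterior (hw : w ∈ relInterior τ) (hy : y ∈ τ) :
    ∀ᶠ ε : ℝ in 𝓝 0, w + ε • y ∈ relInterior τ := by
  obtain ⟨w, hw', rfl⟩ := mem_intrinsicInterior.1 hw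
  have hdir : y ∈ (affineSpan ℝ (τ : Set (σ → ℝ))).direction := by
    have := AffineSubspace.vsub_mem_direction (subset_affineSpan ℝ (τ : Set (σ → ℝ)) hy)
      (subset_affineSpan ℝ (τ : Set (σ → ℝ)) τ.zero_mem)
    simpa using this
  have hmem : ∀ ε : ℝ, (w : σ → ℝ) + ε • y ∈ affineSpan ℝ (τ : Set (σ → ℝ)) := fun ε => by
    rw [add_comm]
    exact AffineSubspace.vadd_mem_of_mem_direction (Submodule.smul_mem _ ε hdir) w.2
  let φ : ℝ → affineSpan ℝ (τ : Set (σ → ℝ)) := fun ε => ⟨(w : σ → ℝ) + ε • y, hmem ε⟩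
  have hφ : Continuous φ := Continuous.subtype_mk (by fun_prop) _
  have hφ0 : φ 0 = w := Subtype.ext (by simp [φ])
  have h := hφ.tendsto 0
  rw [hφ0] at h
  filter_upwards [h (isOpen_interior.mem_nhds hw')] with ε hε
  exact mem_intrinsicInterior.2 ⟨φ ε, hε, rfl⟩

lemma exists_sub_smul_mem (hw : w ∈ relInterior τ) (hy : y ∈ τ) :
    ∃ ε : ℝ, 0 < ε ∧ w - ε • y ∈ τ := by
  have h := eventually_add_smul_mem_relInterior hw hy
  have h' := (continuous_neg.tendsto' (0 : ℝ) 0 neg_zero).eventually h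
  obtain ⟨ε, hε, hpos⟩ := ((h'.filter_mono nhdsWithin_le_nhds).and
    (self_mem_nhdsWithin (s := Set.Ioi (0 : ℝ)))).exists
  refine ⟨ε, hpos, ?_⟩
  rw [sub_eq_add_neg, ← neg_smul]
  exact mem_of_mem_relInterior hε

/-- A cone of dimension at least two has points in its relative interior outside any finite union
of lines. -/
lemma exists_mem_relInterior_not_mem_line {ι : Type*} [Finite ι] (hw : w ∈ relInterior τ)
    (hw0 : w ≠ 0) (hτ : 2 ≤ Module.finrank ℝ (Submodule.span ℝ (τ : Set (σ → ℝ))))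
    (x : ι → σ → ℝ) : ∃ w' ∈ relInterior τ, ∀ (i : ι) (c : ℝ), w' ≠ c • x i := by
  obtain ⟨y, hy, hyw⟩ : ∃ y ∈ τ, y ∉ Submodule.span ℝ {w} := by
    by_contra! hcon
    have h1 := Submodule.finrank_mono (Submodule.span_le.2 hcon)
    have h2 := finrank_span_singleton (K := ℝ) hw0
    omega
  have hbad : (⋃ i, {ε : ℝ | ∃ c : ℝ, w + ε • y = c • x i}).Finite := by
    refine Set.finite_iUnion fun i => Set.Subsingleton.finite ?_
    rintro ε ⟨c, hc⟩ ε' ⟨c', hc'⟩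
    -- Two bad parameters for the same x_i would put w and y both on the line of x_i, contrary to
    -- the choice of y; w ≠ 0 allows division.
    by_contra hne
    have hne' : ε - ε' ≠ 0 := sub_ne_zero.2 hne
    refine hyw (Submodule.mem_span_singleton.2 ?_)
    have h1 : (ε - ε') • y = (c - c') • x i := by
      rw [sub_smul, sub_smul, ← hc, ← hc']
      abel
    have h2 : (ε - ε') • w = (c' * ε - c * ε') • x i := by
      have : (ε - ε') • w = ε • (w + ε' • y) - ε' • (w + ε • y) := by module
      rw [this, hc, hc']
      module
    have h3 : c' * ε - c * ε' ≠ 0 := by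
      intro h0
      rw [h0, zero_smul] at h2
      exact (smul_ne_zero hne' hw0) h2
    refine ⟨(c - c') / (c' * ε - c * ε'), smul_right_injective _ hne' ?_⟩
    simp only
    rw [smul_comm, h2, h1, smul_smul, div_mul_cancel₀ _ h3]
  obtain ⟨ε, hε, hε'⟩ : ∃ ε : ℝ, w + ε • y ∈ relInterior τ ∧
      ε ∉ ⋃ i, {ε : ℝ | ∃ c : ℝ, w + ε • y = c • x i} := by
    by_contra! hcon
    exact (infinite_of_mem_nhds (0 : ℝ) (eventually_add_smul_mem_relInterior hw hy))
      (hbad.subset fun ε hε => hcon ε hε)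
  refine ⟨_, hε, fun i c hc => hε' (Set.mem_iUnion.2 ⟨i, c, hc⟩)⟩

end RelInterior

namespace SpliceDiagram

variable {V : Type*} [Fintype V] {Γ : SpliceDiagram V}

/-- A small multiple of w_u + w_v can be subtracted without leaving the cone; adding it back makes
both coefficients positive. -/
lemma exists_of_mem_relInterior_spliceCone {u v : V} {w : Γ.Leaf → ℝ}
    (hw : w ∈ relInterior (Γ.spliceCone u v)) : ∃ a b : ℝ, 0 < a ∧ 0 < b ∧
      w = a • Γ.vertexWeight u + b • Γ.vertexWeight v := by
  have hy : Γ.vertexWeight u + Γ.vertexWeight v ∈ Γ.spliceCone u v :=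
    add_mem (Submodule.subset_span (by simp)) (Submodule.subset_span (by simp))
  obtain ⟨ε, hε, h⟩ := exists_sub_smul_mem hw hy
  obtain ⟨s, t, hst⟩ := Submodule.mem_span_pair.1 h
  refine ⟨s + ε, t + ε, add_pos_of_nonneg_of_pos s.2 hε, add_pos_of_nonneg_of_pos t.2 hε, ?_⟩
  have hst' : (s : ℝ) • Γ.vertexWeight u + (t : ℝ) • Γ.vertexWeight v =
      w - ε • (Γ.vertexWeight u + Γ.vertexWeight v) := hst
  rw [eq_sub_iff_add_eq] at hst'
  rw [← hst']
  module

/-! ### The dimension of the local tropicalization -/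

/-- Certifies that w_u and w_v are not proportional: the multiples A w_u and D w_v agree at a leaf
on the side of u and differ at a leaf beyond v. -/
lemma exists_lt_and_eq (hdet : Γ.EdgeDeterminantCondition) (u : Γ.Node) {v : V}
    (huv : Γ.graph.Adj u.1 v) : ∃ (A D : ℕ) (l l' : Γ.Leaf), 0 < D ∧
      A * Γ.vertexWeightNat u.1 l < D * Γ.vertexWeightNat v l ∧
      A * Γ.vertexWeightNat u.1 l' = D * Γ.vertexWeightNat v l' := by
  classical
  obtain ⟨e, hev, -⟩ := u.exists_star_ne v v
  obtain ⟨l, hl⟩ := exists_leaf_beyond huv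
  obtain ⟨l', hl'⟩ := exists_leaf_beyond (Γ := Γ) e.2
  have hl'v : ¬ Γ.Beyond u.1 v l' := fun h => hev (hl'.unique h)
  rcases node_or_leaf (Γ := Γ) v with hn | hn
  · lift v to Γ.Node using hn
    refine ⟨Γ.linking v.1 u.1, Γ.totalWeight u.1, l, l', u.totalWeight_pos, ?_, ?_⟩
    · rw [vertexWeightNat_node, vertexWeightNat_node]
      exact linking_mul_linking_lt hdet u v (beyond_adj huv) hl
    · rw [vertexWeightNat_node, vertexWeightNat_node]
      exact (linking_mul_linking u
        (mem_support_geodesic_comm (mem_support_of_beyond (beyond_adj huv) hl'v))).symm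
  · lift v to Γ.Leaf using hn
    refine ⟨0, 1, l, l', one_pos, ?_, ?_⟩
    · rw [vertexWeightNat_leaf, if_pos (Subtype.ext (hl.eq_of_leaf v.2))]
      simp
    · rw [vertexWeightNat_leaf, if_neg]
      · simp
      · rintro rfl
        exact hl'v (beyond_adj huv)

lemma linearIndependent_vertexWeight (hdet : Γ.EdgeDeterminantCondition) (u : Γ.Node) {v : V}
    (huv : Γ.graph.Adj u.1 v) :
    LinearIndependent ℝ ![Γ.vertexWeight u.1, Γ.vertexWeight v] := by
  obtain ⟨A, D, l, l', hD, hlt, heq⟩ := exists_lt_and_eq hdet u huv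
  rw [LinearIndependent.pair_iff]
  intro s t hst
  have h1 : s * Γ.vertexWeight u.1 l + t * Γ.vertexWeight v l = 0 := congrFun hst l
  have h2 : s * Γ.vertexWeight u.1 l' + t * Γ.vertexWeight v l' = 0 := congrFun hst l'
  have hlt' : (A : ℝ) * Γ.vertexWeight u.1 l < D * Γ.vertexWeight v l := by
    simp only [vertexWeight_eq]
    exact_mod_cast hlt
  have heq' : (A : ℝ) * Γ.vertexWeight u.1 l' = D * Γ.vertexWeight v l' := by
    simp only [vertexWeight_eq]
    exact_mod_cast heq
  have hD' : (D : ℝ) ≠ 0 := Nat.cast_ne_zero.2 hD.ne'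
  have hu := vertexWeight_node_pos u l'
  have h3 : s * D + t * A = 0 := by
    refine (mul_eq_zero.1 ?_).resolve_right hu.ne'
    linear_combination D * h2 + t * heq'
  have ht : t = 0 := by
    refine (mul_eq_zero.1 ?_).resolve_right (sub_pos.2 hlt').ne'
    linear_combination D * h1 - Γ.vertexWeight u.1 l * h3
  rw [ht, zero_mul, add_zero] at h3
  exact ⟨(mul_eq_zero.1 h3).resolve_right hD', ht⟩

lemma exists_node_adj : ∃ (u : Γ.Node) (v : V), Γ.graph.Adj u.1 v := by
  obtain ⟨u, hu⟩ := Γ.exists_node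
  obtain ⟨e, -⟩ := Node.exists_star_ne (Γ := Γ) ⟨u, hu⟩ u u
  exact ⟨⟨u, hu⟩, e.1, e.2⟩

/-- All maximal cones have the dimension of the germ, so it suffices to find one that spans a plane
or more. Its value need not be computed. -/
theorem two_le_finrank_of_maximal (hΓ : Γ.IsCoprime) (hdet : Γ.EdgeDeterminantCondition)
    (S : Γ.SpliceTypeSystem) {F : Set (PointedCone ℝ (Γ.Leaf → ℝ))}
    (hF : IsTropicalizingFan S.ideal F) {τ : PointedCone ℝ (Γ.Leaf → ℝ)}
    (hτ : Maximal (· ∈ F) τ) :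
    2 ≤ Module.finrank ℝ (Submodule.span ℝ (τ : Set (Γ.Leaf → ℝ))) := by
  obtain ⟨u, v, huv⟩ := Γ.exists_node_adj
  -- Infinitely many tropical points in the interior of one splice cone. Two of them fall into the
  -- same cone of the finite fan, and together they span w_u and w_v.
  let p : ℕ → Γ.Leaf → ℝ := fun k => (1 : ℝ) • Γ.vertexWeight u.1 + (k + 1 : ℝ) • Γ.vertexWeight v
  have hp : ∀ k, ∃ τ' ∈ F, p k ∈ τ' := by
    intro k
    have h1 := (mem_positiveLocalTrop_and_tropicalMultiplicity hΓ hdet S huv one_pos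
      (by positivity : (0 : ℝ) < k + 1)).1.1
    rw [← hF.support_eq] at h1
    simpa [p] using h1
  choose T hTF hT using hp
  obtain ⟨k, -, k', -, hkk', hTk⟩ := Set.infinite_univ.exists_ne_map_eq_of_mapsTo
    (f := T) (fun k _ => hTF k) hF.isFan.finite
  obtain ⟨τ', hle, hmax⟩ := hF.isFan.finite.exists_le_maximal (hTF k)
  have hdim := (hF.dim_eq τ hτ).trans (hF.dim_eq τ' hmax).symm
  have hdim' : Module.finrank ℝ (Submodule.span ℝ (τ : Set (Γ.Leaf → ℝ))) =
      Module.finrank ℝ (Submodule.span ℝ (τ' : Set (Γ.Leaf → ℝ))) := by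
    exact_mod_cast hdim
  rw [hdim']
  have hk : p k ∈ Submodule.span ℝ (τ' : Set (Γ.Leaf → ℝ)) := Submodule.subset_span (hle (hT k))
  have hk' : p k' ∈ Submodule.span ℝ (τ' : Set (Γ.Leaf → ℝ)) :=
    Submodule.subset_span (hle (hTk ▸ hT k'))
  have hne : (k : ℝ) - k' ≠ 0 := sub_ne_zero.2 (Nat.cast_injective.ne hkk')
  have hv : Γ.vertexWeight v ∈ Submodule.span ℝ (τ' : Set (Γ.Leaf → ℝ)) := by
    refine (Submodule.smul_mem_iff _ hne).1 ?_
    convert Submodule.sub_mem _ hk hk' using 1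
    simp only [p]
    module
  have hu : Γ.vertexWeight u.1 ∈ Submodule.span ℝ (τ' : Set (Γ.Leaf → ℝ)) := by
    convert Submodule.sub_mem _ hk (Submodule.smul_mem _ (k + 1 : ℝ) hv) using 1
    simp only [p]
    module
  have hcard := finrank_span_eq_card (linearIndependent_vertexWeight hdet u huv)
  rw [Fintype.card_fin] at hcard
  refine hcard.ge.trans (Submodule.finrank_mono (Submodule.span_le.2 ?_))
  rintro _ ⟨i, rfl⟩
  fin_cases i
  exacts [hu, hv]

/-- The multiplicity is transported within the relative interior of τ to a point that is interior to
a splice cone. -/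
theorem tropicalMultiplicity_of_maximal (hΓ : Γ.IsCoprime) (hdet : Γ.EdgeDeterminantCondition)
    (S : Γ.SpliceTypeSystem) {F : Set (PointedCone ℝ (Γ.Leaf → ℝ))}
    (hF : IsTropicalizingFan S.ideal F) {τ : PointedCone ℝ (Γ.Leaf → ℝ)}
    (hτ : Maximal (· ∈ F) τ) {w : Γ.Leaf → ℝ} (hw : w ∈ relInterior τ) :
    tropicalMultiplicity S.ideal w = 1 := by
  have htrop : ∀ x ∈ τ, x ∈ localTrop S.ideal := fun x hx => by
    rw [← hF.support_eq]
    exact Set.mem_biUnion hτ.prop hx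
  -- A small multiple of a positive vector of τ can be subtracted from x inside the non-negative
  -- orthant.
  have hpos : ∀ x ∈ relInterior τ, ∀ l, 0 < x l := by
    intro x hx l
    obtain ⟨p, hp, hp'⟩ := hF.meets_positive τ hτ
    obtain ⟨ε, hε, h⟩ := exists_sub_smul_mem hx hp
    have h1 : 0 ≤ x l - ε * p l := (htrop _ h).1 l
    have h2 := mul_pos hε (hp' l)
    linarith
  have hw0 : w ≠ 0 := by
    obtain ⟨u, v, huv⟩ := Γ.exists_node_adj
    obtain ⟨l, -⟩ := exists_leaf_beyond huv
    intro h
    exact (hpos w hw l).ne' (congrFun h l)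
  obtain ⟨w', hw', hline⟩ := exists_mem_relInterior_not_mem_line hw hw0
    (two_le_finrank_of_maximal hΓ hdet S hF hτ) Γ.vertexWeight
  obtain ⟨u, v, s, t, huv, hs, ht, hst⟩ := S.exists_mem_spliceCone hdet
    ⟨htrop w' (mem_of_mem_relInterior hw'), hpos w' hw'⟩
  -- A vanishing coefficient would put w' on the line of a vertex vector.
  have hs' : 0 < s := hs.lt_of_ne fun h => hline v t (by rw [hst, ← h, zero_smul, zero_add])
  have ht' : 0 < t := ht.lt_of_ne fun h => hline u s (by rw [hst, ← h, zero_smul, add_zero])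
  have hone := (mem_positiveLocalTrop_and_tropicalMultiplicity hΓ hdet S huv hs' ht').2
  rw [← hst] at hone
  have heq := hF.initialIdeal_eq τ hτ.prop w hw w' hw'
  have hideal : torusInitialIdeal w S.ideal = torusInitialIdeal w' S.ideal :=
    le_antisymm (torusInitialIdeal_le_of_initialIdeal_eq (hpos w' hw') heq)
      (torusInitialIdeal_le_of_initialIdeal_eq (hpos w hw) heq.symm)
  unfold tropicalMultiplicity at hone ⊢
  rwa [hideal]

end SpliceDiagram

theorem mainTheorem7 {V : Type*} [Fintype V] (Γ : SpliceDiagram V) (hΓ : Γ.IsCoprime) :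
    (∀ v : Γ.Node, IsPrimitiveVector (Γ.nodeWeight v)) ∧
    (Γ.EdgeDeterminantCondition → Γ.SemigroupCondition → ∀ S : Γ.SpliceTypeSystem,
      (∀ F : Set (PointedCone ℝ (Γ.Leaf → ℝ)), IsTropicalizingFan S.ideal F →
        ∀ τ, Maximal (· ∈ F) τ → ∀ w ∈ relInterior τ, tropicalMultiplicity S.ideal w = 1) ∧
      (∀ u v : V, Γ.graph.Adj u v → ∀ w ∈ relInterior (Γ.spliceCone u v),
        w ∈ positiveLocalTrop S.ideal ∧ tropicalMultiplicity S.ideal w = 1)) := by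
  refine ⟨SpliceDiagram.isPrimitiveVector_nodeWeight hΓ, fun hdet _ S => ⟨fun F hF τ hτ w hw =>
    SpliceDiagram.tropicalMultiplicity_of_maximal hΓ hdet S hF hτ hw, fun u v huv w hw => ?_⟩⟩
  obtain ⟨a, b, ha, hb, rfl⟩ := SpliceDiagram.exists_of_mem_relInterior_spliceCone hw
  exact SpliceDiagram.mem_positiveLocalTrop_and_tropicalMultiplicity hΓ hdet S huv ha hb

end
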